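/- An \emph{LDP-polygon} is a convex polygon $\mathcal{A}$ in the plane that contains the origin as an interior point and all of whose vertices are primitive vectors of $\mathbb{Z}^2$. For an integer $k \ge 1$ it is \emph{almost $k$-hollow} if $\mathcal{A}^\circ \cap k\mathbb{Z}^2 = \{(0,0)\}$. Two polygons are \emph{unimodularly equivalent} if an integral $2\times 2$ matrix of determinant $\pm 1$ maps one onto the other. Volumes are Euclidean areas, and numbers of polygons are numbers of unimodular equivalence classes. \textbf{Theorem 4.10.} \begin{itemize} \item[$k=1$:] There are, up to unimodular equivalence, exactly $16$ almost $1$-hollow LDP-polygons. The almost $1$-hollow LDP-polygons are precisely the reflexive polygons, i.e. the lattice polygons with the origin in the interior whose polar dual $\{y : \langle x,y\rangle \ge -1 \text{ for all } x \in \mathcal{A}\}$ is a lattice polygon as well. The maximum number of vertices is $6$ and the maximum volume is $\frac{9}{2}$. By number of vertices: \[ \begin{array}{l|cccc} \text{vertices} & 3 & 4 & 5 & 6\\ \hline \text{number} & 5 & 7 & 3 & 1\\ \text{max. vol.} & \frac92 & 4 & \frac72 & 3 \end{array} \] \item[$k=2$:] There are, up to unimodular equivalence, exactly $505$ almost $2$-hollow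 LDP-polygons. The maximum number of vertices is $8$, realized by exactly one polygon up to unimodular equivalence, and the maximum volume is $17$. By number of vertices: \[ \begin{array}{l|cccccc} \text{vertices} & 3 & 4 & 5 & 6 & 7 & 8\\ \hline \text{number} & 42 & 181 & 202 & 74 & 5 & 1\\ \text{max. vol.} & 16 & 16 & 17 & \frac{33}{2} & 14 & 14 \end{array} \] \item[$k=3$:] There are, up to unimodular equivalence, exactly $48032$ almost $3$-hollow LDP-polygons. The maximum number of vertices is $12$, realized by exactly one polygon up to unimodular equivalence, and the maximum volume is $47$. By number of vertices: \[ \begin{array}{l|cccccccccc} \text{vertices} & 3 & 4 & 5 & 6 & 7 & 8 & 9 & 10 & 11 & 12\\ \hline \text{number} & 355 & 3983 & 13454 & 17791 & 9653 & 2465 & 292 & 37 & 1 & 1\\ \text{max. vol.} & 44 & \frac{91}{2} & 47 & 43 & 39 & 35 & 30 & 29 & \frac{47}{2} & 24 \end{array} \] \end{itemize} -/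

import Mathlib

open scoped Matrix

namespace LDP

/-- The plane `ℝ²`; its `volume` is Lebesgue measure (Euclidean area). -/
abbrev Plane : Type := Fin 2 → ℝ

/-- The lattice point `(a, b) ∈ ℤ²` as a point of the plane. -/
def latticePoint (a b : ℤ) : Plane := ![(a : ℝ), (b : ℝ)]

/-- A convex polytope: the convex hull of finitely many points. -/
def IsPolytope (A : Set Plane) : Prop :=
  ∃ S : Set Plane, S.Finite ∧ A = convexHull ℝ S

/-- The vertices of a polytope are its extreme points. -/
def vertices (A : Set Plane) : Set Plane := A.extremePoints ℝ

/-- A lattice polytope: a polytope all of whose vertices are integral. -/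
def IsLatticePolytope (A : Set Plane) : Prop :=
  IsPolytope A ∧ ∀ v ∈ vertices A, ∃ a b : ℤ, v = latticePoint a b

/-- A primitive vector of `ℤ²`: an integral vector with coprime coordinates. -/
def IsPrimitiveVector (v : Plane) : Prop :=
  ∃ a b : ℤ, IsCoprime a b ∧ v = latticePoint a b

/-- An LDP-polygon: a convex polytope in the plane with the origin as an interior point, all of
whose vertices are primitive vectors of `ℤ²`. -/
structure IsLDPPolygon (A : Set Plane) : Prop where
  isPolytope : IsPolytope A
  zero_mem_interior : (0 : Plane) ∈ interior A
  primitive_vertices : ∀ v ∈ vertices A, IsPrimitiveVector v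

/-- `A` is almost `k`-hollow if the origin is the only point of `kℤ²` in the interior of `A`. -/
def IsAlmostHollow (k : ℕ) (A : Set Plane) : Prop :=
  interior A ∩ {x | ∃ a b : ℤ, x = (k : ℝ) • latticePoint a b} = {0}

/-- The polar dual `{y | ⟨x, y⟩ ≥ -1 for all x ∈ A}`. -/
def polarDual (A : Set Plane) : Set Plane := {y | ∀ x ∈ A, -1 ≤ x ⬝ᵥ y}

/-- A reflexive polygon: a lattice polygon with the origin in its interior whose polar dual is a
lattice polygon as well. -/
def IsReflexive (A : Set Plane) : Prop :=
  IsLatticePolytope A ∧ (0 : Plane) ∈ interior A ∧ IsLatticePolytope (polarDual A)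

/-- The linear action of an integral matrix on the plane. -/
def matAct (U : Matrix (Fin 2) (Fin 2) ℤ) (x : Plane) : Plane :=
  U.map (Int.cast : ℤ → ℝ) *ᵥ x

/-- Unimodular equivalence: `B` is the image of `A` under an integral matrix of determinant
`1` or `-1`. -/
def UnimodEquiv (A B : Set Plane) : Prop :=
  ∃ U : Matrix (Fin 2) (Fin 2) ℤ, (U.det = 1 ∨ U.det = -1) ∧ matAct U '' A = B

theorem matAct_one : matAct 1 = id := by
  funext x
  simp [matAct]

theorem matAct_mul (U V : Matrix (Fin 2) (Fin 2) ℤ) : matAct (U * V) = matAct U ∘ matAct V := by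
  funext x
  have h : (U * V).map (Int.cast : ℤ → ℝ) = U.map Int.cast * V.map Int.cast :=
    Matrix.map_mul (f := Int.castRingHom ℝ)
  simp only [matAct, Function.comp_apply, h, Matrix.mulVec_mulVec]

theorem unimodEquiv_equivalence : Equivalence UnimodEquiv where
  refl A := ⟨1, by simp, by simp [matAct_one]⟩
  symm := by
    rintro A B ⟨U, hU, rfl⟩
    have hu : IsUnit U.det := Int.isUnit_iff.mpr hU
    refine ⟨U⁻¹, ?_, ?_⟩
    · have h : IsUnit (U⁻¹).det := Matrix.isUnit_nonsing_inv_det U hu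
      exact Int.isUnit_iff.mp h
    · rw [← Set.image_comp, ← matAct_mul, Matrix.nonsing_inv_mul U hu, matAct_one, Set.image_id]
  trans := by
    rintro A B C ⟨U, hU, rfl⟩ ⟨V, hV, rfl⟩
    refine ⟨V * U, ?_, ?_⟩
    · rw [Matrix.det_mul]
      rcases hU with h | h <;> rcases hV with h' | h' <;> simp [h, h']
    · rw [matAct_mul, Set.image_comp]

/-- Unimodular equivalence as an equivalence relation. -/
def unimodSetoid : Setoid (Set Plane) := ⟨UnimodEquiv, unimodEquiv_equivalence⟩

/-- The number of unimodular equivalence classes met by a family of subsets of the plane. -/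
noncomputable def classCount (F : Set (Set Plane)) : ℕ∞ :=
  ((Quotient.mk unimodSetoid) '' F).encard

/-- The almost `k`-hollow LDP-polygons. -/
def hollowLDP (k : ℕ) : Set (Set Plane) := {A | IsLDPPolygon A ∧ IsAlmostHollow k A}

/-- The almost `k`-hollow LDP-polygons with exactly `n` vertices. -/
def hollowLDPWith (k n : ℕ) : Set (Set Plane) := {A ∈ hollowLDP k | (vertices A).encard = n}

/-- The maximum number of vertices of the polygons of the family `F` is `n`. -/
def MaxVertices (F : Set (Set Plane)) (n : ℕ) : Prop :=
  IsGreatest ((fun A => (vertices A).encard) '' F) (n : ℕ∞)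

/-- The maximum area of the polygons of the family `F` is `V`. -/
def MaxVolume (F : Set (Set Plane)) (V : ENNReal) : Prop :=
  IsGreatest ((fun A => MeasureTheory.volume A) '' F) V

/-- A column of the table: up to unimodular equivalence there are exactly `N` almost `k`-hollow
LDP-polygons with `n` vertices, and the maximum of their areas is `V`. -/
def TableColumn (k n N : ℕ) (V : ENNReal) : Prop :=
  classCount (hollowLDPWith k n) = N ∧ MaxVolume (hollowLDPWith k n) V

end LDP

/-! A verified search lists exactly one representative of every equivalence class. The mathematics
consists in making this search finite, complete and free of repetitions.

Encoding. A polygon is given by the counterclockwise cyclic list of its vertices. Convexity is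
positivity of `orient` on all triples; the origin is interior exactly when every edge has positive
determinant. The cones over the edges cover the plane, so almost hollowness splits into the
condition `Hollow` for each edge. Thus the polygons in question are the hulls of the lists with
`IsCycle` (`exists_isCycle`, `hull_mem_hollowLDP`), and `volume_hull` gives their areas.

Canonical forms. A flag is a choice of starting edge on the polygon or on its mirror image. Its
`key` consists of the determinant and the residue of the edge, followed by the coordinates, in the
basis formed by the edge, of the whole vertex list packed into one vector. The key is invariant
under matrices of determinant one. A list is canonical if it starts with `(1, 0)`, `(a, d)`, `0 ≤ a
< d`, and has the greatest key among its flags. Every class contains a canonical list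
(`exists_canon`), and only one (`canon_unique`), because the first edge and the key determine the
packed vector. The table entries are therefore statistics of the set of canonical lists.

Finiteness. By `cross_le` the determinant of two vertices is at most `2k²(k+1)`, that is 4, 24 and
72. If the determinant of `v`, `w` is large, Dirichlet approximation and hollowness produce a
lattice vector `g` whose determinants with `v` and `w` lie between 1 and `k`
(`exists_short_direction`). A vertex `z` on the other side of the line through `g` then satisfies
two hollowness inequalities, which the Plücker relation combines to the bound.

Search. By `canon_iff_good`, canonicity of a list is a chain of conditions on consecutive vertices,
apart from a comparison of flags whose edge type ties with that of the first edge. Convexity can be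
tested while the list grows, by three orientations for each new vertex (`triple_concat`). The
program `Prog.runs` performs the corresponding depth first search on natural numbers. By
`Params.exists_dfs` and `Setup.exists_runs` its result is the sum of the weights of all canonical
lists, each counted once, unless an overflow mark appears. The weights are numbers in base 65536
whose digits count polygons, polygons with `n` vertices, and those among the latter that attain a
prescribed maximal area; `reading` recovers these counts. The sums themselves are evaluated by the
kernel.

Reflexivity. For `k = 1` the few possible edge types all have lattice distance one from the origin,
so the polar dual is the hull of the integral edge normals. Conversely, integrality of the vertices
of the dual excludes nonzero interior lattice points, and then every vertex is primitive. -/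

namespace LDP

/-! ### Lattice points and cyclic lists -/

/-- Lattice points of the plane. -/
abbrev Pt : Type := ℤ × ℤ

/-- The determinant of two lattice vectors. -/
def cross (p q : Pt) : ℤ := p.1 * q.2 - p.2 * q.1

/-- Twice the signed area of a lattice triangle. -/
def orient (p q r : Pt) : ℤ := cross p q + cross q r + cross r p

/-- The half-open triangle `0, p, q` has no nonzero point of `kℤ²` off its edge `pq`. -/
def Hollow (k : ℕ) (p q : Pt) : Prop :=
  ∀ z : Pt, 0 ≤ cross p z → 0 ≤ cross z q → k * (cross p z + cross z q) < cross p q → z = 0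

/-- `(p, q)` is an edge of the cyclic list `L`. -/
def Edge (L : List Pt) (p q : Pt) : Prop := ∃ l, L ~r p :: q :: l

/-- `L` lists counterclockwise the vertices of an almost `k`-hollow LDP-polygon. -/
structure IsCycle (k : ℕ) (L : List Pt) : Prop where
  three : 3 ≤ L.length
  triple : L.Triplewise fun a b c => 0 < orient a b c
  pos : ∀ p q, Edge L p q → 0 < cross p q
  hollow : ∀ p q, Edge L p q → Hollow k p q
  prim : ∀ p ∈ L, IsCoprime p.1 p.2

theorem orient_rot (p q r : Pt) : orient q r p = orient p q r := by unfold orient; ring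

theorem rotate_invariant {α : Type*} {P : List α → Prop} (h : ∀ a l, P (a :: l) → P (l ++ [a]))
    {L L' : List α} (hr : L ~r L') (hL : P L) : P L' := by
  obtain ⟨n, rfl⟩ := hr
  induction n with
  | zero => simpa using hL
  | succ n ih =>
    rw [← List.rotate_rotate]
    cases hl : L.rotate n with
    | nil => simpa [hl] using ih
    | cons a l => rw [hl] at ih; simpa using h a l ih

theorem triple_isRotated {L L' : List Pt} (hr : L ~r L')
    (h : L.Triplewise fun a b c => 0 < orient a b c) :
    L'.Triplewise fun a b c => 0 < orient a b c := by
  refine rotate_invariant (P := fun L => L.Triplewise fun a b c => 0 < orient a b c) ?_ hr h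
  intro a l h
  rw [List.triplewise_cons] at h
  rw [List.triplewise_append]
  refine ⟨h.2, by simp, by simp, ?_⟩
  simpa [orient_rot] using h.1

theorem Edge.isRotated {L L' : List Pt} (hr : L ~r L') {p q : Pt} (h : Edge L p q) :
    Edge L' p q := by
  obtain ⟨l, hl⟩ := h
  exact ⟨l, hr.symm.trans hl⟩

theorem Edge.left_mem {L : List Pt} {p q : Pt} (h : Edge L p q) : p ∈ L := by
  obtain ⟨l, hl⟩ := h; exact hl.mem_iff.2 (by simp)

theorem Edge.right_mem {L : List Pt} {p q : Pt} (h : Edge L p q) : q ∈ L := by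
  obtain ⟨l, hl⟩ := h; exact hl.mem_iff.2 (by simp)

/-- Edges are defined by rotations, which makes them rotation invariant; the closed chain is the
form that can be computed with. The list `[a]` is excluded because none of its rotations has two
entries, while the chain `a, a` has a link. -/
theorem edge_cons_iff {a : Pt} {l : List Pt} (hl : l ≠ []) {R : Pt → Pt → Prop} :
    (∀ p q, Edge (a :: l) p q → R p q) ↔ List.IsChain R (a :: l ++ [a]) := by
  constructor
  · intro h
    rw [List.isChain_iff_forall_rel_of_append_cons_cons]
    intro p q l₁ l₂ e
    apply h
    rcases List.eq_nil_or_concat l₂ with rfl | ⟨l₂', b, rfl⟩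
    · have e' : a :: l ++ [a] = (l₁ ++ [p]) ++ [q] := by simpa using e
      obtain ⟨e1, e2⟩ := List.append_inj' e' rfl
      obtain rfl : a = q := by simpa using e2
      cases l₁ with
      | nil => simp at e1; exact absurd e1.2 hl
      | cons c l₁ =>
        simp at e1
        obtain ⟨rfl, rfl⟩ := e1
        refine ⟨l₁, ?_⟩
        have := List.isRotated_append (l := a :: l₁) (l' := [p])
        simpa using this
    · have e' : a :: l ++ [a] = (l₁ ++ p :: q :: l₂') ++ [b] := by simpa using e
      obtain ⟨e1, e2⟩ := List.append_inj' e' rfl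
      rw [e1]
      refine ⟨l₂' ++ l₁, ?_⟩
      have := List.isRotated_append (l := l₁) (l' := p :: q :: l₂')
      simpa using this
  · intro h p q ⟨m, hm⟩
    have h1 : Cycle.Chain R ((a :: l : List Pt) : Cycle Pt) := (Cycle.chain_coe_cons R a l).2 h
    rw [Cycle.coe_eq_coe.2 hm, Cycle.chain_coe_cons] at h1
    simp only [List.cons_append] at h1
    exact (List.isChain_cons_cons.1 h1).1

theorem edge_iff_cycleChain {L : List Pt} (hl : 2 ≤ L.length) {R : Pt → Pt → Prop} :
    (∀ p q, Edge L p q → R p q) ↔ Cycle.Chain R (L : Cycle Pt) := by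
  cases L with
  | nil => simp at hl
  | cons a l => 
    rw [Cycle.chain_coe_cons]
    exact edge_cons_iff (by rintro rfl; simp at hl)

/-- A predicate that holds for some, but not for all points changes along some edge. -/
theorem exists_edge_change {L : List Pt} (hl : 2 ≤ L.length) (P : Pt → Prop) {a b : Pt}
    (ha : a ∈ L) (hb : b ∈ L) (hPa : P a) (hPb : ¬ P b) :
    ∃ p q, Edge L p q ∧ P p ∧ ¬ P q := by
  by_contra hc
  push Not at hc
  have h : ∀ p q, Edge L p q → (P p → P q) := hc
  rw [edge_iff_cycleChain hl] at h
  have : IsTrans Pt (fun p q => P p → P q) := ⟨fun _ _ _ h1 h2 h3 => h2 (h1 h3)⟩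
  -- Implication is transitive, so a relation between neighbours spreads to all pairs of the cycle.
  rw [Cycle.chain_iff_pairwise] at h
  exact hPb (h a (by simpa using ha) b (by simpa using hb) hPa)

theorem exists_rotated_of_mem {α : Type*} {L : List α} {a : α} (ha : a ∈ L) : ∃ l, L ~r a :: l := by
  obtain ⟨s, t, rfl⟩ := List.append_of_mem ha
  exact ⟨t ++ s, by simpa using List.isRotated_append (l := s) (l' := a :: t)⟩

theorem exists_two_pred {L : List Pt} (hl : 3 ≤ L.length) {a : Pt} (ha : a ∈ L) :
    ∃ p u l, L ~r p :: u :: a :: l := by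
  obtain ⟨l, hr⟩ := exists_rotated_of_mem ha
  have hlen := hr.perm.length_eq
  rcases List.eq_nil_or_concat l with rfl | ⟨l', u, rfl⟩
  · simp at hlen; omega
  rcases List.eq_nil_or_concat l' with rfl | ⟨l'', p, rfl⟩
  · simp at hlen; omega
  refine ⟨p, u, l'', hr.trans ?_⟩
  simpa using List.isRotated_append (l := a :: l'') (l' := [p, u])

theorem exists_edge_from {L : List Pt} (hl : 2 ≤ L.length) {a : Pt} (ha : a ∈ L) :
    ∃ b, Edge L a b := by
  obtain ⟨l, hr⟩ := exists_rotated_of_mem ha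
  cases l with
  | nil => have := hr.perm.length_eq; simp at this; omega
  | cons b l => exact ⟨b, l, hr⟩

theorem IsCycle.isRotated {k : ℕ} {L L' : List Pt} (hr : L ~r L') (h : IsCycle k L) :
    IsCycle k L' where
  three := by rw [← hr.perm.length_eq]; exact h.three
  triple := triple_isRotated hr h.triple
  pos p q e := h.pos p q (e.isRotated hr.symm)
  hollow p q e := h.hollow p q (e.isRotated hr.symm)
  prim p hp := h.prim p (hr.mem_iff.2 hp)

/-! ### Convex position and uniqueness of the cyclic order -/

theorem orient_self_left (p q : Pt) : orient p p q = 0 := by unfold orient cross; ring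
theorem orient_self_right (p q : Pt) : orient p q q = 0 := by unfold orient cross; ring
theorem orient_self_mid (p q : Pt) : orient p q p = 0 := by unfold orient cross; ring

/-- All points of a convex cycle lie strictly to the left of an edge. -/
theorem orient_edge_pos {L : List Pt} (h : L.Triplewise fun a b c => 0 < orient a b c)
    {p q r : Pt} (e : Edge L p q) (hr : r ∈ L) (hp : r ≠ p) (hq : r ≠ q) : 0 < orient p q r := by
  obtain ⟨l, hl⟩ := e
  have h' := triple_isRotated hl h
  rw [List.triplewise_cons, List.pairwise_cons] at h'
  have hm : r ∈ p :: q :: l := hl.mem_iff.1 hr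
  simp [hp, hq] at hm
  exact h'.1.1 r hm

theorem orient_edge_nonneg {L : List Pt} (h : L.Triplewise fun a b c => 0 < orient a b c)
    {p q r : Pt} (e : Edge L p q) (hr : r ∈ L) : 0 ≤ orient p q r := by
  by_cases hp : r = p
  · subst hp; rw [orient_self_mid]
  by_cases hq : r = q
  · subst hq; rw [orient_self_right]
  exact (orient_edge_pos h e hr hp hq).le

/-- Three distinct points of a convex cycle are not collinear. -/
theorem triple_nodup {L : List Pt} (hl : 3 ≤ L.length)
    (h : L.Triplewise fun a b c => 0 < orient a b c) : L.Nodup := by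
  rw [List.nodup_iff_pairwise_ne, List.pairwise_iff_getElem]
  intro i j hi hj hij e
  rw [List.triplewise_iff_getElem] at h
  have : (∃ m, m < i) ∨ (∃ m, i < m ∧ m < j) ∨ ∃ m, j < m ∧ m < L.length := by
    by_contra hc
    push Not at hc
    have h1 := hc.1 0
    have h2 := hc.2.1 (i+1)
    have h3 := hc.2.2 (j+1)
    omega
  rcases this with ⟨m, hm⟩ | ⟨m, hm1, hm2⟩ | ⟨m, hm1, hm2⟩
  · have := h m i j hm hij hj
    rw [e, orient_self_right] at this; omega
  · have := h i m j hm1 hm2 hj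
    rw [e, orient_self_mid] at this; omega
  · have := h i j m hij hm1 hm2
    rw [e, orient_self_left] at this; omega

theorem IsCycle.nodup {k : ℕ} {L : List Pt} (h : IsCycle k L) : L.Nodup :=
  triple_nodup h.three h.triple

/-- A convex cycle starting at a given vertex is determined by its set of vertices. -/
theorem triple_unique {a : Pt} {l l' : List Pt} (hl : 3 ≤ (a :: l).length)
    (hl' : 3 ≤ (a :: l').length)
    (h : (a :: l).Triplewise fun a b c => 0 < orient a b c)
    (h' : (a :: l').Triplewise fun a b c => 0 < orient a b c)
    (hm : ∀ x, x ∈ a :: l ↔ x ∈ a :: l') : l = l' := by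
  have n1 := triple_nodup hl h
  have n2 := triple_nodup hl' h'
  have hp : (a :: l).Perm (a :: l') := (List.perm_ext_iff_of_nodup n1 n2).2 hm
  have hp' : l.Perm l' := hp.cons_inv
  -- Both tails are sorted by angle around `a`, and a list sorted by an antisymmetric relation is
  -- determined by its elements.
  refine hp'.eq_of_pairwise (le := fun x y => 0 < orient a x y) ?_ (List.triplewise_cons.1 h).1 (List.triplewise_cons.1 h').1
  intro x y _ _ h1 h2
  have : orient a x y = - orient a y x := by unfold orient cross; ring
  omega

theorem isRotated_of_mem_iff {L L' : List Pt} (hl : 3 ≤ L.length) (hl' : 3 ≤ L'.length)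
    (h : L.Triplewise fun a b c => 0 < orient a b c)
    (h' : L'.Triplewise fun a b c => 0 < orient a b c)
    (hm : ∀ x, x ∈ L ↔ x ∈ L') : L ~r L' := by
  obtain ⟨a, ha⟩ : ∃ a, a ∈ L := List.exists_mem_of_length_pos (by omega)
  obtain ⟨l, r⟩ := exists_rotated_of_mem ha
  obtain ⟨l', r'⟩ := exists_rotated_of_mem ((hm a).1 ha)
  have : l = l' := triple_unique (by rw [← r.perm.length_eq]; exact hl) (by rw [← r'.perm.length_eq]; exact hl')
    (triple_isRotated r h) (triple_isRotated r' h')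
    (fun x => by rw [← r.mem_iff, ← r'.mem_iff]; exact hm x)
  subst this
  exact r.trans r'.symm

/-! ### Unimodular maps -/

/-- The action of an integral matrix on lattice points. -/
def act (U : Matrix (Fin 2) (Fin 2) ℤ) (p : Pt) : Pt :=
  (U 0 0 * p.1 + U 0 1 * p.2, U 1 0 * p.1 + U 1 1 * p.2)

theorem cross_act (U : Matrix (Fin 2) (Fin 2) ℤ) (p q : Pt) :
    cross (act U p) (act U q) = U.det * cross p q := by
  simp [cross, act, Matrix.det_fin_two]; ring

theorem act_mul (U V : Matrix (Fin 2) (Fin 2) ℤ) (p : Pt) : act (U * V) p = act U (act V p) := by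
  simp [act, Matrix.mul_apply, Fin.sum_univ_two]; constructor <;> ring

theorem act_one (p : Pt) : act 1 p = p := by simp [act]

theorem act_inv_act {U : Matrix (Fin 2) (Fin 2) ℤ} (h : U.det = 1) (p : Pt) :
    act U⁻¹ (act U p) = p := by
  rw [← act_mul, Matrix.nonsing_inv_mul U (by simp [h]), act_one]

theorem act_act_inv {U : Matrix (Fin 2) (Fin 2) ℤ} (h : U.det = 1) (p : Pt) :
    act U (act U⁻¹ p) = p := by
  rw [← act_mul, Matrix.mul_nonsing_inv U (by simp [h]), act_one]

theorem det_inv_eq_one {U : Matrix (Fin 2) (Fin 2) ℤ} (h : U.det = 1) : U⁻¹.det = 1 := by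
  simp [Matrix.det_nonsing_inv, h]

theorem cross_act_one {U : Matrix (Fin 2) (Fin 2) ℤ} (h : U.det = 1) (p q : Pt) :
    cross (act U p) (act U q) = cross p q := by rw [cross_act, h, one_mul]

theorem orient_act {U : Matrix (Fin 2) (Fin 2) ℤ} (h : U.det = 1) (p q r : Pt) :
    orient (act U p) (act U q) (act U r) = orient p q r := by
  simp only [orient, cross_act_one h]

theorem Hollow.act {k : ℕ} {U : Matrix (Fin 2) (Fin 2) ℤ} (h : U.det = 1) {p q : Pt}
    (hh : Hollow k p q) : Hollow k (act U p) (act U q) := by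
  intro z h1 h2 h3
  rw [← act_act_inv h z, cross_act_one h] at h1 h2 h3
  rw [cross_act_one h, cross_act_one h] at h3
  have := hh _ h1 h2 h3
  rw [← act_act_inv h z, this]; simp [LDP.act]

theorem Edge.map_iff {f : Pt → Pt} {L : List Pt} {p q : Pt} :
    Edge (L.map f) p q → ∃ p' q', Edge L p' q' ∧ f p' = p ∧ f q' = q := by
  rintro ⟨l, n, hn⟩
  rw [← List.map_rotate] at hn
  rw [List.map_eq_cons_iff] at hn
  obtain ⟨p', m, hm, rfl, hn⟩ := hn
  rw [List.map_eq_cons_iff] at hn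
  obtain ⟨q', m', rfl, rfl, hn⟩ := hn
  exact ⟨p', q', ⟨m', n, hm⟩, rfl, rfl⟩

theorem isCoprime_act {U : Matrix (Fin 2) (Fin 2) ℤ} (h : U.det = 1) {p : Pt}
    (hp : IsCoprime p.1 p.2) : IsCoprime (act U p).1 (act U p).2 := by
  obtain ⟨a, b, hab⟩ := hp
  rw [Matrix.det_fin_two] at h
  refine ⟨a * U 1 1 - b * U 1 0, b * U 0 0 - a * U 0 1, ?_⟩
  simp only [act]
  linear_combination h + (U 0 0 * U 1 1 - U 0 1 * U 1 0) * hab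

theorem IsCycle.map_act {k : ℕ} {L : List Pt} (hL : IsCycle k L) {U : Matrix (Fin 2) (Fin 2) ℤ}
    (h : U.det = 1) : IsCycle k (L.map (act U)) where
  three := by simpa using hL.three
  triple := by
    rw [List.triplewise_map]
    simpa only [orient_act h] using hL.triple
  pos p q e := by
    obtain ⟨p', q', e', rfl, rfl⟩ := Edge.map_iff e
    rw [cross_act_one h]; exact hL.pos _ _ e'
  hollow p q e := by
    obtain ⟨p', q', e', rfl, rfl⟩ := Edge.map_iff e
    exact (hL.hollow _ _ e').act h
  prim p hp := by
    obtain ⟨p', hp', rfl⟩ := List.mem_map.1 hp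
    exact isCoprime_act h (hL.prim _ hp')

/-- The cyclic list of the mirror image under the exchange of the coordinates. -/
def mirror (L : List Pt) : List Pt := (L.map Prod.swap).reverse

theorem cross_swap (p q : Pt) : cross p.swap q.swap = cross q p := by
  simp [cross]; ring

theorem mirror_mirror (L : List Pt) : mirror (mirror L) = L := by
  simp [mirror, List.map_reverse, Function.comp_def]

theorem mirror_isRotated {L L' : List Pt} (h : L ~r L') : mirror L ~r mirror L' :=
  (h.map _).reverse

theorem length_mirror (L : List Pt) : (mirror L).length = L.length := by simp [mirror]

theorem mem_mirror {L : List Pt} {p : Pt} : p ∈ mirror L ↔ p.swap ∈ L := by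
  simp only [mirror, List.mem_reverse, List.mem_map]
  constructor
  · rintro ⟨a, ha, rfl⟩; simpa using ha
  · intro h; exact ⟨_, h, by simp⟩

theorem Edge.mirror {L : List Pt} {p q : Pt} (h : Edge (mirror L) p q) :
    Edge L q.swap p.swap := by
  obtain ⟨l, hl⟩ := h
  have := mirror_isRotated hl
  rw [mirror_mirror] at this
  refine ⟨(l.map Prod.swap).reverse, this.trans ?_⟩
  simpa [LDP.mirror] using List.isRotated_append (l := (l.map Prod.swap).reverse) (l' := [q.swap, p.swap])

/-- The exchange of coordinates reverses orientation, and the reversal of the list restores it. -/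
theorem IsCycle.mirror {k : ℕ} {L : List Pt} (hL : IsCycle k L) : IsCycle k (mirror L) where
  three := by rw [length_mirror]; exact hL.three
  triple := by
    rw [LDP.mirror, List.triplewise_reverse, List.triplewise_map]
    refine hL.triple.imp ?_
    intro a b c h
    simp only [orient, cross_swap] at h ⊢
    linarith
  pos p q e := by
    have := hL.pos _ _ e.mirror
    rwa [cross_swap] at this
  hollow p q e := by
    have := hL.hollow _ _ e.mirror
    intro z h1 h2 h3
    have h := this z.swap (by rwa [cross_swap]) (by rwa [cross_swap])
      (by rw [cross_swap, cross_swap, cross_swap]; linarith)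
    simpa using congrArg Prod.swap h
  prim p hp := (hL.prim _ (mem_mirror.1 hp)).symm

end LDP

namespace LDP
open Set

/-! ### Polygons spanned by cyclic lists -/

/-- A lattice point as a point of the plane. -/
def toP (p : Pt) : Plane := latticePoint p.1 p.2

/-- The polygon spanned by a list of lattice points. -/
def hull (L : List Pt) : Set Plane := convexHull ℝ (toP '' {p | p ∈ L})

/-- The determinant of a lattice vector and a vector. -/
def crossR (p : Pt) (x : Plane) : ℝ := p.1 * x 1 - p.2 * x 0

/-- The affine function vanishing along the line through two lattice points. -/
def orientR (p q : Pt) (x : Plane) : ℝ := (cross p q : ℝ) + crossR q x - crossR p x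

@[simp] theorem toP_zero (p : Pt) : toP p 0 = p.1 := rfl
@[simp] theorem toP_one (p : Pt) : toP p 1 = p.2 := rfl

theorem toP_injective : Function.Injective toP := by
  intro p q h
  have h0 := congrFun h 0
  have h1 := congrFun h 1
  simp at h0 h1
  exact Prod.ext h0 h1

theorem plane_ext {x y : Plane} (h0 : x 0 = y 0) (h1 : x 1 = y 1) : x = y := by
  funext i; fin_cases i <;> assumption

theorem crossR_toP (p q : Pt) : crossR p (toP q) = cross p q := by
  simp [crossR, cross]

theorem orientR_toP (p q r : Pt) : orientR p q (toP r) = orient p q r := by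
  simp [orientR, orient, crossR_toP, cross]; ring

theorem crossR_combo (p : Pt) (x y : Plane) (a b : ℝ) :
    crossR p (a • x + b • y) = a * crossR p x + b * crossR p y := by
  simp [crossR]; ring

theorem orientR_combo (p q : Pt) (x y : Plane) {a b : ℝ} (h : a + b = 1) :
    orientR p q (a • x + b • y) = a * orientR p q x + b * orientR p q y := by
  simp only [orientR, crossR_combo]
  linear_combination - (cross p q : ℝ) * h

theorem continuous_crossR (p : Pt) : Continuous (crossR p) := by
  unfold crossR; fun_prop

theorem continuous_orientR (p q : Pt) : Continuous (orientR p q) := by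
  unfold orientR; have := continuous_crossR p; have := continuous_crossR q; fun_prop

theorem convex_orientR_nonneg (p q : Pt) : Convex ℝ {x | 0 ≤ orientR p q x} := by
  intro x hx y hy a b ha hb hab
  simp only [mem_ofPred_eq] at *
  rw [orientR_combo p q x y hab]; positivity

theorem convex_crossR_nonneg (p : Pt) : Convex ℝ {x | 0 ≤ crossR p x} := by
  intro x hx y hy a b ha hb hab
  simp only [mem_ofPred_eq] at *
  rw [crossR_combo]; positivity

theorem toP_mem_hull {L : List Pt} {p : Pt} (h : p ∈ L) : toP p ∈ hull L :=
  subset_convexHull ℝ _ ⟨p, h, rfl⟩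

theorem convex_hull (L : List Pt) : Convex ℝ (hull L) := convex_convexHull ℝ _

theorem hull_subset {L : List Pt} {s : Set Plane} (hs : Convex ℝ s) (h : ∀ p ∈ L, toP p ∈ s) :
    hull L ⊆ s := by
  refine convexHull_min ?_ hs
  rintro _ ⟨p, hp, rfl⟩; exact h p hp

theorem hull_mono {L L' : List Pt} (h : ∀ p ∈ L, p ∈ L') : hull L ⊆ hull L' :=
  hull_subset (convex_hull _) fun p hp => toP_mem_hull (h p hp)

theorem hull_congr {L L' : List Pt} (h : ∀ p, p ∈ L ↔ p ∈ L') : hull L = hull L' :=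
  (hull_mono fun p hp => (h p).1 hp).antisymm (hull_mono fun p hp => (h p).2 hp)

theorem finite_toP (L : List Pt) : (toP '' {p | p ∈ L}).Finite := (List.finite_toSet L).image _

theorem isClosed_hull (L : List Pt) : IsClosed (hull L) := (finite_toP L).isClosed_convexHull ℝ

/-- An affine function that is nonnegative on a set and not constant is positive in the interior. -/
theorem pos_of_mem_interior {s : Set Plane} {f : Plane → ℝ} {d : Plane} {c : ℝ} (hc : 0 < c)
    (hf : ∀ x t, f (x + t • d) = f x - t * c) (hs : ∀ x ∈ s, 0 ≤ f x) {x : Plane}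
    (hx : x ∈ interior s) : 0 < f x := by
  have hcont : Continuous fun t : ℝ => x + t • d := by fun_prop
  have h0 : (fun t : ℝ => x + t • d) ⁻¹' (interior s) ∈ nhds (0 : ℝ) :=
    (isOpen_interior.preimage hcont).mem_nhds (by simpa using hx)
  obtain ⟨ε, hε, hball⟩ := Metric.mem_nhds_iff.1 h0
  have h1 : ε / 2 ∈ Metric.ball (0 : ℝ) ε := by
    rw [Metric.mem_ball, Real.dist_eq, sub_zero, abs_of_pos (by positivity)]; linarith
  have h2 := hs _ (interior_subset (hball h1))
  rw [hf] at h2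
  have : 0 < ε / 2 * c := by positivity
  linarith

theorem orientR_pos_of_mem_interior {s : Set Plane} {p q : Pt} (hpq : p ≠ q)
    (hs : ∀ x ∈ s, 0 ≤ orientR p q x) {x : Plane} (hx : x ∈ interior s) : 0 < orientR p q x := by
  -- The direction is the outer normal of the line; along it the function decreases at the rate of
  -- the squared length of `q - p`.
  refine pos_of_mem_interior (f := orientR p q)
    (d := ![((q.2 : ℝ) - p.2), (p.1 - q.1 : ℝ)]) (c := ((q.2 : ℝ) - p.2) ^ 2 + (p.1 - q.1 : ℝ) ^ 2) ?_ ?_ hs hx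
  · by_contra hc
    have h1 : ((q.2 : ℝ) - p.2) = 0 := by nlinarith [sq_nonneg ((q.2 : ℝ) - p.2), sq_nonneg (p.1 - q.1 : ℝ)]
    have h2 : (p.1 - q.1 : ℝ) = 0 := by nlinarith [sq_nonneg ((q.2 : ℝ) - p.2), sq_nonneg (p.1 - q.1 : ℝ)]
    refine hpq (Prod.ext ?_ ?_)
    · exact_mod_cast sub_eq_zero.1 h2
    · exact_mod_cast (sub_eq_zero.1 h1).symm
  · intro y t
    simp [orientR, crossR]; ring

theorem crossR_pos_of_mem_interior {s : Set Plane} {p : Pt} (hp : p ≠ 0)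
    (hs : ∀ x ∈ s, 0 ≤ crossR p x) {x : Plane} (hx : x ∈ interior s) : 0 < crossR p x := by
  have h : ∀ x, orientR 0 p x = crossR p x := by intro x; simp [orientR, crossR, cross]
  rw [← h]
  exact orientR_pos_of_mem_interior hp.symm (by simpa only [h] using hs) hx

theorem orientR_nonneg {L : List Pt} (h : L.Triplewise fun a b c => 0 < orient a b c) {p q : Pt}
    (e : Edge L p q) {x : Plane} (hx : x ∈ hull L) : 0 ≤ orientR p q x := by
  refine hull_subset (convex_orientR_nonneg p q) (fun r hr => ?_) hx
  simp only [mem_ofPred_eq, orientR_toP]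
  exact_mod_cast orient_edge_nonneg h e hr

/-- Barycentric coordinates. -/
theorem barycentric {a b c : Pt} (h : 0 < orient a b c) (x : Plane) :
    x = (orientR b c x / orient a b c) • toP a + (orientR c a x / orient a b c) • toP b +
      (orientR a b x / orient a b c) • toP c := by
  have h' : (orient a b c : ℝ) ≠ 0 := by exact_mod_cast h.ne'
  apply plane_ext
  · simp only [Pi.add_apply, Pi.smul_apply, toP_zero, smul_eq_mul]
    field_simp
    simp only [orientR, crossR, orient, cross]; push_cast; ring
  · simp only [Pi.add_apply, Pi.smul_apply, toP_one, smul_eq_mul]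
    field_simp
    simp only [orientR, crossR, orient, cross]; push_cast; ring

theorem orientR_sum (a b c : Pt) (x : Plane) :
    orientR b c x + orientR c a x + orientR a b x = orient a b c := by
  simp only [orientR, crossR, orient, cross]; push_cast; ring

theorem mem_triangle {a b c : Pt} (h : 0 < orient a b c) {x : Plane} (h1 : 0 ≤ orientR a b x)
    (h2 : 0 ≤ orientR b c x) (h3 : 0 ≤ orientR c a x) : x ∈ hull [a, b, c] := by
  have h' : (0 : ℝ) < orient a b c := by exact_mod_cast h
  have hs := (convex_hull [a, b, c]).sum_mem (t := Finset.univ)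
    (w := ![orientR b c x / orient a b c, orientR c a x / orient a b c, orientR a b x / orient a b c])
    (z := ![toP a, toP b, toP c]) ?_ ?_ ?_
  · simp [Fin.sum_univ_three] at hs
    rw [barycentric h x]; simpa using hs
  · intro i _; fin_cases i <;> simp <;> positivity
  · simp only [Fin.sum_univ_three]
    simp only [Matrix.cons_val_zero, Matrix.cons_val_one, Matrix.cons_val]
    rw [← add_div, ← add_div, orientR_sum, div_self h'.ne']
  · intro i _; fin_cases i <;> exact toP_mem_hull (by simp)

theorem orientR_swap (p q : Pt) (x : Plane) : orientR q p x = - orientR p q x := by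
  simp only [orientR, cross]; push_cast; ring

/-- A point on the nonnegative side of all edges lies in the polygon. -/
theorem mem_hull {L : List Pt} (hl : 3 ≤ L.length)
    (h : L.Triplewise fun a b c => 0 < orient a b c) {x : Plane}
    (hx : ∀ p q, Edge L p q → 0 ≤ orientR p q x) : x ∈ hull L := by
  obtain ⟨a, ha⟩ : ∃ a, a ∈ L := List.exists_mem_of_length_pos (by omega)
  by_cases hall : ∀ v ∈ L, 0 ≤ orientR a v x
  -- If no diagonal from `a` has `x` strictly on its right, then `x` lies in the last triangle of
  -- the fan from `a`, spanned by `a` and its two predecessors.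
  · obtain ⟨p, u, l, hr⟩ := exists_two_pred hl ha
    have ht := triple_isRotated hr h
    have hpos : 0 < orient p u a := by
      rw [List.triplewise_cons, List.pairwise_cons] at ht
      exact ht.1.1 a (by simp)
    have hp : p ∈ L := hr.mem_iff.2 (by simp)
    have h1 := hx p u ⟨a :: l, hr⟩
    have h2 := hx u a ⟨l ++ [p], hr.trans (by simpa using List.isRotated_append (l := [p]) (l' := u :: a :: l))⟩
    refine hull_mono ?_ (mem_triangle hpos h1 h2 (hall p hp))
    intro y hy
    rw [hr.mem_iff]
    simp at hy ⊢; tauto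
  · push Not at hall
    obtain ⟨w, hw, hwx⟩ := hall
    obtain ⟨b, hb⟩ := exists_edge_from (by omega) ha
    -- Otherwise the side of `x` relative to the diagonals from `a` changes along some edge `pq`,
    -- and `x` lies in the fan triangle over this edge.
    obtain ⟨p, q, e, hp, hq⟩ := exists_edge_change (by omega) (fun v => 0 ≤ orientR a v x)
      hb.right_mem hw (hx a b hb) (by simpa using hwx)
    simp only [not_le] at hq
    have haq : a ≠ q := by
      rintro rfl
      simp [orientR, cross] at hq
      linarith
    have hap : a ≠ p := by
      rintro rfl
      exact absurd (hx a q e) (not_le.2 hq)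
    have hpos : 0 < orient p q a := orient_edge_pos h e ha hap haq
    refine hull_mono ?_ (mem_triangle hpos (hx p q e) (by rw [orientR_swap]; linarith) hp)
    intro y hy
    simp at hy
    rcases hy with rfl | rfl | rfl
    · exact e.left_mem
    · exact e.right_mem
    · exact ha

theorem edge_ne {L : List Pt} (hl : 3 ≤ L.length)
    (h : L.Triplewise fun a b c => 0 < orient a b c) {p q : Pt} (e : Edge L p q) : p ≠ q := by
  have hn := triple_nodup hl h
  obtain ⟨l, hr⟩ := e
  have := hr.nodup_iff.1 hn
  simp at this
  tauto

theorem mem_interior_hull_iff {L : List Pt} (hl : 3 ≤ L.length)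
    (h : L.Triplewise fun a b c => 0 < orient a b c) {x : Plane} :
    x ∈ interior (hull L) ↔ ∀ p q, Edge L p q → 0 < orientR p q x := by
  constructor
  · intro hx p q e
    exact orientR_pos_of_mem_interior (edge_ne hl h e) (fun y hy => orientR_nonneg h e hy) hx
  · intro hx
    have hfin : {e : Pt × Pt | Edge L e.1 e.2}.Finite := by
      refine ((List.finite_toSet L).prod (List.finite_toSet L)).subset ?_
      rintro ⟨p, q⟩ e
      exact ⟨e.left_mem, e.right_mem⟩
    have hopen : IsOpen (⋂ e ∈ {e : Pt × Pt | Edge L e.1 e.2}, {y : Plane | 0 < orientR e.1 e.2 y}) :=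
      hfin.isOpen_biInter fun e _ => isOpen_lt continuous_const (continuous_orientR _ _)
    refine mem_interior.2 ⟨_, ?_, hopen, by simpa using hx⟩
    intro y hy
    simp only [mem_ofPred_eq, mem_iInter] at hy
    exact mem_hull hl h fun p q e => (hy (p, q) e).le

theorem zero_mem_interior_iff {L : List Pt} (hl : 3 ≤ L.length)
    (h : L.Triplewise fun a b c => 0 < orient a b c) :
    (0 : Plane) ∈ interior (hull L) ↔ ∀ p q, Edge L p q → 0 < cross p q := by
  rw [mem_interior_hull_iff hl h]
  simp [orientR, crossR]

/-- The extreme points of the polygon are the points of the list. -/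
theorem vertices_hull {L : List Pt} (hl : 3 ≤ L.length)
    (h : L.Triplewise fun a b c => 0 < orient a b c) :
    vertices (hull L) = toP '' {p | p ∈ L} := by
  refine extremePoints_convexHull_subset.antisymm ?_
  rintro _ ⟨v, hv, rfl⟩
  refine mem_extremePoints.2 ?_
  refine ⟨toP_mem_hull hv, ?_⟩
  intro x hx y hy hxy
  obtain ⟨p, u, l, hr⟩ := exists_two_pred hl hv
  obtain ⟨w, hw⟩ := exists_edge_from (by omega) hv
  have e1 : Edge L u v := ⟨l ++ [p], hr.trans (by simpa using List.isRotated_append (l := [p]) (l' := u :: v :: l))⟩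
  have huw : w ≠ u := by
    rintro rfl
    obtain ⟨m, hm⟩ := hw
    have h2 := hr.symm.trans hm
    have hp : p ∈ L := hr.mem_iff.2 (by simp)
    have hn := hr.nodup_iff.1 (triple_nodup hl h)
    simp at hn
    have a1 := orient_edge_pos h e1 hp (by tauto) (by tauto)
    have a2 := orient_edge_pos h ⟨m, hm⟩ hp (by tauto) (by tauto)
    have : orient w v p = - orient v w p := by unfold orient cross; ring
    omega
  have hpos : 0 < orient u v w := orient_edge_pos h e1 hw.right_mem huw (edge_ne hl h hw).symm
  obtain ⟨a, b, ha, hb, hab, hxyv⟩ := hxy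
  -- An edge function that is nonnegative on the polygon and vanishes inside a segment vanishes at
  -- both ends. The two edges at `v` meet only in `v`.
  have key : ∀ p q, Edge L p q → orientR p q (toP v) = 0 → orientR p q x = 0 ∧ orientR p q y = 0 := by
    intro p q e h0
    have h1 := orientR_nonneg h e hx
    have h2 := orientR_nonneg h e hy
    rw [← hxyv, orientR_combo p q x y hab] at h0
    constructor
    · by_contra hne
      have : 0 < a * orientR p q x := mul_pos ha (lt_of_le_of_ne h1 (Ne.symm hne))
      have : 0 ≤ b * orientR p q y := by positivity
      linarith
    · by_contra hne
      have : 0 < b * orientR p q y := mul_pos hb (lt_of_le_of_ne h2 (Ne.symm hne))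
      have : 0 ≤ a * orientR p q x := by positivity
      linarith
  obtain ⟨k1, k2⟩ := key u v e1 (by rw [orientR_toP, orient_self_right]; simp)
  obtain ⟨k3, k4⟩ := key v w hw (by rw [orientR_toP, orient_self_mid]; simp)
  have fin : ∀ z : Plane, orientR u v z = 0 → orientR v w z = 0 → z = toP v := by
    intro z z1 z2
    have h' : (orient u v w : ℝ) ≠ 0 := by exact_mod_cast hpos.ne'
    have hs := orientR_sum u v w z
    rw [z1, z2] at hs
    have hb := barycentric hpos z
    rw [z1, z2] at hb
    rw [hb]
    have : orientR w u z = orient u v w := by linarith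
    rw [this, div_self h']; simp
  exact ⟨fin x k1 k3, fin y k2 k4⟩

theorem encard_vertices_hull {L : List Pt} (hl : 3 ≤ L.length)
    (h : L.Triplewise fun a b c => 0 < orient a b c) : (vertices (hull L)).encard = L.length := by
  rw [vertices_hull hl h, toP_injective.injOn.encard_image]
  have hn := triple_nodup hl h
  have : {p | p ∈ L} = ((L.toFinset : Finset Pt) : Set Pt) := by ext; simp
  rw [this, Set.encard_coe_eq_coe_finsetCard, List.toFinset_card_of_nodup hn]

/-! ### Lattice points in the polygon and almost hollowness -/

/-- Every nonzero lattice vector lies in the cone over an edge. -/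
theorem exists_edge_cone {L : List Pt} (hl : 3 ≤ L.length)
    (h0 : (0 : Plane) ∈ interior (hull L)) {g : Pt} (hg : g ≠ 0) :
    (∃ w ∈ L, 0 < cross g w) ∧ (∃ w ∈ L, cross g w < 0) ∧
      ∃ p q, Edge L p q ∧ 0 < cross p g ∧ 0 ≤ cross g q := by
  have key : ∀ g : Pt, g ≠ 0 → ∃ w ∈ L, cross g w < 0 := by
    intro g hg
    by_contra hc
    push Not at hc
    -- Otherwise the polygon lies in a half plane whose boundary passes through the origin.
    have hsub : hull L ⊆ {x | 0 ≤ crossR g x} := hull_subset (convex_crossR_nonneg g)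
      fun p hp => by rw [mem_ofPred_eq, crossR_toP]; exact_mod_cast hc p hp
    have := crossR_pos_of_mem_interior hg (s := hull L) (fun x hx => hsub hx) h0
    simp [crossR] at this
  have h1 := key g hg
  obtain ⟨v, hv, hv'⟩ := key (-g) (by simpa using hg)
  have hv'' : 0 < cross g v := by simp [cross] at hv' ⊢; linarith
  obtain ⟨w, hw, hw'⟩ := h1
  refine ⟨⟨v, hv, hv''⟩, ⟨w, hw, hw'⟩, ?_⟩
  obtain ⟨p, q, e, hp, hq⟩ := exists_edge_change (by omega) (fun v => cross g v < 0)
      hw hv hw' (by omega)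
  refine ⟨p, q, e, ?_, by omega⟩
  simp [cross] at hp ⊢; linarith

/-- Such a combination lies on the segment from the interior point `0` to a point of `s`, strictly
before its end. -/
theorem combo_mem_interior {s : Set Plane} (hs : Convex ℝ s) (h0 : (0 : Plane) ∈ interior s)
    {x y : Plane} (hx : x ∈ s) (hy : y ∈ s) {a b : ℝ} (ha : 0 ≤ a) (hb : 0 ≤ b)
    (hab : a + b < 1) : a • x + b • y ∈ interior s := by
  rcases eq_or_lt_of_le (add_nonneg ha hb) with h | h
  · have ha0 : a = 0 := by linarith
    have hb0 : b = 0 := by linarith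
    simpa [ha0, hb0] using h0
  · have hz : (a / (a + b)) • x + (b / (a + b)) • y ∈ s :=
      hs hx hy (by positivity) (by positivity) (by field_simp)
    have := hs.combo_interior_self_mem_interior h0 hz (a := 1 - (a + b)) (b := a + b)
      (by linarith) h.le (by ring)
    convert this using 1
    rw [smul_zero, zero_add, smul_add, smul_smul, smul_smul, mul_div_cancel₀ _ h.ne', mul_div_cancel₀ _ h.ne']

/-- Two lattice points of an almost hollow polygon bound a hollow triangle with the origin. -/
theorem hollow_of_isAlmostHollow {k : ℕ} (hk : 0 < k) {s : Set Plane} (hs : Convex ℝ s)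
    (hh : IsAlmostHollow k s) {p q : Pt} (hp : toP p ∈ s) (hq : toP q ∈ s)
    (hpq : 0 < cross p q) : Hollow k p q := by
  intro z h1 h2 h3
  have hD : (0 : ℝ) < cross p q := by exact_mod_cast hpq
  have h0 : (0 : Plane) ∈ interior s := by
    have : (0 : Plane) ∈ ({0} : Set Plane) := rfl
    rw [← hh] at this; exact this.1
  have h1' : (0 : ℝ) ≤ cross p z := by exact_mod_cast h1
  have h2' : (0 : ℝ) ≤ cross z q := by exact_mod_cast h2
  have h3' : (k : ℝ) * (cross p z + cross z q) < cross p q := by exact_mod_cast h3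
  -- By Cramer's rule these are the coefficients of `k z` with respect to `p` and `q`; the third
  -- hypothesis on `z` says that their sum is below one.
  have hm := combo_mem_interior hs h0 hp hq (a := k * cross z q / cross p q)
    (b := k * cross p z / cross p q) (by positivity) (by positivity)
    (by rw [← add_div, div_lt_one hD]; linarith)
  have hz : (k * cross z q / cross p q : ℝ) • toP p + (k * cross p z / cross p q : ℝ) • toP q =
      (k : ℝ) • latticePoint z.1 z.2 := by
    apply plane_ext
    · change _ = (k : ℝ) * (z.1 : ℝ)
      simp only [Pi.add_apply, Pi.smul_apply, toP_zero, smul_eq_mul]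
      field_simp
      simp only [cross]; push_cast; ring
    · change _ = (k : ℝ) * (z.2 : ℝ)
      simp only [Pi.add_apply, Pi.smul_apply, toP_one, smul_eq_mul]
      field_simp
      simp only [cross]; push_cast; ring
  rw [hz] at hm
  have hmem : (k : ℝ) • latticePoint z.1 z.2 ∈ ({0} : Set Plane) := by
    rw [← hh]; exact ⟨hm, z.1, z.2, rfl⟩
  have hk' : (k : ℝ) ≠ 0 := by positivity
  have h4 : latticePoint z.1 z.2 = 0 := (smul_eq_zero.1 hmem).resolve_left hk'
  have a1 := congrFun h4 0
  have a2 := congrFun h4 1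
  simp [latticePoint] at a1 a2
  exact Prod.ext a1 a2

/-- A nonzero `z` lies in the cone over some edge. If `k z` were interior, it would be strictly
inside this edge, which hollowness of the edge excludes. -/
theorem isAlmostHollow_hull {k : ℕ} {L : List Pt} (hL : IsCycle k L) : IsAlmostHollow k (hull L) := by
  have h0 := (zero_mem_interior_iff hL.three hL.triple).2 hL.pos
  apply Set.eq_of_subset_of_subset
  · rintro _ ⟨hx, a, b, rfl⟩
    by_contra hne
    set z : Pt := (a, b) with hz
    have hz0 : z ≠ 0 := by
      intro h
      apply hne
      obtain ⟨rfl, rfl⟩ : a = 0 ∧ b = 0 := by simpa [hz] using h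
      simp [latticePoint]
    obtain ⟨-, -, p, q, e, h1, h2⟩ := exists_edge_cone hL.three h0 hz0
    have h3 := (mem_interior_hull_iff hL.three hL.triple).1 hx p q e
    refine hz0 (hL.hollow p q e z h1.le h2 ?_)
    have : orientR p q ((k : ℝ) • latticePoint a b) = cross p q - k * (cross p z + cross z q) := by
      simp [orientR, crossR, latticePoint, cross, hz]; ring
    rw [this] at h3
    have : (0 : ℝ) < ((cross p q - k * (cross p z + cross z q) : ℤ) : ℝ) := by push_cast; exact h3
    have := Int.cast_pos.1 this
    linarith
  · rintro _ rfl
    exact ⟨h0, 0, 0, by ext i; fin_cases i <;> simp [latticePoint]⟩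

theorem isLDPPolygon_hull {k : ℕ} {L : List Pt} (hL : IsCycle k L) : IsLDPPolygon (hull L) where
  isPolytope := ⟨_, finite_toP L, rfl⟩
  zero_mem_interior := (zero_mem_interior_iff hL.three hL.triple).2 hL.pos
  primitive_vertices := by
    intro v hv
    rw [vertices_hull hL.three hL.triple] at hv
    obtain ⟨p, hp, rfl⟩ := hv
    exact ⟨p.1, p.2, hL.prim p hp, rfl⟩

theorem hull_mem_hollowLDP {k : ℕ} {L : List Pt} (hL : IsCycle k L) : hull L ∈ hollowLDP k :=
  ⟨isLDPPolygon_hull hL, isAlmostHollow_hull hL⟩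

end LDP

namespace LDP
open Set MeasureTheory

/-! ### Areas -/

/-- The sum of the determinants of consecutive points. -/
def pathSum : List Pt → ℤ
  | p :: q :: l => cross p q + pathSum (q :: l)
  | _ => 0

/-- Twice the area enclosed by a cyclic list. -/
def area2 : List Pt → ℤ
  | [] => 0
  | a :: l => pathSum (a :: l ++ [a])

theorem volume_line {p q : Pt} (h : p ≠ q) : volume {x : Plane | orientR p q x = 0} = 0 := by
  let φ : Plane →ₗ[ℝ] ℝ := ((q.1 : ℝ) - p.1) • LinearMap.proj 1 - ((q.2 : ℝ) - p.2) • LinearMap.proj 0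
  have hφ : ∀ x, φ x = ((q.1 : ℝ) - p.1) * x 1 - ((q.2 : ℝ) - p.2) * x 0 := fun x => by simp [φ]
  have hne : LinearMap.ker φ ≠ ⊤ := by
    intro hT
    rw [LinearMap.ker_eq_top] at hT
    have h1 := hφ ![0, 1]
    have h2 := hφ ![1, 0]
    rw [hT] at h1 h2
    simp at h1 h2
    refine h (Prod.ext ?_ ?_)
    · exact_mod_cast (sub_eq_zero.1 h1.symm).symm
    · have : (p.2 : ℝ) = q.2 := by linarith
      exact_mod_cast this
  have hs : {x : Plane | orientR p q x = 0} =
      (fun x => x + (-toP p)) ⁻¹' (LinearMap.ker φ : Set Plane) := by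
    ext x
    simp only [mem_ofPred_eq, mem_preimage, SetLike.mem_coe, LinearMap.mem_ker, hφ]
    have : orientR p q x = ((q.1 : ℝ) - p.1) * ((x + -toP p) 1) - ((q.2 : ℝ) - p.2) * ((x + -toP p) 0) := by
      simp [orientR, crossR, cross]; ring
    rw [this]
  rw [hs, measure_preimage_add_right]
  exact Measure.addHaar_submodule volume _ hne

/-- The standard triangle. -/
def stdTriangle : Set Plane := {x | 0 ≤ x 0 ∧ 0 ≤ x 1 ∧ x 0 + x 1 ≤ 1}

theorem isClosed_stdTriangle : IsClosed stdTriangle := by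
  refine IsClosed.and (isClosed_le (by fun_prop) (by fun_prop)) (IsClosed.and (isClosed_le (by fun_prop) (by fun_prop)) (isClosed_le (by fun_prop) (by fun_prop)))

/-- The triangle and its point reflection cover the unit square and overlap in a diagonal. -/
theorem volume_stdTriangle : volume stdTriangle = 2⁻¹ := by
  have h1 : stdTriangle ∪ (fun x : Plane => 1 - x) ⁻¹' stdTriangle = Icc (0 : Plane) 1 := by
    ext x
    simp only [stdTriangle, mem_union, mem_preimage, mem_ofPred_eq, mem_Icc, Pi.le_def, Fin.forall_fin_two,
      Pi.sub_apply, Pi.one_apply, Pi.zero_apply]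
    constructor
    · rintro (⟨a, b, c⟩ | ⟨a, b, c⟩) <;> refine ⟨⟨?_, ?_⟩, ?_, ?_⟩ <;> linarith
    · rintro ⟨⟨a, b⟩, c, d⟩
      by_cases h : x 0 + x 1 ≤ 1
      · exact Or.inl ⟨a, b, h⟩
      · exact Or.inr ⟨by linarith, by linarith, by linarith⟩
  have h2 : volume ((fun x : Plane => 1 - x) ⁻¹' stdTriangle) = volume stdTriangle :=
    (Measure.measurePreserving_sub_left volume (1 : Plane)).measure_preimage isClosed_stdTriangle.nullMeasurableSet
  have h3 : volume (stdTriangle ∩ (fun x : Plane => 1 - x) ⁻¹' stdTriangle) = 0 := by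
    refine measure_mono_null ?_ (volume_line (p := (1, 0)) (q := (0, 1)) (by simp))
    rintro x ⟨⟨a, b, c⟩, a', b', c'⟩
    simp [orientR, crossR, cross] at *
    linarith
  have h4 : volume (Icc (0 : Plane) 1) = 1 := by
    rw [Real.volume_Icc_pi]; simp
  rw [← h1, measure_union₀ ?_ h3, h2, ← two_mul] at h4
  · rw [mul_comm] at h4
    exact ENNReal.eq_inv_of_mul_eq_one_left h4
  · exact ((isClosed_stdTriangle.preimage (by fun_prop)).nullMeasurableSet)

theorem triple_triangle {a b c : Pt} (h : 0 < orient a b c) :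
    [a, b, c].Triplewise fun a b c => 0 < orient a b c := by simpa using h

theorem forall_edge_triangle {a b c : Pt} {R : Pt → Pt → Prop} :
    (∀ p q, Edge [a, b, c] p q → R p q) ↔ R a b ∧ R b c ∧ R c a := by
  rw [edge_cons_iff (by simp)]; simp

theorem mem_triangle_iff {a b c : Pt} (h : 0 < orient a b c) {x : Plane} :
    x ∈ hull [a, b, c] ↔ 0 ≤ orientR a b x ∧ 0 ≤ orientR b c x ∧ 0 ≤ orientR c a x := by
  rw [← forall_edge_triangle (R := fun p q => 0 ≤ orientR p q x)]
  exact ⟨fun hx p q e => orientR_nonneg (triple_triangle h) e hx, fun hx =>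
    mem_hull (by simp) (triple_triangle h) hx⟩

theorem volume_triangle {a b c : Pt} (h : 0 < orient a b c) :
    volume (hull [a, b, c]) = ENNReal.ofReal (orient a b c / 2) := by
  have hD : (0 : ℝ) < orient a b c := by exact_mod_cast h
  set D : ℝ := ((orient a b c : ℤ) : ℝ) with hDdef
  -- After translation by `-a`, this matrix maps a point to its barycentric coordinates at `b` and
  -- `c`, so the triangle becomes the standard one.
  let N : Matrix (Fin 2) (Fin 2) ℝ :=
    !![-(a.2 - c.2) / D, (a.1 - c.1) / D; -(b.2 - a.2) / D, (b.1 - a.1) / D]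
  have hdet : N.det = D⁻¹ := by
    simp only [N, Matrix.det_fin_two_of]
    field_simp
    rw [hDdef]; simp only [orient, cross]; push_cast; ring
  have hN0 : ∀ x, Matrix.toLin' N (x + -toP a) 0 = orientR c a x / D := by
    intro x
    simp [N, Matrix.mulVec, dotProduct, Fin.sum_univ_two, orientR, crossR, cross]; field_simp; ring
  have hN1 : ∀ x, Matrix.toLin' N (x + -toP a) 1 = orientR a b x / D := by
    intro x
    simp [N, Matrix.mulVec, dotProduct, Fin.sum_univ_two, orientR, crossR, cross]; field_simp; ring
  have hs : hull [a, b, c] = (fun x => x + -toP a) ⁻¹' (Matrix.toLin' N ⁻¹' stdTriangle) := by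
    ext x
    rw [mem_triangle_iff h]
    simp only [mem_preimage, stdTriangle, mem_ofPred_eq, hN0, hN1]
    have := orientR_sum a b c x
    rw [← hDdef] at this
    rw [← add_div, div_le_one hD, le_div_iff₀ hD, le_div_iff₀ hD]
    constructor
    · rintro ⟨h1, h2, h3⟩; refine ⟨?_, ?_, ?_⟩ <;> linarith
    · rintro ⟨h1, h2, h3⟩; refine ⟨?_, ?_, ?_⟩ <;> linarith
  rw [hs, measure_preimage_add_right, Measure.addHaar_preimage_linearMap _ (by
    rw [LinearMap.det_toLin', hdet]; positivity), LinearMap.det_toLin', hdet, volume_stdTriangle,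
    inv_inv, abs_of_pos hD]
  rw [ENNReal.ofReal_div_of_pos (by norm_num), div_eq_mul_inv]; simp

/-- The chord from `a` to `c` cuts off the triangle at `b`; on either side of it the remaining edge
inequalities suffice for membership. -/
theorem hull_fan {a b c : Pt} {r : List Pt} (hr : r ≠ [])
    (h : (a :: b :: c :: r).Triplewise fun a b c => 0 < orient a b c) :
    hull (a :: b :: c :: r) = hull [a, b, c] ∪ hull (a :: c :: r) := by
  have h' := h
  simp only [List.triplewise_cons, List.pairwise_cons] at h'
  have habc : 0 < orient a b c := h'.1.1 c (by simp)
  have htri : (a :: c :: r).Triplewise fun a b c => 0 < orient a b c := by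
    simp only [List.triplewise_cons, List.pairwise_cons]; tauto
  refine Set.Subset.antisymm ?_ (union_subset (hull_mono (by simp)) (hull_mono (by simp; tauto)))
  intro x hx
  have hedge : ∀ p q, Edge (a :: b :: c :: r) p q → 0 ≤ orientR p q x :=
    fun p q e => orientR_nonneg h e hx
  rw [edge_cons_iff (by simp)] at hedge
  simp only [List.cons_append, List.isChain_cons_cons] at hedge
  by_cases hac : 0 ≤ orientR a c x
  · right
    refine mem_hull (by cases r; simp at hr; simp) htri ?_
    rw [edge_cons_iff (by simp)]
    simp only [List.cons_append, List.isChain_cons_cons]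
    exact ⟨hac, hedge.2.2⟩
  · left
    exact mem_triangle habc hedge.1 hedge.2.1 (by rw [orientR_swap]; linarith)

/-- The shoelace formula. -/
theorem volume_hull {L : List Pt} (hl : 3 ≤ L.length)
    (h : L.Triplewise fun a b c => 0 < orient a b c) :
    0 < area2 L ∧ volume (hull L) = ENNReal.ofReal (area2 L / 2) := by
  match L, hl with
  | a :: b :: c :: r, _ =>
    induction r generalizing b c with
    | nil =>
      have h3 : area2 [a, b, c] = orient a b c := by simp [area2, pathSum, orient]; ring
      have hpos : 0 < orient a b c := by simpa using h
      rw [h3]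
      exact ⟨hpos, volume_triangle hpos⟩
    | cons d r ih =>
      have h' := h
      simp only [List.triplewise_cons, List.pairwise_cons] at h'
      have habc : 0 < orient a b c := h'.1.1 c (by simp)
      have htri : (a :: c :: d :: r).Triplewise fun a b c => 0 < orient a b c := by
        simp only [List.triplewise_cons, List.pairwise_cons]; tauto
      have ih := ih c d (by simp) htri
      have hA : area2 (a :: b :: c :: d :: r) = orient a b c + area2 (a :: c :: d :: r) := by
        simp [area2, pathSum, orient, cross]; ring
      refine ⟨by omega, ?_⟩
      rw [hull_fan (by simp) h, measure_union₀ (isClosed_hull _).nullMeasurableSet, volume_triangle habc, ih.2, hA,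
        ← ENNReal.ofReal_add]
      · push_cast; ring_nf
      · have : (0 : ℝ) < orient a b c := by exact_mod_cast habc
        positivity
      · have : (0 : ℝ) < area2 (a :: c :: d :: r) := by exact_mod_cast ih.1
        positivity
      · have hac : a ≠ c := edge_ne (L := a :: c :: d :: r) (by simp) htri ⟨_, List.IsRotated.refl _⟩
        -- The two pieces lie on opposite sides of the chord `ac`, so their overlap is contained in
        -- a line.
        refine measure_mono_null ?_ (volume_line hac)
        rintro x ⟨h1, h2⟩
        have h1 := ((mem_triangle_iff habc).1 h1).2.2
        have h2 := orientR_nonneg htri ⟨_, List.IsRotated.refl _⟩ h2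
        rw [orientR_swap] at h1
        simp only [mem_ofPred_eq]; linarith

/-! ### Every almost hollow LDP-polygon comes from a cyclic list -/

theorem not_combo_of_extreme {A : Set Plane} {x y z : Plane}
    (hy : y ∈ A.extremePoints ℝ) (hA : Convex ℝ A) (hx : x ∈ A) (hz : z ∈ A) (hxy : x ≠ y) (hzy : z ≠ y) ⦃a b : ℝ⦄
    (ha : 0 ≤ a) (hb : 0 ≤ b) (hab : a + b = 1) : a • x + b • z ≠ y := by
  have := (hA.mem_extremePoints_iff_convex_sdiff.1 hy).2
  intro h
  have hm := this ⟨hx, hxy⟩ ⟨hz, hzy⟩ ha hb hab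
  exact hm.2 h

theorem not_mem_triangle_of_extreme {A : Set Plane} (hA : Convex ℝ A) {p q r y : Pt}
    (hy : toP y ∈ A.extremePoints ℝ) (hp : toP p ∈ A) (hq : toP q ∈ A) (hr : toP r ∈ A)
    (hpy : p ≠ y) (hqy : q ≠ y) (hry : r ≠ y) (hpos : 0 < orient p q r) (h1 : 0 ≤ orient p q y)
    (h2 : 0 ≤ orient q r y) (h3 : 0 ≤ orient r p y) : False := by
  have hc := (hA.mem_extremePoints_iff_convex_sdiff.1 hy).2
  have hm : toP y ∈ hull [p, q, r] := by
    refine mem_triangle hpos ?_ ?_ ?_ <;> rw [orientR_toP] <;> exact_mod_cast ‹_›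
  have hsub : hull [p, q, r] ⊆ A \ {toP y} := by
    refine hull_subset hc ?_
    intro v hv
    simp only [List.mem_cons, List.not_mem_nil, or_false] at hv
    rcases hv with rfl | rfl | rfl
    · exact ⟨hp, fun h => hpy (toP_injective h)⟩
    · exact ⟨hq, fun h => hqy (toP_injective h)⟩
    · exact ⟨hr, fun h => hry (toP_injective h)⟩
  exact (hsub hm).2 rfl

/-- For collinear points, `s / N` is the position of `z` on the line on which `x` and `y` have the
positions 0 and 1. In each of the three ranges one point lies between the other two and is not
extreme. -/
theorem orient_ne_zero_of_extreme {A : Set Plane} (hA : Convex ℝ A) {x y z : Pt}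
    (hx : toP x ∈ A.extremePoints ℝ) (hy : toP y ∈ A.extremePoints ℝ)
    (hz : toP z ∈ A.extremePoints ℝ) (hxy : x ≠ y) (hxz : x ≠ z) (hyz : y ≠ z) :
    orient x y z ≠ 0 := by
  intro h0
  have i := toP_injective
  -- `N • (z - x) = s • (y - x)`
  set N : ℝ := (y.1 - x.1) ^ 2 + (y.2 - x.2) ^ 2 with hN
  set s : ℝ := (y.1 - x.1) * (z.1 - x.1) + (y.2 - x.2) * (z.2 - x.2) with hs
  have h0' : ((y.1 : ℝ) - x.1) * (z.2 - x.2) - (y.2 - x.2) * (z.1 - x.1) = 0 := by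
    have : ((orient x y z : ℤ) : ℝ) = 0 := by rw [h0]; simp
    rw [← this]; simp only [orient, cross]; push_cast; ring
  have hNpos : 0 < N := by
    by_contra hc
    have a1 : ((y.1 : ℝ) - x.1) = 0 := by nlinarith [sq_nonneg ((y.1 : ℝ) - x.1), sq_nonneg ((y.2 : ℝ) - x.2)]
    have a2 : ((y.2 : ℝ) - x.2) = 0 := by nlinarith [sq_nonneg ((y.1 : ℝ) - x.1), sq_nonneg ((y.2 : ℝ) - x.2)]
    exact hxy (Prod.ext (by exact_mod_cast (sub_eq_zero.1 a1).symm) (by exact_mod_cast (sub_eq_zero.1 a2).symm))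
  have e1 : N * (z.1 - x.1) = s * (y.1 - x.1) := by
    rw [hN, hs]; linear_combination (-(y.2 - x.2 : ℝ)) * h0'
  have e2 : N * (z.2 - x.2) = s * (y.2 - x.2) := by
    rw [hN, hs]; linear_combination ((y.1 - x.1 : ℝ)) * h0'
  have cx := fun a b => @not_combo_of_extreme A _ _ _ hx hA hz.1 hy.1 (fun h => hxz (i h).symm) (fun h => hxy (i h).symm) a b
  have cy := fun a b => @not_combo_of_extreme A _ _ _ hy hA hx.1 hz.1 (fun h => hxy (i h)) (fun h => hyz (i h).symm) a b
  have cz := fun a b => @not_combo_of_extreme A _ _ _ hz hA hx.1 hy.1 (fun h => hxz (i h)) (fun h => hyz (i h)) a b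
  rcases le_total s 0 with hs0 | hs0
  · have hd : 0 < N - s := by linarith
    refine cx (N / (N - s)) (-s / (N - s)) (by positivity) (div_nonneg (by linarith) hd.le)
      (by rw [← add_div, ← sub_eq_add_neg, div_self hd.ne']) ?_
    apply plane_ext
    · simp; field_simp; linarith
    · simp; field_simp; linarith
  rcases le_total s N with hsN | hsN
  · refine cz ((N - s) / N) (s / N) (div_nonneg (by linarith) hNpos.le) (by positivity)
      (by rw [← add_div, sub_add_cancel, div_self hNpos.ne']) ?_
    apply plane_ext
    · simp; field_simp; linarith
    · simp; field_simp; linarith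
  · have hs1 : 0 < s := by linarith
    refine cy ((s - N) / s) (N / s) (div_nonneg (by linarith) hs1.le) (by positivity)
      (by rw [← add_div, sub_add_cancel, div_self hs1.ne']) ?_
    apply plane_ext
    · simp; field_simp; linarith
    · simp; field_simp; linarith

/-- This is the Krein–Milman theorem; the closure is superfluous because the hull of a finite set is
closed. -/
theorem convexHull_vertices {A : Set Plane} (hA : IsPolytope A) :
    (vertices A).Finite ∧ convexHull ℝ (vertices A) = A := by
  obtain ⟨S, hS, rfl⟩ := hA
  have hsub : vertices (convexHull ℝ S) ⊆ S := extremePoints_convexHull_subset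
  have hfin := hS.subset hsub
  refine ⟨hfin, ?_⟩
  have := closure_convexHull_extremePoints (hS.isCompact_convexHull ℝ) (convex_convexHull ℝ S)
  change closure (convexHull ℝ (vertices (convexHull ℝ S))) = _ at this
  rwa [(Set.Finite.isClosed_convexHull ℝ hfin).closure_eq] at this

/-- Sorting the vertices of a polygon around one of them. -/
theorem exists_sorted {A : Set Plane} (hA : Convex ℝ A) (F : Finset Pt)
    (hF : ∀ p ∈ F, toP p ∈ A.extremePoints ℝ) {a : Pt} (ha : a ∈ F) :
    ∃ l : List Pt, (∀ x, x ∈ a :: l ↔ x ∈ F) ∧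
      (a :: l).Triplewise fun a b c => 0 < orient a b c := by
  classical
  let T := {x // x ∈ F.erase a}
  let r : T → T → Prop := fun x y => x = y ∨ 0 < orient a x.1 y.1
  have hT : ∀ x : T, x.1 ∈ F ∧ x.1 ≠ a := fun x => ⟨Finset.mem_of_mem_erase x.2, Finset.ne_of_mem_erase x.2⟩
  have anti : ∀ x y : Pt, orient a x y = - orient a y x := by intro x y; unfold orient cross; ring
  have hne : ∀ x y : T, x ≠ y → orient a x.1 y.1 ≠ 0 := fun x y hxy =>
    orient_ne_zero_of_extreme hA (hF a ha) (hF _ (hT x).1) (hF _ (hT y).1) (hT x).2.symm (hT y).2.symm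
      (fun h => hxy (Subtype.ext h))
  have : Std.Total r := ⟨fun x y => by
    by_cases hxy : x = y
    · exact Or.inl (Or.inl hxy)
    · have h1 := hne x y hxy
      have h2 := anti x.1 y.1
      rcases lt_or_gt_of_ne h1 with h | h
      · exact Or.inr (Or.inr (by omega))
      · exact Or.inl (Or.inr h)⟩
  have : Std.Antisymm r := ⟨fun x y h1 h2 => by
    rcases h1 with h1 | h1
    · exact h1
    rcases h2 with h2 | h2
    · exact h2.symm
    have := anti x.1 y.1
    omega⟩
  have : IsTrans T r := ⟨fun x y z h1 h2 => by
    rcases h1 with rfl | h1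
    · exact h2
    rcases h2 with rfl | h2
    · exact Or.inr h1
    by_cases hxz : x = z
    · exact Or.inl hxz
    · right
      rcases lt_or_gt_of_ne (hne x z hxz) with h | h
      -- If the angular order ran around in a circle, `a` would lie in the triangle `x, y, z`.
      · exfalso
        refine not_mem_triangle_of_extreme hA (hF a ha) (hF _ (hT x).1).1 (hF _ (hT y).1).1 (hF _ (hT z).1).1
          (hT x).2 (hT y).2 (hT z).2 ?_ ?_ ?_ ?_
        all_goals
          simp only [orient, cross] at h h1 h2 ⊢
          linarith
      · exact h⟩
  let l := (Finset.univ : Finset T).sort r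
  have hl : l.Pairwise r := Finset.pairwise_sort _ _
  have hnd : l.Nodup := Finset.sort_nodup _ _
  have hl' : l.Pairwise fun x y => 0 < orient a x.1 y.1 := by
    refine (hl.and hnd).imp ?_
    rintro x y ⟨h1 | h1, h2⟩
    · exact absurd h1 h2
    · exact h1
  refine ⟨l.map Subtype.val, ?_, ?_⟩
  · intro x
    constructor
    · intro hx
      rcases List.mem_cons.1 hx with rfl | hx
      · exact ha
      · obtain ⟨y, -, rfl⟩ := List.mem_map.1 hx
        exact (hT y).1
    · intro hx
      by_cases hxa : x = a
      · subst hxa; simp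
      · refine List.mem_cons_of_mem _ (List.mem_map.2 ⟨⟨x, Finset.mem_erase.2 ⟨hxa, hx⟩⟩, ?_, rfl⟩)
        simp [l]
  · rw [List.triplewise_cons, List.pairwise_map, List.triplewise_map]
    refine ⟨hl', ?_⟩
    rw [List.triplewise_iff_getElem]
    rw [List.pairwise_iff_getElem] at hl'
    intro i j k hij hjk hk
    have a1 := hl' i j (by omega) (by omega) hij
    have a2 := hl' j k (by omega) (by omega) hjk
    have a3 := hl' i k (by omega) (by omega) (by omega)
    have n1 : l[i] ≠ l[j] := fun h => by
      rw [h, orient_self_right] at a1; omega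
    have n2 : l[j] ≠ l[k] := fun h => by
      rw [h, orient_self_right] at a2; omega
    -- Otherwise `l[j]` would lie in the triangle spanned by `a`, `l[i]` and `l[k]`.
    by_contra hc
    refine not_mem_triangle_of_extreme hA (hF _ (hT l[j]).1) (hF a ha).1 (hF _ (hT l[i]).1).1
      (hF _ (hT l[k]).1).1 (hT l[j]).2.symm (fun h => n1 (Subtype.ext h)) (fun h => n2 (Subtype.ext h.symm))
      a3 a1.le ?_ ?_
    · simp only [orient, cross] at hc ⊢
      linarith
    · simp only [orient, cross] at a2 ⊢
      linarith

/-- The finitely many vertices are sorted by angle around one of them. At least three must exist,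
since the origin is an interior point. -/
theorem exists_isCycle {k : ℕ} (hk : 0 < k) {A : Set Plane} (hA : A ∈ hollowLDP k) :
    ∃ L, IsCycle k L ∧ hull L = A := by
  obtain ⟨hP, hH⟩ := hA
  obtain ⟨hfin, hconv⟩ := convexHull_vertices hP.isPolytope
  have hcA : Convex ℝ A := hconv ▸ convex_convexHull ℝ _
  let F : Finset Pt := (hfin.preimage toP_injective.injOn).toFinset
  have hF : ∀ p, p ∈ F ↔ toP p ∈ vertices A := by intro p; simp [F]
  have himg : toP '' {p | p ∈ F} = vertices A := by
    ext v
    constructor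
    · rintro ⟨p, hp, rfl⟩; exact (hF p).1 hp
    · intro hv
      obtain ⟨a, b, -, rfl⟩ := hP.primitive_vertices v hv
      exact ⟨(a, b), (hF _).2 hv, rfl⟩
  have hne : F.Nonempty := by
    by_contra hc
    rw [Finset.not_nonempty_iff_eq_empty] at hc
    have : vertices A = ∅ := by rw [← himg, hc]; simp
    rw [this, convexHull_empty] at hconv
    have h0 := interior_subset hP.zero_mem_interior
    rw [← hconv] at h0
    exact h0
  obtain ⟨a, ha⟩ := hne
  obtain ⟨l, hl, htr⟩ := exists_sorted hcA F (fun p hp => (hF p).1 hp) ha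
  have hhull : hull (a :: l) = A := by
    rw [← hconv, ← himg, hull]
    congr 2
    ext p; exact hl p
  have hthree : 3 ≤ (a :: l).length := by
    by_contra hc
    obtain ⟨q, hq, hmem⟩ : ∃ q, q ≠ a ∧ ∀ x ∈ a :: l, x = a ∨ x = q := by
      match l, hc with
      | [], _ => exact ⟨(a.1 + 1, a.2), by intro h; simpa using congrArg Prod.fst h, by simp⟩
      | [q], _ =>
        by_cases hqa : q = a
        · exact ⟨(a.1 + 1, a.2), by intro h; simpa using congrArg Prod.fst h, by simp [hqa]⟩
        · exact ⟨q, hqa, by simp⟩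
      | _ :: _ :: _, hc => simp at hc
    -- All vertices would lie on the line `pq`. Both of its sides then qualify as the side
    -- containing the polygon, so the origin would lie strictly on both.
    have key : ∀ p q : Pt, p ≠ q → (∀ x ∈ a :: l, x = p ∨ x = q) → 0 < orientR p q 0 := by
      intro p q hpq hm
      refine orientR_pos_of_mem_interior hpq (s := A) ?_ hP.zero_mem_interior
      rw [← hhull]
      refine fun x hx => hull_subset (convex_orientR_nonneg p q) (fun v hv => ?_) hx
      simp only [mem_ofPred_eq, orientR_toP]
      rcases hm v hv with rfl | rfl
      · rw [orient_self_mid]; simp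
      · rw [orient_self_right]; simp
    have h1 := key a q hq.symm hmem
    have h2 := key q a hq (fun x hx => (hmem x hx).symm)
    rw [orientR_swap] at h2
    linarith
  have hpos := (zero_mem_interior_iff hthree htr).1 (by rw [hhull]; exact hP.zero_mem_interior)
  have hin : ∀ p ∈ a :: l, toP p ∈ A := fun p hp => hhull ▸ toP_mem_hull hp
  refine ⟨a :: l, ⟨hthree, htr, hpos, ?_, ?_⟩, hhull⟩
  · intro p q e
    exact hollow_of_isAlmostHollow hk hcA hH (hin p e.left_mem) (hin q e.right_mem) (hpos p q e)
  · intro p hp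
    obtain ⟨x, y, hxy, e⟩ := hP.primitive_vertices _ ((hF p).1 ((hl p).1 hp))
    have : p = (x, y) := toP_injective e
    rw [this]; exact hxy

end LDP

namespace LDP
open Set MeasureTheory

/-! ### Unimodular maps of polygons -/

theorem matAct_toP (U : Matrix (Fin 2) (Fin 2) ℤ) (p : Pt) : matAct U (toP p) = toP (act U p) := by
  apply plane_ext <;> simp [matAct, Matrix.mulVec, dotProduct, Fin.sum_univ_two, act]

theorem matAct_eq_toLin (U : Matrix (Fin 2) (Fin 2) ℤ) :
    matAct U = ⇑(Matrix.toLin' (U.map (Int.cast : ℤ → ℝ))) := by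
  funext x; rfl

theorem matAct_hull (U : Matrix (Fin 2) (Fin 2) ℤ) (L : List Pt) :
    matAct U '' hull L = hull (L.map (act U)) := by
  rw [matAct_eq_toLin, hull, LinearMap.image_convexHull, hull, ← matAct_eq_toLin, image_image]
  congr 1
  ext x
  constructor
  · rintro ⟨p, hp, rfl⟩
    exact ⟨act U p, List.mem_map.2 ⟨p, hp, rfl⟩, (matAct_toP U p).symm⟩
  · rintro ⟨q, hq, rfl⟩
    obtain ⟨p, hp, rfl⟩ := List.mem_map.1 hq
    exact ⟨p, hp, matAct_toP U p⟩

theorem volume_matAct {U : Matrix (Fin 2) (Fin 2) ℤ} (hU : U.det = 1 ∨ U.det = -1) (A : Set Plane) :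
    volume (matAct U '' A) = volume A := by
  have hd : (U.map (Int.cast : ℤ → ℝ)).det = (U.det : ℝ) := by
    simp [Matrix.det_fin_two]
  rw [matAct_eq_toLin, Measure.addHaar_image_linearMap, LinearMap.det_toLin', hd]
  rcases hU with h | h <;> simp [h]

/-- The exchange of the coordinates. -/
def swapMat : Matrix (Fin 2) (Fin 2) ℤ := !![0, 1; 1, 0]

theorem det_swapMat : swapMat.det = -1 := by simp [swapMat, Matrix.det_fin_two]

theorem swapMat_mul_self : swapMat * swapMat = 1 := by
  ext i j; fin_cases i <;> fin_cases j <;> simp [swapMat]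

theorem act_swapMat (p : Pt) : act swapMat p = p.swap := by
  simp [act, swapMat, Prod.swap]

theorem hull_mirror (L : List Pt) : hull (mirror L) = matAct swapMat '' hull L := by
  rw [matAct_hull]
  apply hull_congr
  intro p
  rw [mem_mirror, List.mem_map]
  constructor
  · intro h; exact ⟨_, h, by simp [act_swapMat]⟩
  · rintro ⟨a, ha, rfl⟩; simpa [act_swapMat] using ha

theorem mirror_map_act (U : Matrix (Fin 2) (Fin 2) ℤ) (L : List Pt) :
    mirror (L.map (act U)) = (mirror L).map (act (swapMat * U * swapMat)) := by
  simp only [mirror, List.map_map, List.map_reverse]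
  congr 2
  funext p
  simp only [Function.comp_apply, act_mul, act_swapMat, Prod.swap_swap]

theorem det_conj_swap {U : Matrix (Fin 2) (Fin 2) ℤ} (h : U.det = 1) :
    (swapMat * U * swapMat).det = 1 := by
  rw [Matrix.det_mul, Matrix.det_mul, det_swapMat, h]; norm_num

theorem isRotated_of_hull_eq {k k' : ℕ} {L M : List Pt} (hL : IsCycle k L) (hM : IsCycle k' M)
    (h : hull L = hull M) : L ~r M := by
  refine isRotated_of_mem_iff hL.three hM.three hL.triple hM.triple ?_
  have h1 := vertices_hull hL.three hL.triple
  rw [h, vertices_hull hM.three hM.triple] at h1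
  have h2 := toP_injective.image_injective h1
  intro x
  have : x ∈ {p | p ∈ M} ↔ x ∈ {p | p ∈ L} := by rw [h2]
  exact this.symm

/-! ### Canonical forms -/

/-- The residue `α` of `q` modulo `cross p q` in `q ≡ α p`. -/
def res (p q : Pt) : ℤ := (Int.gcdA p.1 p.2 * q.1 + Int.gcdB p.1 p.2 * q.2) % cross p q

/-- Two Bézout pairs for `p` differ by a multiple of `(p.2, -p.1)`, which changes the value at `q`
by a multiple of `cross p q`. So any pair may be used. -/
theorem res_eq {p q : Pt} {s t : ℤ} (h : s * p.1 + t * p.2 = 1) :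
    res p q = (s * q.1 + t * q.2) % cross p q := by
  have hg : Int.gcdA p.1 p.2 * p.1 + Int.gcdB p.1 p.2 * p.2 = 1 := by
    have h1 : IsCoprime p.1 p.2 := ⟨s, t, h⟩
    have h2 := Int.gcd_eq_gcd_ab p.1 p.2
    rw [Int.isCoprime_iff_gcd_eq_one.1 h1] at h2
    push_cast at h2; linarith
  unfold res
  apply Int.ModEq.symm
  apply Int.modEq_of_dvd
  refine ⟨(Int.gcdA p.1 p.2 * t - Int.gcdB p.1 p.2 * s) * (-1), ?_⟩
  unfold cross
  linear_combination (s * q.1 + t * q.2) * hg - (Int.gcdA p.1 p.2 * q.1 + Int.gcdB p.1 p.2 * q.2) * h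

/-- A Bézout pair for `p` is carried along by the inverse matrix and takes the same value at the
image of `q`. -/
theorem res_act {U : Matrix (Fin 2) (Fin 2) ℤ} (h : U.det = 1) {p q : Pt}
    (hp : IsCoprime p.1 p.2) : res (act U p) (act U q) = res p q := by
  obtain ⟨s, t, hst⟩ := hp
  rw [res_eq hst, res_eq (s := s * U 1 1 - t * U 1 0) (t := t * U 0 0 - s * U 0 1), cross_act_one h]
  · congr 1
    rw [Matrix.det_fin_two] at h
    simp only [act]
    linear_combination (s * q.1 + t * q.2) * h
  · rw [Matrix.det_fin_two] at h
    simp only [act]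
    linear_combination (s * p.1 + t * p.2) * h + hst

/-- The radix of the packed coordinates. -/
def radix : ℤ := 2 ^ 48

/-- The points of a list packed into a single vector. -/
def packP (L : List Pt) : Pt := L.foldl (fun P v => (radix * P.1 + v.1, radix * P.2 + v.2)) 0

theorem packP_concat (L : List Pt) (v : Pt) :
    packP (L ++ [v]) = (radix * (packP L).1 + v.1, radix * (packP L).2 + v.2) := by
  simp [packP]

/-- Packing is linear in the points, so the comparison of whole vertex lists reduces to that of
single vectors on which the matrix acts. -/
theorem packP_map (U : Matrix (Fin 2) (Fin 2) ℤ) (L : List Pt) :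
    packP (L.map (act U)) = act U (packP L) := by
  induction L using List.reverseRecOn with
  | nil => simp [packP, act, Prod.ext_iff]
  | append_singleton l v ih =>
    rw [List.map_append, List.map_singleton, packP_concat, packP_concat, ih]
    simp only [act]
    refine Prod.ext ?_ ?_ <;> simp only <;> ring

/-- Digits of absolute value below half the radix are determined by the number that they represent.
-/
theorem packP_injective {L L' : List Pt} (hlen : L.length = L'.length)
    (h : ∀ p ∈ L, |p.1| < 2 ^ 47 ∧ |p.2| < 2 ^ 47) (h' : ∀ p ∈ L', |p.1| < 2 ^ 47 ∧ |p.2| < 2 ^ 47)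
    (hP : packP L = packP L') : L = L' := by
  induction L using List.reverseRecOn generalizing L' with
  | nil => exact (List.length_eq_zero_iff.1 hlen.symm).symm
  | append_singleton l v ih =>
    rcases List.eq_nil_or_concat L' with rfl | ⟨l', v', rfl⟩
    · simp at hlen
    rw [List.concat_eq_append] at *
    rw [packP_concat, packP_concat] at hP
    have hv := h v (by simp)
    have hv' := h' v' (by simp)
    rw [abs_lt, abs_lt] at hv hv'
    have e1 := congrArg Prod.fst hP
    have e2 := congrArg Prod.snd hP
    simp only [radix] at e1 e2
    have f1 : (packP l).1 = (packP l').1 ∧ v.1 = v'.1 := by omega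
    have f2 : (packP l).2 = (packP l').2 ∧ v.2 = v'.2 := by omega
    have : l = l' := ih (by simpa using hlen) (fun p hp => h p (by simp [hp])) (fun p hp => h' p (by simp [hp]))
      (Prod.ext f1.1 f2.1)
    rw [this, Prod.ext f1.2 f2.2]

/-- The invariant of a flag of a polygon that is compared for canonical forms. -/
def key : List Pt → ℤ ×ₗ ℤ ×ₗ ℤ ×ₗ ℤ
  | u :: v :: l => toLex (cross u v, toLex (res u v,
      toLex (cross u (packP (u :: v :: l)), cross (packP (u :: v :: l)) v)))
  | _ => toLex (0, toLex (0, toLex (0, 0)))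

theorem key_map {U : Matrix (Fin 2) (Fin 2) ℤ} (h : U.det = 1) {L : List Pt}
    (hp : ∀ p ∈ L, IsCoprime p.1 p.2) : key (L.map (act U)) = key L := by
  match L with
  | [] => rfl
  | [_] => rfl
  | u :: v :: l =>
    have := packP_map U (u :: v :: l)
    simp only [List.map_cons] at this
    simp only [List.map_cons, key, this, cross_act_one h, res_act h (hp u (by simp))]

/-- The rotations of a cyclic list and of its mirror image. -/
def Flag (F L : List Pt) : Prop := F ~r L ∨ F ~r mirror L

theorem Flag.trans {F G L : List Pt} (h : Flag G F) (h' : Flag F L) : Flag G L := by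
  rcases h with h | h <;> rcases h' with h' | h'
  · exact Or.inl (h.trans h')
  · exact Or.inr (h.trans h')
  · exact Or.inr (h.trans (mirror_isRotated h'))
  · refine Or.inl (h.trans ?_)
    have := mirror_isRotated h'
    rwa [mirror_mirror] at this

theorem Flag.isCycle {k : ℕ} {F L : List Pt} (h : Flag F L) (hL : IsCycle k L) : IsCycle k F := by
  rcases h with h | h
  · exact hL.isRotated h.symm
  · exact hL.mirror.isRotated h.symm

/-- The first two points of a list are `(1, 0)` and `(a, d)` with `0 ≤ a < d`. -/
def Normalized (L : List Pt) : Prop := ∃ a d l, L = (1, 0) :: (a, d) :: l ∧ 0 ≤ a ∧ a < d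

/-- The canonical cyclic lists. -/
structure Canon (k : ℕ) (L : List Pt) : Prop where
  isCycle : IsCycle k L
  normalized : Normalized L
  max : ∀ F, Flag F L → key F ≤ key L

/-- The flags of the image are the images of the flags. On mirrored lists the matrix is conjugated
by the exchange of coordinates, which keeps determinant one. -/
theorem exists_flag_key_eq {U : Matrix (Fin 2) (Fin 2) ℤ} (h : U.det = 1) {L G : List Pt}
    (hp : ∀ p ∈ L, IsCoprime p.1 p.2) (hG : Flag G (L.map (act U))) :
    ∃ F, Flag F L ∧ key G = key F := by
  rcases hG with ⟨n, hn⟩ | ⟨n, hn⟩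
  · have hr : L.map (act U) ~r G := (List.IsRotated.symm ⟨n, hn⟩)
    obtain ⟨m, hm⟩ := hr
    rw [← List.map_rotate] at hm
    refine ⟨L.rotate m, Or.inl (List.IsRotated.symm ⟨m, rfl⟩), ?_⟩
    rw [← hm, key_map h]
    intro p hp'; exact hp p (by simpa using hp')
  · have hr : mirror (L.map (act U)) ~r G := (List.IsRotated.symm ⟨n, hn⟩)
    obtain ⟨m, hm⟩ := hr
    rw [mirror_map_act, ← List.map_rotate] at hm
    refine ⟨(mirror L).rotate m, Or.inr (List.IsRotated.symm ⟨m, rfl⟩), ?_⟩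
    rw [← hm, key_map (det_conj_swap h)]
    intro p hp'
    have : p ∈ mirror L := by simpa using hp'
    exact (hp _ (mem_mirror.1 this)).symm

/-- The second row is the determinant with `u`. The first row is a Bézout pair for `u`, shifted by
the multiple of the second row that reduces the image of `v` to its residue. -/
theorem exists_normalize {u v : Pt} (hu : IsCoprime u.1 u.2) :
    ∃ U : Matrix (Fin 2) (Fin 2) ℤ, U.det = 1 ∧ act U u = (1, 0) ∧ act U v = (res u v, cross u v) := by
  obtain ⟨s, t, hst⟩ := hu
  set m := (s * v.1 + t * v.2) / cross u v with hm
  have hdm := Int.emod_add_mul_ediv (s * v.1 + t * v.2) (cross u v)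
  rw [← res_eq hst, ← hm] at hdm
  refine ⟨!![s + m * u.2, t - m * u.1; -u.2, u.1], ?_, ?_, ?_⟩
  · simp [Matrix.det_fin_two]; linear_combination hst
  · simp [act]; constructor
    · linear_combination hst
    · ring
  · simp only [act, Matrix.of_apply, Matrix.cons_val', Matrix.cons_val_zero, Matrix.cons_val_one,
      Matrix.cons_val_fin_one]
    refine Prod.ext ?_ ?_
    · simp only
      rw [← sub_eq_zero]
      have : res u v = s * v.1 + t * v.2 - cross u v * m := by linarith
      rw [this]; unfold cross; ring
    · simp only [cross]; ring

/-- Among the finitely many flags one has the greatest key. Normalizing its first edge changes no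
key, and neither the number of vertices nor the area. -/
theorem exists_canon {k : ℕ} (hk : 0 < k) {A : Set Plane} (hA : A ∈ hollowLDP k) :
    ∃ L, Canon k L ∧ UnimodEquiv A (hull L) ∧ (vertices A).encard = L.length ∧
      volume A = ENNReal.ofReal (area2 L / 2) := by
  obtain ⟨L, hL, rfl⟩ := exists_isCycle hk hA
  obtain ⟨F, hF, hmax⟩ : ∃ F, Flag F L ∧ ∀ G, Flag G L → key G ≤ key F := by
    obtain ⟨F, hF, h⟩ := (L.cyclicPermutations ++ (mirror L).cyclicPermutations).toFinset.exists_max_image key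
      ⟨L, by simp [List.IsRotated.refl]⟩
    simp only [List.mem_toFinset, List.mem_append, List.mem_cyclicPermutations_iff] at hF h
    exact ⟨F, hF, h⟩
  have hFc := hF.isCycle hL
  have hFh : ∃ U : Matrix (Fin 2) (Fin 2) ℤ, (U.det = 1 ∨ U.det = -1) ∧ matAct U '' hull L = hull F := by
    rcases hF with h | h
    · exact ⟨1, by simp, by rw [matAct_one, image_id]; exact hull_congr fun p => h.symm.mem_iff⟩
    · refine ⟨swapMat, by simp [det_swapMat], ?_⟩
      rw [← hull_mirror]; exact hull_congr fun p => h.symm.mem_iff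
  have hlen : F.length = L.length := by
    rcases hF with h | h
    · exact h.perm.length_eq
    · rw [h.perm.length_eq, length_mirror]
  match F, hFc.three with
  | u :: v :: l, _ =>
    have hcr : 0 < cross u v := hFc.pos u v ⟨l, List.IsRotated.refl _⟩
    obtain ⟨U, hU, hu, hv⟩ := exists_normalize (v := v) (hFc.prim u (by simp))
    have hN := hFc.map_act hU
    have hvol : volume (hull L) = volume (hull ((u :: v :: l).map (act U))) := by
      obtain ⟨V, hV, hVh⟩ := hFh
      rw [← matAct_hull, volume_matAct (Or.inl hU), ← hVh, volume_matAct hV]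
    refine ⟨(u :: v :: l).map (act U), ⟨hN, ?_, ?_⟩, ?_, ?_, ?_⟩
    · refine ⟨res u v, cross u v, l.map (act U), by simp [hu, hv], ?_, ?_⟩
      · exact Int.emod_nonneg _ hcr.ne'
      · exact Int.emod_lt_of_pos _ hcr
    · intro G hG
      obtain ⟨F', hF', e⟩ := exists_flag_key_eq hU hFc.prim hG
      rw [e, key_map hU hFc.prim]
      exact hmax _ (hF'.trans hF)
    · refine unimodEquiv_equivalence.trans hFh ⟨U, Or.inl hU, ?_⟩
      rw [matAct_hull]
    · rw [encard_vertices_hull hL.three hL.triple, ← hlen]; simp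
    · rw [hvol, (volume_hull hN.three hN.triple).2]

/-- A matrix of determinant `-1` becomes one of determinant `1` after precomposition with the
exchange of coordinates, at the cost of passing to the mirror list. Hence `L'` is the image of a
flag of `L`. -/
theorem Canon.key_le {k : ℕ} {L L' : List Pt} (hL : Canon k L) (hL' : IsCycle k L')
    (h : UnimodEquiv (hull L) (hull L')) : key L' ≤ key L ∧ L'.length = L.length := by
  obtain ⟨V, F, hV, hF, hr⟩ : ∃ (V : Matrix (Fin 2) (Fin 2) ℤ) (F : List Pt), V.det = 1 ∧ Flag F L ∧
      L' ~r F.map (act V) := by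
    obtain ⟨U, hU | hU, hUh⟩ := h
    · refine ⟨U, L, hU, Or.inl (List.IsRotated.refl _), ?_⟩
      rw [matAct_hull] at hUh
      exact isRotated_of_hull_eq hL' (hL.isCycle.map_act hU) hUh.symm
    · have hdet : (U * swapMat).det = 1 := by rw [Matrix.det_mul, hU, det_swapMat]; norm_num
      refine ⟨U * swapMat, mirror L, hdet, Or.inr (List.IsRotated.refl _), ?_⟩
      refine isRotated_of_hull_eq hL' (hL.isCycle.mirror.map_act hdet) ?_
      rw [← matAct_hull, hull_mirror, ← image_comp, ← matAct_mul, mul_assoc, swapMat_mul_self, mul_one, hUh]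
  have hFc := hF.isCycle hL.isCycle
  obtain ⟨F', hF', e⟩ := exists_flag_key_eq hV hFc.prim (Or.inl hr)
  refine ⟨e ▸ hL.max _ (hF'.trans hF), ?_⟩
  rw [hr.perm.length_eq, List.length_map]
  rcases hF with h | h
  · exact h.perm.length_eq
  · rw [h.perm.length_eq, length_mirror]

theorem res_one_zero {a d : ℤ} (h0 : 0 ≤ a) (h1 : a < d) : res (1, 0) (a, d) = a := by
  rw [res_eq (s := 1) (t := 0) (by simp)]
  simp [cross]
  exact Int.emod_eq_of_lt h0 h1

theorem key_cons (u v : Pt) (l : List Pt) : key (u :: v :: l) = toLex (cross u v, toLex (res u v,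
      toLex (cross u (packP (u :: v :: l)), cross (packP (u :: v :: l)) v))) := rfl

/-- The first two components of the key determine the normalized first edge. The last two are, up to
the factor `d`, the coordinates of the packed vector in the basis of this edge, and the packed
vector determines the list. -/
theorem key_injective {L L' : List Pt} (hL : Normalized L) (hL' : Normalized L')
    (hlen : L.length = L'.length)
    (h : ∀ p ∈ L, |p.1| < 2 ^ 47 ∧ |p.2| < 2 ^ 47) (h' : ∀ p ∈ L', |p.1| < 2 ^ 47 ∧ |p.2| < 2 ^ 47)
    (hk : key L = key L') : L = L' := by
  apply packP_injective hlen h h'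
  obtain ⟨a, d, l, rfl, h0, h1⟩ := hL
  obtain ⟨a', d', l', rfl, h0', h1'⟩ := hL'
  rw [key_cons, key_cons, res_one_zero h0 h1, res_one_zero h0' h1'] at hk
  have e1 := congrArg (fun z => (ofLex z).1) hk
  have e2 := congrArg (fun z => (ofLex (ofLex z).2).1) hk
  have e3 := congrArg (fun z => (ofLex (ofLex (ofLex z).2).2).1) hk
  have e4 := congrArg (fun z => (ofLex (ofLex (ofLex z).2).2).2) hk
  simp only [ofLex_toLex] at e1 e2 e3 e4
  simp only [cross, one_mul, zero_mul, sub_zero] at e1 e2 e3 e4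
  subst e1 e2
  refine Prod.ext ?_ e3
  rw [e3] at e4
  have : d ≠ 0 := by omega
  exact mul_right_cancel₀ this (by linarith)

/-- All vertices of normalized cyclic lists have coordinates of at most 47 bits. -/
def Bounded (k : ℕ) : Prop :=
  ∀ L, IsCycle k L → Normalized L → ∀ p ∈ L, |p.1| < 2 ^ 47 ∧ |p.2| < 2 ^ 47

theorem canon_unique {k : ℕ} (hb : Bounded k) {L L' : List Pt} (hL : Canon k L) (hL' : Canon k L')
    (h : UnimodEquiv (hull L) (hull L')) : L = L' := by
  have h1 := hL.key_le hL'.isCycle h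
  have h2 := hL'.key_le hL.isCycle (unimodEquiv_equivalence.symm h)
  exact key_injective hL.normalized hL'.normalized h2.2 (hb _ hL.isCycle hL.normalized)
    (hb _ hL'.isCycle hL'.normalized) (le_antisymm h2.1 h1.1)

theorem classCount_eq {k : ℕ} (hb : Bounded k) {E : List (List Pt)} (hE : E.Nodup)
    (hc : ∀ L ∈ E, Canon k L) {F : Set (Set Plane)} (h1 : ∀ A ∈ F, ∃ L ∈ E, UnimodEquiv A (hull L))
    (h2 : ∀ L ∈ E, hull L ∈ F) : classCount F = E.length := by
  have himg : (Quotient.mk unimodSetoid) '' F =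
      (fun L => Quotient.mk unimodSetoid (hull L)) '' {L | L ∈ E} := by
    ext x
    constructor
    · rintro ⟨A, hA, rfl⟩
      obtain ⟨L, hL, h⟩ := h1 A hA
      exact ⟨L, hL, Quotient.sound (s := unimodSetoid) (unimodEquiv_equivalence.symm h)⟩
    · rintro ⟨L, hL, rfl⟩
      exact ⟨_, h2 L hL, rfl⟩
  have hinj : InjOn (fun L => Quotient.mk unimodSetoid (hull L)) {L | L ∈ E} := by
    intro L hL L' hL' h
    exact canon_unique hb (hc L hL) (hc L' hL') (Quotient.exact (s := unimodSetoid) h)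
  classical
  rw [classCount, himg, hinj.encard_image]
  have : {L | L ∈ E} = ((E.toFinset : Finset (List Pt)) : Set (List Pt)) := by ext; simp
  rw [this, Set.encard_coe_eq_coe_finsetCard, List.toFinset_card_of_nodup hE]

/-! ### Reading off the table from the list of canonical forms -/

/-- `E` enumerates the canonical cyclic lists. -/
structure Enumerates (k : ℕ) (E : List (List Pt)) : Prop where
  pos : 0 < k
  bounded : Bounded k
  nodup : E.Nodup
  mem : ∀ L, L ∈ E ↔ Canon k L

namespace Enumerates

theorem classCount_all {k : ℕ} {E : List (List Pt)} (hE : Enumerates k E) : classCount (hollowLDP k) = E.length := by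
  refine classCount_eq hE.bounded hE.nodup (fun L hL => (hE.mem L).1 hL) ?_ ?_
  · intro A hA
    obtain ⟨L, hL, h, -⟩ := exists_canon hE.pos hA
    exact ⟨L, (hE.mem L).2 hL, h⟩
  · intro L hL
    exact hull_mem_hollowLDP ((hE.mem L).1 hL).isCycle

theorem encard_vertices {k : ℕ} {E : List (List Pt)} (hE : Enumerates k E) {L : List Pt} (hL : L ∈ E) : (vertices (hull L)).encard = L.length := by
  have := ((hE.mem L).1 hL).isCycle
  exact encard_vertices_hull this.three this.triple

theorem classCount_with {k : ℕ} {E : List (List Pt)} (hE : Enumerates k E) (n : ℕ) :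
    classCount (hollowLDPWith k n) = (E.filter fun L => L.length = n).length := by
  refine classCount_eq hE.bounded (hE.nodup.filter _)
    (fun L hL => (hE.mem L).1 (List.mem_of_mem_filter hL)) ?_ ?_
  · rintro A ⟨hA, hn⟩
    obtain ⟨L, hL, h, hv, -⟩ := exists_canon hE.pos hA
    refine ⟨L, List.mem_filter.2 ⟨(hE.mem L).2 hL, ?_⟩, h⟩
    rw [hv] at hn
    simpa using hn
  · intro L hL
    have h1 := List.mem_filter.1 hL
    refine ⟨hull_mem_hollowLDP ((hE.mem L).1 h1.1).isCycle, ?_⟩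
    rw [hE.encard_vertices h1.1]
    have := h1.2
    simp at this
    rw [this]

theorem volume_eq {k : ℕ} {E : List (List Pt)} (hE : Enumerates k E) {L : List Pt} (hL : L ∈ E) : volume (hull L) = ENNReal.ofReal (area2 L / 2) := by
  have := ((hE.mem L).1 hL).isCycle
  exact (volume_hull this.three this.triple).2

theorem maxVolume_with {k : ℕ} {E : List (List Pt)} (hE : Enumerates k E) {n : ℕ} {m : ℤ} (h1 : ∃ L ∈ E, L.length = n ∧ area2 L = m)
    (h2 : ∀ L ∈ E, L.length = n → area2 L ≤ m) :
    MaxVolume (hollowLDPWith k n) (ENNReal.ofReal (m / 2)) := by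
  constructor
  · obtain ⟨L, hL, hn, ha⟩ := h1
    refine ⟨hull L, ⟨hull_mem_hollowLDP ((hE.mem L).1 hL).isCycle, ?_⟩, ?_⟩
    · rw [hE.encard_vertices hL, hn]
    · simp only [hE.volume_eq hL, ha]
  · rintro _ ⟨A, ⟨hA, hn⟩, rfl⟩
    obtain ⟨L, hL, -, hv, ha⟩ := exists_canon hE.pos hA
    rw [hv] at hn
    simp only [ha]
    apply ENNReal.ofReal_le_ofReal
    have := h2 L ((hE.mem L).2 hL) (by simpa using hn)
    have : (area2 L : ℝ) ≤ m := by exact_mod_cast this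
    linarith

theorem maxVolume_all {k : ℕ} {E : List (List Pt)} (hE : Enumerates k E) {m : ℤ} (h1 : ∃ L ∈ E, area2 L = m)
    (h2 : ∀ L ∈ E, area2 L ≤ m) :
    MaxVolume (hollowLDP k) (ENNReal.ofReal (m / 2)) := by
  constructor
  · obtain ⟨L, hL, ha⟩ := h1
    refine ⟨hull L, hull_mem_hollowLDP ((hE.mem L).1 hL).isCycle, ?_⟩
    simp only [hE.volume_eq hL, ha]
  · rintro _ ⟨A, hA, rfl⟩
    obtain ⟨L, hL, -, hv, ha⟩ := exists_canon hE.pos hA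
    simp only [ha]
    apply ENNReal.ofReal_le_ofReal
    have := h2 L ((hE.mem L).2 hL)
    have : (area2 L : ℝ) ≤ m := by exact_mod_cast this
    linarith

theorem maxVertices {k : ℕ} {E : List (List Pt)} (hE : Enumerates k E) {n : ℕ} (h1 : ∃ L ∈ E, L.length = n) (h2 : ∀ L ∈ E, L.length ≤ n) :
    MaxVertices (hollowLDP k) n := by
  constructor
  · obtain ⟨L, hL, ha⟩ := h1
    refine ⟨hull L, hull_mem_hollowLDP ((hE.mem L).1 hL).isCycle, ?_⟩
    simp only [hE.encard_vertices hL, ha]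
  · rintro _ ⟨A, hA, rfl⟩
    obtain ⟨L, hL, -, hv, ha⟩ := exists_canon hE.pos hA
    simp only [hv]
    exact_mod_cast h2 L ((hE.mem L).2 hL)

end Enumerates
end LDP

namespace LDP
open Set MeasureTheory

/-! ### Bounds for the determinants of vertices -/

/-- For the point `(n, j)` the determinants with the two ends of the edge are `j` and `n d - j a`.
Points of height zero satisfy the condition by themselves. -/
theorem hollow_normal_iff {k : ℕ} {a d : ℤ} (hk : 0 < k) (hd : 0 < d) :
    Hollow k (1, 0) (a, d) ↔ ∀ j n : ℤ, 1 ≤ j → 0 ≤ n * d - j * a → d ≤ k * (j + (n * d - j * a)) := by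
  have hk' : (1 : ℤ) ≤ k := by exact_mod_cast hk
  constructor
  · intro h j n hj hn
    by_contra hc
    push Not at hc
    have := h (n, j) (by simp [cross]; omega) (by simp [cross]; linarith) (by simpa [cross] using hc)
    have := congrArg Prod.snd this
    simp at this; omega
  · rintro h ⟨x, y⟩ h1 h2 h3
    simp only [cross, one_mul, zero_mul, sub_zero] at h1 h2 h3
    by_cases hy : y = 0
    · subst hy
      simp only [zero_mul, sub_zero, zero_add] at h2 h3
      have hx : 0 ≤ x := by
        by_contra hc
        have : x * d < 0 := mul_neg_of_neg_of_pos (by omega) hd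
        omega
      have : x = 0 := by
        by_contra hc
        have h5 : d ≤ x * d := by nlinarith [show 1 ≤ x by omega]
        nlinarith
      rw [this]; rfl
    · exfalso
      have := h y x (by omega) h2
      omega

/-- The sum `j + N` is at most `d / b + b`, a convex function of `b`, so it suffices to look at the
ends `b = k + 1` and `b = d / (k + 1)`. The product in `h2` expresses this convexity. -/
theorem window_lt {k b d j N : ℤ} (hk : 1 ≤ k) (hbk : k + 1 ≤ b) (hb : (k + 1) * b ≤ d)
    (hd : k * (k + 1) ^ 2 ≤ d) (hjb : j * b < d) (hNb : N ≤ b) : k * (j + N) < d := by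
  have hpos : 0 < b := by omega
  have h2 : (b - (k + 1)) * ((k + 1) * b - d) ≤ 0 :=
    mul_nonpos_of_nonneg_of_nonpos (by omega) (by linarith)
  have h4 : k * ((k + 1) * (b * b + d)) ≤ k * (b * ((k + 1) ^ 2 + d)) :=
    mul_le_mul_of_nonneg_left (by linarith) (by omega)
  have h5 : b * (k * (k + 1) ^ 2) ≤ b * d := mul_le_mul_of_nonneg_left hd hpos.le
  have h3 : (k + 1) * (k * (b * b + d)) ≤ (k + 1) * (d * b) := by linarith
  have h6 : k * (b * b + d) ≤ d * b := le_of_mul_le_mul_left h3 (by omega)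
  have h7 : N * b ≤ b * b := mul_le_mul_of_nonneg_right hNb hpos.le
  have h8 : k * (j * b + N * b) < k * (d + b * b) := mul_lt_mul_of_pos_left (by linarith) (by omega)
  have h9 : k * (j + N) * b < d * b := by linarith
  exact lt_of_mul_lt_mul_right h9 hpos.le

set_option maxHeartbeats 400000 in
/-- A good rational approximation of the slope of an edge of large determinant. -/
theorem exists_short_direction {k : ℕ} (hk : 0 < k) {a d : ℤ} (hc : IsCoprime a d)
    (hd : (k : ℤ) * (k + 1) ^ 2 < d) (h : Hollow k (1, 0) (a, d)) :
    ∃ p q : ℤ, 1 ≤ q ∧ q ≤ k ∧ 1 ≤ q * a - p * d ∧ q * a - p * d ≤ k := by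
  have hk' : (1 : ℤ) ≤ k := by exact_mod_cast hk
  have hd0 : 0 < d := lt_trans (by positivity) hd
  rw [hollow_normal_iff hk hd0] at h
  -- Dirichlet's theorem approximates `a / d` with a denominator of at most `k`; the fraction is
  -- then reduced to lowest terms.
  obtain ⟨p, q, hq1, hqk, hpq, hb⟩ : ∃ p q : ℤ, 1 ≤ q ∧ q ≤ k ∧ IsCoprime p q ∧ (k + 1) * |q * a - p * d| ≤ d := by
    obtain ⟨p, q, hq0, hqk, hb⟩ := Real.exists_int_int_abs_mul_sub_le ((a : ℝ) / d) hk
    have hdR : (0 : ℝ) < d := by exact_mod_cast hd0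
    have hb1 : (k + 1) * |q * a - p * d| ≤ d := by
      have e : (q : ℝ) * (a / d) - p = (q * a - p * d) / d := by field_simp
      rw [e, abs_div, abs_of_pos hdR, div_le_div_iff₀ hdR (by positivity)] at hb
      have : ((k : ℝ) + 1) * |(q : ℝ) * a - p * d| ≤ d := by linarith
      exact_mod_cast this
    have hg0 : 0 < Int.gcd p q := Int.gcd_pos_of_ne_zero_right _ hq0.ne'
    obtain ⟨p', q', hcop, e1, e2⟩ := Int.exists_gcd_one hg0
    set g : ℤ := (Int.gcd p q : ℤ) with hg
    have hg1 : 1 ≤ g := by omega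
    have hq' : 1 ≤ q' := by
      by_contra hc
      nlinarith
    refine ⟨p', q', hq', ?_, Int.isCoprime_iff_gcd_eq_one.2 hcop, ?_⟩
    · nlinarith
    · have e3 : q * a - p * d = (q' * a - p' * d) * g := by rw [e1, e2]; ring
      rw [e3, abs_mul, abs_of_pos (show 0 < g by omega)] at hb1
      have : 0 ≤ (k + 1) * |q' * a - p' * d| := by positivity
      nlinarith
  set b := q * a - p * d with hbdef
  rcases lt_trichotomy b 0 with hneg | hz | hpos
  -- For negative `b` the vector `(p, q)` itself lies in the cone over the edge and contradicts
  -- hollowness.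
  · exfalso
    rw [abs_of_neg hneg] at hb
    have h1 := h q p hq1 (by linarith)
    have h2 : q + (p * d - q * a) = q - b := by rw [hbdef]; ring
    rw [h2] at h1
    nlinarith
  · exfalso
    have h1 : d ∣ q * a := ⟨p, by linarith⟩
    have h2 : d ∣ q := hc.symm.dvd_of_dvd_mul_right h1
    have := Int.le_of_dvd (by omega) h2
    nlinarith
  · rw [abs_of_pos hpos] at hb
    refine ⟨p, q, hq1, hqk, by omega, ?_⟩
    by_contra hbk
    push Not at hbk
    obtain ⟨s, t, hst⟩ := hpq
    -- the top of a window of `q` consecutive candidates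
    set c := (d - 1) / b with hcdef
    have hc1 : c * b ≤ d - 1 := Int.ediv_mul_le _ hpos.ne'
    have hc2 : d - 1 < (c + 1) * b := by
      have := Int.lt_ediv_add_one_mul_self (d - 1) hpos
      simpa using this
    set j := c - (c + s) % q with hj
    have hm0 := Int.emod_nonneg (c + s) (show q ≠ 0 by omega)
    have hm1 := Int.emod_lt_of_pos (c + s) (show 0 < q by omega)
    -- Every window of `q` consecutive heights contains one with this property. The point `(n, j)`
    -- then satisfies `n q - j p = 1`: it lies on the lattice line next to the one through `(p, q)`.
    have hdvd : q ∣ j * p + 1 := by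
      have h1 : q ∣ j + s := by
        have := Int.dvd_self_sub_emod (x := c + s) (m := q)
        rw [hj]; convert this using 1; ring
      have : j * p + 1 = (j + s) * p + q * t := by linear_combination -hst
      rw [this]
      exact dvd_add (h1.mul_right _) (dvd_mul_right _ _)
    obtain ⟨n, hn⟩ := hdvd
    have hck : (k : ℤ) ≤ c := by
      by_contra hcc
      have : c + 1 ≤ k := by omega
      nlinarith
    have hj1 : 1 ≤ j := by omega
    have hqN : q * (n * d - j * a) = d - j * b := by
      rw [hbdef]; linear_combination (-d) * hn
    have hjb : j * b < d := by
      have : j * b ≤ c * b := mul_le_mul_of_nonneg_right (by omega) hpos.le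
      omega
    have hjqb : d ≤ j * b + q * b := by
      have : (c + 1) * b ≤ (j + q) * b := mul_le_mul_of_nonneg_right (by omega) hpos.le
      linarith
    have hN0 : 0 ≤ n * d - j * a := nonneg_of_mul_nonneg_right (by omega) (show 0 < q by omega)
    have hNb : n * d - j * a ≤ b := le_of_mul_le_mul_left (by omega) (show 0 < q by omega)
    exact absurd (h j n hj1 hN0) (not_le.2 (window_lt hk' (by omega) hb hd.le hjb hNb))

/-- Any two vertices with positive determinant bound a hollow triangle with the origin. -/
theorem IsCycle.pair_hollow {k : ℕ} (hk : 0 < k) {L : List Pt} (hL : IsCycle k L) {p q : Pt}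
    (hp : p ∈ L) (hq : q ∈ L) (h : 0 < cross p q) : Hollow k p q :=
  hollow_of_isAlmostHollow hk (convex_hull L) (isAlmostHollow_hull hL) (toP_mem_hull hp)
    (toP_mem_hull hq) h

/-- The vertices `v` and `w` lie on different sides of the line through `g`. Unless they are
opposite, `g` or `-g` lies in the cone that they span, and its multiple by `k` is not interior to
the polygon. -/
theorem abs_cross_le {k : ℕ} (hk : 0 < k) {L : List Pt} (hL : IsCycle k L) {v w g : Pt}
    (hv : v ∈ L) (hw : w ∈ L) (h1 : 0 < cross v g) (h2 : 0 < cross g w) :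
    |cross v w| ≤ k * (cross v g + cross g w) := by
  have hg : g ≠ 0 := by rintro rfl; simp [cross] at h1
  rw [abs_le]
  constructor
  · by_contra hc
    push Not at hc
    have e1 : cross w v = - cross v w := by unfold cross; ring
    have e2 : cross w (-g) = cross g w := by simp [cross]; ring
    have e3 : cross (-g) v = cross v g := by simp [cross]; ring
    have hpos : 0 < (k : ℤ) * (cross v g + cross g w) := by positivity
    have := hL.pair_hollow hk hw hv (by omega) (-g) (by omega) (by omega) (by
      rw [e1, e2, e3]; linarith)
    exact hg (by simpa using this)
  · by_contra hc
    push Not at hc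
    have hpos : 0 < (k : ℤ) * (cross v g + cross g w) := by positivity
    exact hg (hL.pair_hollow hk hv hw (by omega) g h1.le h2.le hc)

theorem hollow_normalize {k : ℕ} {u v : Pt} (hu : IsCoprime u.1 u.2) :
    Hollow k u v ↔ Hollow k (1, 0) (res u v, cross u v) := by
  obtain ⟨U, hU, h1, h2⟩ := exists_normalize (v := v) hu
  rw [← h1, ← h2]
  refine ⟨fun hh => hh.act hU, fun hh => ?_⟩
  have := hh.act (det_inv_eq_one hU)
  rwa [act_inv_act hU, act_inv_act hU] at this

theorem isCoprime_normalize {u v : Pt} (hu : IsCoprime u.1 u.2) (hv : IsCoprime v.1 v.2) :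
    IsCoprime (res u v) (cross u v) := by
  obtain ⟨U, hU, h1, h2⟩ := exists_normalize (v := v) hu
  have := isCoprime_act hU hv
  rwa [h2] at this

/-- A short direction `g` makes the determinants `cross v g` and `cross w g` at most `k`. Comparison
with a vertex `z` on the other side of the line through `g` bounds the determinant of `v` and `w`.
-/
theorem cross_le {k : ℕ} (hk : 0 < k) {L : List Pt} (hL : IsCycle k L) {v w : Pt}
    (hv : v ∈ L) (hw : w ∈ L) : cross v w ≤ 2 * k ^ 2 * (k + 1) := by
  by_contra hc
  push Not at hc
  have hk' : (1 : ℤ) ≤ k := by exact_mod_cast hk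
  have hpos : 0 < cross v w := lt_trans (by positivity) hc
  obtain ⟨U, hU, h1, h2⟩ := exists_normalize (v := w) (hL.prim v hv)
  have hh := (hollow_normalize (hL.prim v hv)).1 (hL.pair_hollow hk hv hw hpos)
  obtain ⟨p, q, hq1, hqk, hb1, hbk⟩ := exists_short_direction hk
    (isCoprime_normalize (hL.prim v hv) (hL.prim w hw)) (by nlinarith) hh
  set g : Pt := act U⁻¹ (p, q) with hg
  have e1 : cross v g = q := by
    rw [← cross_act_one hU, h1, hg, act_act_inv hU]; simp [cross]
  have e2 : cross w g = q * res v w - p * cross v w := by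
    rw [← cross_act_one hU, h2, hg, act_act_inv hU]; simp [cross]; ring
  have hg0 : g ≠ 0 := by
    intro h0
    rw [h0] at e1; simp [cross] at e1; omega
  have h0 := (zero_mem_interior_iff hL.three hL.triple).2 hL.pos
  obtain ⟨⟨z, hz, hz'⟩, -, -⟩ := exists_edge_cone hL.three h0 hg0
  have b1 := abs_cross_le hk hL hv hz (by omega) hz'
  have b2 := abs_cross_le hk hL hw hz (by omega) hz'
  rw [abs_le] at b1 b2
  have pl : cross g z * cross v w = cross v g * cross w z - cross w g * cross v z := by
    unfold cross; ring
  rw [e1] at b1 pl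
  rw [e2] at b2 pl
  set b := q * res v w - p * cross v w
  set h := cross g z
  set e := cross v w
  have c1 : q * cross w z ≤ q * (k * (b + h)) := mul_le_mul_of_nonneg_left b2.2 (by omega)
  have c2 : b * (-(k * (q + h))) ≤ b * cross v z := mul_le_mul_of_nonneg_left b1.1 (by omega)
  have c3 : h * e ≤ k * (h * (q + b) + 2 * (q * b)) := by rw [pl]; nlinarith
  have c4 : q * b ≤ k * k := mul_le_mul hqk hbk (by omega) (by omega)
  have c5 : h * (q + b) ≤ h * (2 * k) := mul_le_mul_of_nonneg_left (by omega) hz'.le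
  have c6 : (k : ℤ) * (h * (q + b) + 2 * (q * b)) ≤ k * (h * (2 * k) + 2 * (k * k)) :=
    mul_le_mul_of_nonneg_left (by linarith) (by omega)
  -- The constant term is absorbed into the multiple of `h`, which is possible since the integer `h`
  -- is at least one.
  have c7 : (k : ℤ) * (2 * (k * k)) ≤ h * (k * (2 * (k * k))) := le_mul_of_one_le_left (by positivity) (by omega)
  have c8 : h * e ≤ h * (2 * k ^ 2 * (k + 1)) := by nlinarith
  have := le_of_mul_le_mul_left c8 hz'
  omega

/-! ### Types of edges -/

/-- `(e, α)` is the type of an edge of an almost `k`-hollow polygon. -/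
def OkType (k : ℕ) (e α : ℤ) : Prop := 0 ≤ α ∧ α < e ∧ IsCoprime α e ∧ Hollow k (1, 0) (α, e)

theorem res_nonneg {u v : Pt} (h : 0 < cross u v) : 0 ≤ res u v := Int.emod_nonneg _ h.ne'

theorem res_lt {u v : Pt} (h : 0 < cross u v) : res u v < cross u v := Int.emod_lt_of_pos _ h

theorem okType_of_hollow {k : ℕ} {u v : Pt} (hu : IsCoprime u.1 u.2) (hv : IsCoprime v.1 v.2)
    (h : 0 < cross u v) (hh : Hollow k u v) : OkType k (cross u v) (res u v) :=
  ⟨res_nonneg h, res_lt h, isCoprime_normalize hu hv, (hollow_normalize hu).1 hh⟩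

theorem hollow_of_okType {k : ℕ} {u v : Pt} (hu : IsCoprime u.1 u.2) 
    (hh : OkType k (cross u v) (res u v)) : 0 < cross u v ∧ Hollow k u v ∧ IsCoprime v.1 v.2 := by
  have h : 0 < cross u v := lt_of_le_of_lt hh.1 hh.2.1
  refine ⟨h, (hollow_normalize hu).2 hh.2.2.2, ?_⟩
  obtain ⟨U, hU, h1, h2⟩ := exists_normalize (v := v) hu
  have := isCoprime_act (det_inv_eq_one hU) (p := act U v) (by rw [h2]; exact hh.2.2.1)
  rwa [act_inv_act hU] at this

theorem IsCycle.pair_okType {k : ℕ} (hk : 0 < k) {L : List Pt} (hL : IsCycle k L) {p q : Pt}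
    (hp : p ∈ L) (hq : q ∈ L) (h : 0 < cross p q) : OkType k (cross p q) (res p q) :=
  okType_of_hollow (hL.prim p hp) (hL.prim q hq) h (hL.pair_hollow hk hp hq h)

/-- This is the congruence `q ≡ α p` modulo `cross p q` that characterizes the residue `α`. -/
theorem cross_dvd_res_sub {p q : Pt} (hp : IsCoprime p.1 p.2) :
    cross p q ∣ q.1 - res p q * p.1 ∧ cross p q ∣ q.2 - res p q * p.2 := by
  obtain ⟨s, t, hst⟩ := hp
  rw [res_eq hst]
  have hdm := Int.emod_add_mul_ediv (s * q.1 + t * q.2) (cross p q)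
  set m := (s * q.1 + t * q.2) / cross p q
  set r := (s * q.1 + t * q.2) % cross p q
  have hr : r = s * q.1 + t * q.2 - cross p q * m := by linarith
  rw [hr]
  refine ⟨⟨m * p.1 - t, ?_⟩, ⟨m * p.2 + s, ?_⟩⟩
  · unfold cross; linear_combination - q.1 * hst
  · unfold cross; linear_combination - q.2 * hst

/-- The residue of the reversed edge. -/
theorem res_swap_mul {u v : Pt} (hu : IsCoprime u.1 u.2) (hv : IsCoprime v.1 v.2) :
    cross u v ∣ res v.swap u.swap * res u v - 1 := by
  obtain ⟨⟨a, ha⟩, ⟨b, hb⟩⟩ := cross_dvd_res_sub (q := v) hu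
  obtain ⟨⟨a', ha'⟩, ⟨b', hb'⟩⟩ := cross_dvd_res_sub (p := v.swap) (q := u.swap) hv.symm
  rw [cross_swap] at ha' hb'
  simp only [Prod.fst_swap, Prod.snd_swap] at ha' hb'
  obtain ⟨s, t, hst⟩ := hu
  set α := res u v
  set β := res v.swap u.swap
  refine ⟨-(s * b' + t * a' + β * (s * a + t * b)), ?_⟩
  linear_combination (-(β * α - 1)) * hst - (β * s) * ha - β * t * hb - s * hb' - t * ha'

end LDP

namespace LDP

/-! ### Local conditions for convexity -/

/-- The identity is the Plücker relation for the differences with `o`. The next two lemmas use the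
same relation with base points `q` and `b`. -/
theorem orient_pos_of_fan {o b c d e : Pt} (h1 : 0 < orient o b d) (h2 : 0 < orient o b c)
    (h3 : 0 < orient o d e) (h4 : 0 < orient o b e) (h5 : 0 < orient o c d) : 0 < orient o c e := by
  have h : orient o b d * orient o c e =
      orient o b c * orient o d e + orient o b e * orient o c d := by unfold orient cross; ring
  exact Int.pos_of_mul_pos_right (by rw [h]; positivity) h1

theorem orient_pos_of_between {a b p q w : Pt} (h1 : 0 < orient a p q) (h2 : 0 < orient a q w)
    (h3 : 0 < orient b p q) (h4 : 0 < orient a b q) (h5 : 0 < orient p q w) : 0 < orient b q w := by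
  have h : orient a p q * orient b q w =
      orient a q w * orient b p q + orient a b q * orient p q w := by unfold orient cross; ring
  exact Int.pos_of_mul_pos_right (by rw [h]; positivity) h1

theorem orient_pos_of_apex {a b c q w : Pt} (h1 : 0 < orient a b q) (h2 : 0 < orient a b c)
    (h3 : 0 < orient b q w) (h4 : 0 < orient a b w) (h5 : 0 < orient b c q) : 0 < orient b c w := by
  have h : orient a b q * orient b c w =
      orient a b c * orient b q w + orient a b w * orient b c q := by unfold orient cross; ring
  exact Int.pos_of_mul_pos_right (by rw [h]; positivity) h1

/-- Three orientations suffice when a point is appended. Plücker relations extend them first to all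
pairs containing the first point, then to all pairs containing the last point, and finally to
arbitrary pairs. -/
theorem triple_concat {P : List Pt} {v₁ v₂ p q w : Pt} {P₁ P₂ : List Pt}
    (h1 : P = v₁ :: v₂ :: P₁) (h2 : P = P₂ ++ [p, q])
    (h : P.Triplewise fun a b c => 0 < orient a b c)
    (ha : 0 < orient v₁ v₂ w) (hb : 0 < orient v₁ q w) (hc : 0 < orient p q w) :
    (P ++ [w]).Triplewise fun a b c => 0 < orient a b c := by
  rw [List.triplewise_append]
  refine ⟨h, by simp, by simp, ?_⟩
  simp only [List.mem_singleton, forall_eq]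
  rw [List.triplewise_iff_getElem] at h
  rw [List.pairwise_iff_getElem]
  have hn : 2 ≤ P.length := by rw [h1]; simp
  have e0 : P[0] = v₁ := by simp [h1]
  have e1 : P[1] = v₂ := by simp [h1]
  have eq : P[P.length - 1] = q := by simp [h2]
  have ep : P[P.length - 2] = p := by simp [h2]
  have A : ∀ j (hj : j < P.length), 0 < j → 0 < orient P[0] P[j] w := by
    intro j hj hj0
    by_cases hj1 : j = 1
    · subst hj1; rwa [e0, e1]
    by_cases hjn : j = P.length - 1
    · subst hjn; rwa [e0, eq]
    exact orient_pos_of_fan (h 0 1 (P.length - 1) (by omega) (by omega) (by omega))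
      (h 0 1 j (by omega) (by omega) (by omega)) (by rwa [e0, eq]) (by rwa [e0, e1])
      (h 0 j (P.length - 1) (by omega) (by omega) (by omega))
  have B : ∀ i (hi : i < P.length - 1), 0 < orient P[i] q w := by
    intro i hi
    by_cases hi0 : i = 0
    · subst hi0; rwa [e0]
    by_cases hin : i = P.length - 2
    · subst hin; rwa [ep]
    have k1 := h 0 (P.length - 2) (P.length - 1) (by omega) (by omega) (by omega)
    have k2 := h i (P.length - 2) (P.length - 1) (by omega) (by omega) (by omega)
    have k3 := h 0 i (P.length - 1) (by omega) (by omega) (by omega)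
    rw [ep, eq] at k1 k2
    rw [eq] at k3
    exact orient_pos_of_between k1 (by rwa [e0]) k2 k3 hc
  intro i j hi hj hij
  by_cases hi0 : i = 0
  · subst hi0; exact A j hj (by omega)
  by_cases hjn : j = P.length - 1
  · subst hjn; rw [eq]; exact B i (by omega)
  have k1 := h 0 i (P.length - 1) (by omega) (by omega) (by omega)
  have k2 := h 0 i j (by omega) (by omega) (by omega)
  have k3 := h i j (P.length - 1) (by omega) (by omega) (by omega)
  rw [eq] at k1 k3
  exact orient_pos_of_apex k1 k2 (B i (by omega)) (A i hi (by omega)) k3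

/-! ### The search for cyclic lists with a given first edge -/

/-- The bound for the determinants. -/
def bound (k : ℕ) : ℤ := 2 * k ^ 2 * (k + 1)

/-- An edge whose type does not exceed the type `(d, a)` of the first edge. -/
def Adm (k : ℕ) (d a : ℤ) (u v : Pt) : Prop :=
  OkType k (cross u v) (res u v) ∧
    (cross u v < d ∨ cross u v = d ∧ res u v ≤ a ∧ res v.swap u.swap ≤ a)

/-- The candidates for further vertices. -/
def Cand (k : ℕ) (d a : ℤ) (w : Pt) : Prop :=
  0 < orient (1, 0) (a, d) w ∧
  (w = (-1, 0) ∨ (w.2 ≠ 0 ∧ |w.2| ≤ bound k ∧ OkType k |w.2| (w.1 % |w.2|)) ∧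
    cross (a, d) w ≤ bound k ∧ (0 < cross (a, d) w → OkType k (cross (a, d) w) (res (a, d) w)))

/-- The closing conditions of a path ending with `p, q`. -/
def Closing (k : ℕ) (d a : ℤ) (p q : Pt) : Prop :=
  Adm k d a q (1, 0) ∧ 0 < orient p q (1, 0)

/-- The conditions for the extension of a path ending with `p, q`. -/
def Ext (k : ℕ) (d a : ℤ) (p q w : Pt) : Prop :=
  Adm k d a q w ∧ 0 < orient (1, 0) q w ∧ 0 < orient p q w

/-- `s` completes a path ending with `p, q` to a cyclic list. -/
def Good (k : ℕ) (d a : ℤ) (p q : Pt) : List Pt → Prop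
  | [] => Closing k d a p q
  | w :: s => Cand k d a w ∧ Ext k d a p q w ∧ Good k d a q w s

/-- Reflection in the horizontal axis turns the edge from `w` to `(1, 0)` into one from `(1, 0)` to
`(w.1, -w.2)`, whose residue is simply `w.1` modulo its height. -/
theorem okType_reflect {k : ℕ} {w : Pt} (hw : IsCoprime w.1 w.2) (h : 0 < cross w (1, 0))
    (hh : Hollow k w (1, 0)) : OkType k (-w.2) (w.1 % (-w.2)) := by
  have hc : cross w (1, 0) = -w.2 := by simp [cross]
  have hp : 0 < cross (1, 0) ((w.1, -w.2) : Pt) := by simp [cross]; omega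
  have := okType_of_hollow (k := k) (u := (1, 0)) (v := (w.1, -w.2)) isCoprime_one_left (by simpa using hw.neg_right) hp ?_
  · rw [res_eq (s := 1) (t := 0) (by simp)] at this
    simpa [cross] using this
  · intro z h1 h2 h3
    have := hh (z.1, -z.2) (by simp [cross] at *; linarith) (by simp [cross] at *; linarith)
      (by simp [cross] at *; linarith)
    have e1 := congrArg Prod.fst this
    have e2 := congrArg Prod.snd this
    simp at e1 e2
    exact Prod.ext e1 e2

/-- Hollowness and the determinant bound hold for any two vertices, not only for neighbours. Applied
to pairs with `(1, 0)` and `(a, d)` they confine all further vertices to a finite list. The only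
further primitive vector on the axis is `(-1, 0)`. -/
theorem IsCycle.cand {k : ℕ} (hk : 0 < k) {d a : ℤ} {l : List Pt}
    (hL : IsCycle k ((1, 0) :: (a, d) :: l)) {w : Pt} (hw : w ∈ l) : Cand k d a w := by
  have hw' : w ∈ ((1, 0) :: (a, d) :: l : List Pt) := by simp [hw]
  have hnd := hL.nodup
  have hne : w ≠ (1, 0) := by rintro rfl; simp at hnd; tauto
  have hne2 : w ≠ (a, d) := by rintro rfl; simp at hnd; tauto
  refine ⟨orient_edge_pos hL.triple ⟨l, List.IsRotated.refl _⟩ hw' hne hne2, ?_⟩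
  have h2 : cross (a, d) w ≤ bound k ∧
      (0 < cross (a, d) w → OkType k (cross (a, d) w) (res (a, d) w)) :=
    ⟨cross_le hk hL (by simp) hw', hL.pair_okType hk (by simp) hw'⟩
  · rcases lt_trichotomy w.2 0 with h | h | h
    · right
      have hc : cross w (1, 0) = -w.2 := by simp [cross]
      have := hL.pair_hollow hk hw' (q := (1, 0)) (by simp) (by omega)
      have hle := cross_le hk hL hw' (w := (1, 0)) (by simp)
      rw [abs_of_neg h]
      exact ⟨⟨h.ne, by rw [bound]; omega, okType_reflect (hL.prim w hw') (by omega) this⟩, h2⟩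
    · left
      have := hL.prim w hw'
      rw [h, isCoprime_zero_right, Int.isUnit_iff] at this
      rcases this with h1 | h1
      · exact absurd (Prod.ext h1 h) hne
      · exact Prod.ext h1 h
    · right
      have hc : cross (1, 0) w = w.2 := by simp [cross]
      have := hL.pair_okType hk (p := (1, 0)) (by simp) hw' (by omega)
      have hle := cross_le hk hL (v := (1, 0)) (by simp) hw'
      rw [abs_of_pos h]
      rw [res_eq (s := 1) (t := 0) (by simp), hc] at this
      exact ⟨⟨h.ne', by rw [bound]; omega, by simpa using this⟩, h2⟩

theorem good_of_isCycle {k : ℕ} (hk : 0 < k) {d a : ℤ} {l : List Pt}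
    (hL : IsCycle k ((1, 0) :: (a, d) :: l))
    (hA : ∀ p q, Edge ((1, 0) :: (a, d) :: l) p q → Adm k d a p q) :
    Good k d a (1, 0) (a, d) l := by
  have hnd := hL.nodup
  have key : ∀ (s P : List Pt) (p q : Pt), (1, 0) :: (a, d) :: l = P ++ p :: q :: s →
      Good k d a p q s := by
    intro s
    induction s with
    | nil =>
      intro P p q e
      cases P with
      | nil => 
        have := hL.three
        rw [e] at this; simp at this
      | cons x P =>
        simp only [List.cons_append, List.cons.injEq] at e
        obtain ⟨rfl, e⟩ := e
        have hr : ((1, 0) :: (a, d) :: l : List Pt) ~r p :: q :: (1, 0) :: P := by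
          rw [e]; simpa using List.isRotated_append (l := (1, 0) :: P) (l' := [p, q])
        have hr2 : ((1, 0) :: (a, d) :: l : List Pt) ~r q :: (1, 0) :: (P ++ [p]) := by
          rw [e]; simpa using List.isRotated_append (l := (1, 0) :: (P ++ [p])) (l' := [q])
        have hn2 := hr.nodup_iff.1 hnd
        simp only [List.nodup_cons, List.mem_cons, not_or] at hn2
        exact ⟨hA _ _ ⟨_, hr2⟩, orient_edge_pos hL.triple ⟨_, hr⟩ (by simp) (fun h => hn2.1.2.1 h.symm)
          (fun h => hn2.2.1.1 h.symm)⟩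
    | cons w s ih =>
      intro P p q e
      have hr : ((1, 0) :: (a, d) :: l : List Pt) ~r q :: w :: (s ++ (P ++ [p])) := by
        rw [e]; simpa using List.isRotated_append (l := P ++ [p]) (l' := q :: w :: s)
      have htr := hL.triple
      rw [e, List.triplewise_append] at htr
      have h1 : 0 < orient p q w := by
        have := htr.2.1
        rw [List.triplewise_cons, List.pairwise_cons] at this
        exact this.1.1 w (by simp)
      refine ⟨?_, ⟨hA _ _ ⟨_, hr⟩, ?_, h1⟩, ih (P ++ [p]) q w (by simp [e])⟩
      · apply hL.cand hk
        match P, e with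
        | [], e => simp at e; simp [e.2.2]
        | [x], e => simp at e; simp [e.2.2]
        | x :: y :: P, e => simp at e; simp [e.2.2]
      · cases P with
        | nil => simp at e; rw [e.1]; exact h1
        | cons x P =>
          simp at e
          rw [e.1]
          have := htr.2.2.1 x (by simp)
          rw [List.pairwise_cons, List.pairwise_cons] at this
          exact this.2.1 w (by simp)
  exact key l [] _ _ rfl

theorem Good.chain {k : ℕ} {d a : ℤ} : ∀ {s : List Pt} {p q : Pt}, Good k d a p q s →
    List.IsChain (Adm k d a) (q :: s ++ [(1, 0)])
  | [], p, q, h => by simpa using h.1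
  | w :: s, p, q, h => by
    have := h.2.2.chain
    simp only [List.cons_append, List.isChain_cons_cons] at this ⊢
    exact ⟨h.2.1.1, this⟩

theorem Good.triple {k : ℕ} {d a : ℤ} : ∀ {s P P₁ P₂ : List Pt} {p q : Pt}, Good k d a p q s →
    P = (1, 0) :: (a, d) :: P₁ → P = P₂ ++ [p, q] →
    (P.Triplewise fun a b c => 0 < orient a b c) →
    (P ++ s).Triplewise fun a b c => 0 < orient a b c
  | [], P, P₁, P₂, p, q, _, _, _, h => by simpa using h
  | w :: s, P, P₁, P₂, p, q, hg, h1, h2, h => by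
    have := Good.triple (P := P ++ [w]) (P₁ := P₁ ++ [w]) (P₂ := P₂ ++ [p]) hg.2.2 (by simp [h1]) (by simp [h2])
      (triple_concat h1 h2 h hg.1.1 hg.2.1.2.1 hg.2.1.2.2)
    simpa using this

/-- Primitivity need not be tested: it passes from each vertex to the next, because an edge type
contains a coprimality condition. -/
theorem isCycle_of_good {k : ℕ} {d a : ℤ} {l : List Pt} (h0 : Adm k d a (1, 0) (a, d))
    (hg : Good k d a (1, 0) (a, d) l) : IsCycle k ((1, 0) :: (a, d) :: l) ∧
      ∀ p q, Edge ((1, 0) :: (a, d) :: l) p q → Adm k d a p q := by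
  have hch : List.IsChain (Adm k d a) ((1, 0) :: ((a, d) :: l) ++ [(1, 0)]) := by
    have := hg.chain
    simp only [List.cons_append, List.isChain_cons_cons] at this ⊢
    exact ⟨h0, this⟩
  have hA := (edge_cons_iff (by simp)).2 hch
  have hprim : ∀ p ∈ ((1, 0) :: (a, d) :: l : List Pt), IsCoprime p.1 p.2 := by
    have key : ∀ (s : List Pt) (p : Pt), IsCoprime p.1 p.2 → List.IsChain (Adm k d a) (p :: s) →
        ∀ x ∈ p :: s, IsCoprime x.1 x.2 := by
      intro s
      induction s with
      | nil => intro p hp _ x hx; simp at hx; rwa [hx]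
      | cons w s ih =>
        intro p hp hc x hx
        rw [List.isChain_cons_cons] at hc
        rcases List.mem_cons.1 hx with rfl | hx
        · exact hp
        · exact ih w (hollow_of_okType hp hc.1.1).2.2 hc.2 x hx
    intro p hp
    exact key _ (1, 0) isCoprime_one_left hch p (by simp at hp ⊢; tauto)
  refine ⟨⟨?_, ?_, ?_, ?_, hprim⟩, hA⟩
  · cases l with
    | nil => have := hg.2; rw [orient_self_mid] at this; omega
    | cons _ _ => simp
  · exact hg.triple (P := [(1, 0), (a, d)]) (P₁ := []) (P₂ := []) rfl rfl (by simp)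
  · intro p q e
    exact (hollow_of_okType (hprim p e.left_mem) (hA p q e).1).1
  · intro p q e
    exact (hollow_of_okType (hprim p e.left_mem) (hA p q e).1).2.1

/-! ### The comparison of keys -/

/-- The third component of the key of a list that starts with `u`. -/
def key₁ (u : Pt) (F : List Pt) : ℤ := cross u (packP F)

/-- The fourth component of the key of a list with second element `v`. -/
def key₂ (v : Pt) (F : List Pt) : ℤ := cross (packP F) v

/-- The comparison of the last two components of the keys. -/
def SubLE (u v : Pt) (F : List Pt) (u' v' : Pt) (L : List Pt) : Prop :=
  key₁ u F < key₁ u' L ∨ key₁ u F = key₁ u' L ∧ key₂ v F ≤ key₂ v' L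

theorem key_le_iff {u v u' v' : Pt} {l l' : List Pt} :
    key (u :: v :: l) ≤ key (u' :: v' :: l') ↔ cross u v < cross u' v' ∨ cross u v = cross u' v' ∧
      (res u v < res u' v' ∨ res u v = res u' v' ∧
        SubLE u v (u :: v :: l) u' v' (u' :: v' :: l')) := by
  simp only [key, Prod.Lex.toLex_le_toLex, SubLE, key₁, key₂]

/-- The comparison with the flag of the `j`-th edge, in both directions. -/
def TieOK (d a : ℤ) (L : List Pt) (j : ℕ) (u v : Pt) : Prop :=
  (cross u v = d → res u v = a → SubLE u v (L.rotate (j - 1)) (1, 0) (a, d) L) ∧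
  (cross u v = d → res v.swap u.swap = a →
    SubLE v.swap u.swap ((mirror L).rotate (if j = L.length then L.length - 1 else L.length - 1 - j)) (1, 0) (a, d) L)

/-- The comparison with the flags of all edges. -/
def TiesOK (d a : ℤ) (L : List Pt) : Prop :=
  ∀ j (h0 : 0 < j) (hj : j ≤ L.length), TieOK d a L j (L[j - 1]) (L[j % L.length]'(Nat.mod_lt _ (by omega)))

theorem rotate_eq_cons {α : Type*} (L : List α) (i : ℕ) (h2 : 2 ≤ L.length) (hi : i < L.length) :
    ∃ l, L.rotate i = L[i] :: L[(i + 1) % L.length]'(Nat.mod_lt _ (by omega)) :: l := by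
  have hlen := L.length_rotate i
  match h : L.rotate i with
  | [] => rw [h] at hlen; simp at hlen; omega
  | [_] => rw [h] at hlen; simp at hlen; omega
  | x :: y :: l =>
    refine ⟨l, ?_⟩
    have h0 := List.getElem_rotate L i 0 (by omega)
    have h1 := List.getElem_rotate L i 1 (by omega)
    simp only [h] at h0 h1
    simp at h0 h1
    rw [h0, h1]
    congr 2
    · simp [Nat.mod_eq_of_lt hi]
    · simp [add_comm 1 i]

theorem getElem_mirror (L : List Pt) (i : ℕ) (h : i < (mirror L).length) :
    (mirror L)[i] = (L[L.length - 1 - i]'(by rw [length_mirror] at h; omega)).swap := by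
  simp [mirror]

/-- Every flag starts with an edge, traversed forwards or, in the mirror image, backwards. The first
two components of its key depend only on this edge, so maximality amounts to `Adm` for every edge
together with the comparison of the rest in case of ties. -/
theorem canon_iff {k : ℕ} {d a : ℤ} {l : List Pt} (h0 : 0 ≤ a) (had : a < d) :
    Canon k ((1, 0) :: (a, d) :: l) ↔ IsCycle k ((1, 0) :: (a, d) :: l) ∧
      (∀ p q, Edge ((1, 0) :: (a, d) :: l) p q → Adm k d a p q) ∧
      TiesOK d a ((1, 0) :: (a, d) :: l) := by
  have hd : cross (1, 0) (a, d) = d := by simp [cross]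
  have hr : res (1, 0) (a, d) = a := res_one_zero h0 had
  set L : List Pt := (1, 0) :: (a, d) :: l with hL
  have hL2 : 2 ≤ L.length := by simp [hL]
  have hkl : ∀ u v m, key (u :: v :: m) ≤ key L ↔ cross u v < d ∨ cross u v = d ∧
      (res u v < a ∨ res u v = a ∧ SubLE u v (u :: v :: m) (1, 0) (a, d) L) := by
    intro u v m; rw [hL, key_le_iff, hd, hr]
  constructor
  · intro hc
    refine ⟨hc.isCycle, ?_, ?_⟩
    · intro p q e
      obtain ⟨m, hm⟩ := e
      have h1 := hc.max _ (Or.inl hm.symm)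
      have e' : Edge (mirror L) q.swap p.swap := by
        apply Edge.mirror
        simpa [mirror_mirror] using ⟨m, hm⟩
      obtain ⟨m', hm'⟩ := e'
      have h2 := hc.max _ (Or.inr hm'.symm)
      rw [hkl] at h1 h2
      rw [cross_swap] at h2
      refine ⟨okType_of_hollow (hc.isCycle.prim p (hm.mem_iff.2 (by simp))) (hc.isCycle.prim q (hm.mem_iff.2 (by simp)))
        (hc.isCycle.pos p q ⟨m, hm⟩) (hc.isCycle.hollow p q ⟨m, hm⟩), ?_⟩
      rcases h1 with h1 | ⟨h1, h1'⟩
      · exact Or.inl h1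
      · rcases h2 with h2 | ⟨h2, h2'⟩
        · exact Or.inl h2
        · refine Or.inr ⟨h1, ?_, ?_⟩
          · rcases h1' with h | h
            · exact h.le
            · exact h.1.le
          · rcases h2' with h | h
            · exact h.le
            · exact h.1.le
    · intro j hj0 hj
      constructor
      · intro e1 e2
        obtain ⟨m, hm⟩ := rotate_eq_cons L (j - 1) hL2 (by omega)
        have h1 := hc.max (L.rotate (j - 1)) (Or.inl (List.IsRotated.symm ⟨_, rfl⟩))
        simp only [Nat.sub_add_cancel hj0] at hm
        rw [hm, hkl] at h1
        rw [hm]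
        rcases h1 with h1 | ⟨-, h1⟩
        · omega
        rcases h1 with h1 | ⟨-, h1⟩
        · omega
        exact h1
      · intro e1 e2
        have hml := length_mirror L
        -- The mirror list carries the swapped entry of index `n - 1 - i` at position `i`. The
        -- reversed `j`-th edge starts at index `j` modulo `n`, whence the special case `j = n`.
        set i := if j = L.length then L.length - 1 else L.length - 1 - j with hi
        have hil : i < (mirror L).length := by rw [hml]; split_ifs at hi <;> omega
        obtain ⟨m, hm⟩ := rotate_eq_cons (mirror L) i (by omega) hil
        have h1 := hc.max ((mirror L).rotate i) (Or.inr (List.IsRotated.symm ⟨_, rfl⟩))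
        rw [getElem_mirror, getElem_mirror] at hm
        have i1 : L.length - 1 - i = j % L.length := by
          rw [hi]; split_ifs with h
          · rw [h, Nat.mod_self]; omega
          · rw [Nat.mod_eq_of_lt (by omega)]; omega
        have i2 : L.length - 1 - (i + 1) % (mirror L).length = j - 1 := by
          rw [hi, hml]; split_ifs with h
          · rw [Nat.sub_add_cancel (by omega), Nat.mod_self]; omega
          · rw [Nat.mod_eq_of_lt (by omega)]; omega
        simp only [i1, i2] at hm
        rw [hm, hkl, cross_swap] at h1
        rw [hm]
        rcases h1 with h1 | ⟨-, h1⟩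
        · omega
        rcases h1 with h1 | ⟨-, h1⟩
        · omega
        exact h1
  · rintro ⟨hc, hA, ht⟩
    refine ⟨hc, ⟨a, d, l, rfl, h0, had⟩, ?_⟩
    have edge : ∀ i (hi : i < L.length), Edge L L[i] (L[(i + 1) % L.length]'(Nat.mod_lt _ (by omega))) := by
      intro i hi
      obtain ⟨m, hm⟩ := rotate_eq_cons L i hL2 hi
      exact ⟨m, hm ▸ ⟨i, rfl⟩⟩
    rintro F (h | h)
    · obtain ⟨i, hi, rfl⟩ := List.isRotated_iff_mod.1 h.symm
      have hi' : i % L.length < L.length := Nat.mod_lt _ (by omega)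
      rw [← List.rotate_mod]
      set i' := i % L.length
      obtain ⟨m, hm⟩ := rotate_eq_cons L i' hL2 hi'
      have h1 := (ht (i' + 1) (by omega) (by omega)).1
      have h2 := (hA _ _ (edge i' hi')).2
      simp only [Nat.add_sub_cancel] at h1
      rw [hm] at h1 ⊢
      rw [hkl]
      rcases h2 with h2 | ⟨h2, h3, -⟩
      · exact Or.inl h2
      · refine Or.inr ⟨h2, ?_⟩
        rcases h3.lt_or_eq with h3 | h3
        · exact Or.inl h3
        · exact Or.inr ⟨h3, h1 h2 h3⟩
    · obtain ⟨i, hi, rfl⟩ := List.isRotated_iff_mod.1 h.symm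
      have hml := length_mirror L
      have hi' : i % L.length < L.length := Nat.mod_lt _ (by omega)
      rw [← List.rotate_mod, hml]
      set i' := i % L.length
      obtain ⟨m, hm⟩ := rotate_eq_cons (mirror L) i' (by omega) (by omega)
      rw [getElem_mirror, getElem_mirror] at hm
      set j := L.length - 1 - (i' + 1) % L.length + 1 with hj
      have hmod : (i' + 1) % L.length < L.length := Nat.mod_lt _ (by omega)
      have i1 : j % L.length = L.length - 1 - i' := by
        rw [hj]
        by_cases h : i' + 1 = L.length
        · rw [h, Nat.mod_self, show L.length - 1 - 0 + 1 = L.length by omega, Nat.mod_self]; omega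
        · rw [Nat.mod_eq_of_lt (show i' + 1 < L.length by omega), Nat.mod_eq_of_lt (by omega)]; omega
      have i2 : (if j = L.length then L.length - 1 else L.length - 1 - j) = i' := by
        rw [hj]
        by_cases h : i' + 1 = L.length
        · rw [h, Nat.mod_self, if_pos (by omega)]; omega
        · rw [Nat.mod_eq_of_lt (show i' + 1 < L.length by omega), if_neg (by omega)]; omega
      have i3 : L.length - 1 - (i' + 1) % (mirror L).length = j - 1 := by rw [hml]; omega
      simp only [i3] at hm
      have h1 := (ht j (by omega) (by omega)).2
      have h2 := (hA _ _ (edge (j - 1) (by omega))).2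
      simp only [Nat.sub_add_cancel (show 1 ≤ j by omega)] at h2
      simp only [i1] at h1 h2
      rw [i2, hm] at h1
      rw [hm, hkl, cross_swap]
      rcases h2 with h2 | ⟨h2, -, h3⟩
      · exact Or.inl h2
      · refine Or.inr ⟨h2, ?_⟩
        rcases h3.lt_or_eq with h3 | h3
        · exact Or.inl h3
        · exact Or.inr ⟨h3, h1 h2 h3⟩

theorem canon_iff_good {k : ℕ} (hk : 0 < k) {d a : ℤ} {l : List Pt} (h0 : 0 ≤ a) (had : a < d) :
    Canon k ((1, 0) :: (a, d) :: l) ↔ Adm k d a (1, 0) (a, d) ∧ Good k d a (1, 0) (a, d) l ∧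
      TiesOK d a ((1, 0) :: (a, d) :: l) := by
  rw [canon_iff h0 had]
  constructor
  · rintro ⟨h1, h2, h3⟩
    exact ⟨h2 _ _ ⟨l, List.IsRotated.refl _⟩, good_of_isCycle hk h1 h2, h3⟩
  · rintro ⟨h1, h2, h3⟩
    have := isCycle_of_good h1 h2
    exact ⟨this.1, this.2, h3⟩

end LDP

namespace LDP

/-! ### The search program

The search is carried out by kernel reduction, on natural numbers: a coordinate `x` is stored as
`x + 2 ^ 20`, and `force` evaluates a number before it is used. -/

noncomputable section
namespace Prog

/-- A candidate vertex `(X, Y)`, with the determinant and the tie code of the edge leading to it. -/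
inductive Ed
  | mk (X Y e t : ℕ)

/-- The `j`-th edge, whose type agrees with the type of the first edge. -/
inductive Tie
  | mk (j Xu Yu Xv Yv t : ℕ)

/-- Application to an evaluated number. -/
def force {α : Type} (n : ℕ) (f : ℕ → α) : α :=
  Nat.rec (f 0) (fun m _ => f (Nat.succ m)) n

/-- Case distinction on a truth value. -/
def ifb {α : Type} (b : Bool) (t e : α) : α := Bool.rec e t b

/-- Case distinction on a number being zero. -/
def ifz {α : Type} (n : ℕ) (z s : α) : α := Nat.rec z (fun _ _ => s) n

/-- Case distinction on a bit of a number. -/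
def bit {α : Type} (m i : ℕ) (t e : α) : α :=
  Nat.rec e (fun _ _ => t) (Nat.land (Nat.shiftRight m i) 1)

/-- The offset `2 ^ 20`, lowered by one and raised by one, times a multiple of all products of
two positive numbers up to `72`. -/
def offLo : ℕ := 33166318424430163172016449548926886807873138207316980545292860391424

/-- See `offLo`. -/
def offHi : ℕ := 33166318424430163172016449548926886807873138207316980545292862488576

/-- The first number from `s` on that is inverse to `x` modulo `e`. -/
def invFrom (x e fuel : ℕ) : ℕ → ℕ :=
  Nat.rec (motive := fun _ => ℕ → ℕ) (fun s => s)
    (fun _ ih s => ifb (Nat.beq (Nat.mod (Nat.mul s x) e) (Nat.mod 1 e)) s (ih (Nat.succ s))) fuel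

/-- The inverse of `x` modulo `e`. -/
def inv (x e : ℕ) : ℕ := invFrom x e e 0

/-- The residue of an edge starting above the `x`-axis. -/
def resPos (s y _X Y e : ℕ) : ℕ :=
  Nat.mod (Nat.div (Nat.sub (Nat.add offLo Y) (Nat.mul s e)) y) e

/-- The residue of an edge starting below the `x`-axis. -/
def resNeg (s y _X Y e : ℕ) : ℕ :=
  Nat.mod (Nat.div (Nat.sub (Nat.add offHi (Nat.mul s e)) Y) y) e

/-- The residue of an edge starting at `(-1, 0)`. -/
def resZero (X _Y e : ℕ) : ℕ := Nat.mod (Nat.sub offHi X) e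

/-- The test for the type `(d, a)`. -/
def okLoop (k d a : ℕ) (fuel : ℕ) : ℕ → Bool :=
  Nat.rec (motive := fun _ => ℕ → Bool) (fun _ => true)
    (fun _ ih y => force y fun y => ifb (Nat.ble d (Nat.mul k y)) true
      (ifb (Nat.ble d (Nat.mul k (Nat.add y (Nat.mod (Nat.mul y (Nat.sub d a)) d))))
        (ih (Nat.succ y)) false)) fuel

/-- The types `(d, a)` with `a < n`, added to a bit mask. -/
def maskRow (k d n : ℕ) : ℕ → ℕ :=
  Nat.rec (motive := fun _ => ℕ → ℕ) (fun m => m)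
    (fun a ih m => force a fun a => ifb (Nat.beq (Nat.gcd a d) 1)
      (ifb (okLoop k d a d 1)
        (force (Nat.lor m (Nat.shiftLeft 1 (Nat.add (Nat.mul 80 d) a))) fun m => ih m) (ih m))
      (ih m)) n

/-- The bit mask of all types `(d, a)` with `d ≤ M`. -/
def mask (k M : ℕ) : ℕ :=
  Nat.rec (motive := fun _ => ℕ → ℕ) (fun m => m)
    (fun d ih m => force (Nat.succ d) fun d => force (maskRow k d d m) fun m => ih m) M 0

/-- The types of edges that do not exceed the type `(d, a)`. -/
def startMask (mask d a : ℕ) : ℕ :=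
  Nat.rec (motive := fun _ => ℕ → ℕ) (fun m => m)
    (fun al ih m => force al fun al => bit mask (Nat.add (Nat.mul 80 d) al)
      (ifb (Nat.ble (inv al d) a)
        (force (Nat.lor m (Nat.shiftLeft 1 (Nat.add (Nat.mul 80 d) al))) fun m => ih m) (ih m))
      (ih m)) (Nat.succ a)
    (Nat.mod mask (Nat.shiftLeft 1 (Nat.mul 80 d)))

/-- Candidates with ordinate `Y`. -/
def row (mask e c Y N s d A cnt : ℕ) : ℕ → List Ed → List Ed :=
  Nat.rec (motive := fun _ => ℕ → List Ed → List Ed) (fun _ acc => acc)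
    (fun _ ih X acc => force X fun X =>
      bit mask (Nat.add (Nat.mul 80 e) (Nat.mod (Nat.add X c) e))
        (force (Nat.mod (Nat.add (Nat.mul A Y) (Nat.mul N X)) 1048576) fun e' =>
          ifb (Nat.ble 524288 e') (ih (Nat.succ X) (List.cons (Ed.mk X Y 0 0) acc))
           (ifz e' (ih (Nat.succ X) (List.cons (Ed.mk X Y 0 0) acc))
             (bit mask (Nat.add (Nat.mul 80 e') (resPos s d X Y e'))
               (ih (Nat.succ X) (List.cons (Ed.mk X Y 0 0) acc)) (ih (Nat.succ X) acc))))
       (ih (Nat.succ X) acc)) cnt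

/-- All candidates for vertices of polygons with first edge of type `(d, a)`. -/
def rows (mask M d a : ℕ) : List Ed :=
  force (inv a d) fun s => force (Nat.sub 1048576 d) fun N => force (Nat.add 1048576 a) fun A =>
  force (Nat.add (Nat.mul 1048576 d) (Nat.pred d)) fun D =>
  Nat.rec (motive := fun _ => List Ed → List Ed) (fun acc => acc)
   (fun e' ih acc => force (Nat.succ e') fun e => force (Nat.mul 1048576 e') fun c =>
     force (Nat.div (Nat.sub (Nat.add D (Nat.mul a e)) M) d) fun xl =>
     force (Nat.div (Nat.sub (Nat.add D (Nat.add (Nat.mul a e) d)) e) d) fun xh =>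
     force (Nat.div (Nat.sub D (Nat.add (Nat.mul a e) M)) d) fun xl' =>
     force (Nat.div (Nat.sub (Nat.add D (Nat.add e d)) (Nat.mul a e)) d) fun xh' =>
     force (Nat.add 1048576 e) fun Y => force (Nat.sub 1048576 e) fun Y' =>
     ih (row mask e c Y' N s d A (Nat.sub xh' xl') xl'
       (row mask e c Y N s d A (Nat.sub xh xl) xl acc)))
   M (List.cons (Ed.mk 1048575 1048576 0 0) List.nil)

/-- The tie code of an edge of type `(e, al)`. -/
def tie (d a al e : ℕ) : ℕ :=
  ifb (Nat.beq e d) (Nat.add (ifb (Nat.beq al a) 1 0)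
    (ifb (Nat.beq (Nat.mod (Nat.mul al a) d) (Nat.mod 1 d)) 2 0)) 0

/-- The candidates that can follow `(X, Y)`. -/
def nbrLoop (mask d a X N Y : ℕ) (al : ℕ → ℕ → ℕ → ℕ) (W : List Ed) : List Ed → List Ed :=
  List.rec (motive := fun _ => List Ed → List Ed) (fun acc => acc)
   (fun w _ ih acc => Ed.rec (fun X' Y' _ _ =>
     force (Nat.mod (Nat.add (Nat.mul X Y') (Nat.mul N X')) 1048576) fun e =>
       -- A negative determinant shows up as a large residue modulo `2 ^ 20`, so this test rejects
       -- it as well.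
       ifb (Nat.ble e d) (ifz e (ih acc) (ifb (Nat.ble (Nat.add e Y) Y') (ih acc)
        (force (al X' Y' e) fun al => bit mask (Nat.add (Nat.mul 80 e) al)
          (force (tie d a al e) fun t => ih (List.cons (Ed.mk X' Y' e t) acc)) (ih acc))))
        (ih acc)) w) W

/-- The closing edge from `(X, Y)`, followed by the candidates that can follow `(X, Y)`. -/
def nbr (mask d a : ℕ) (W : List Ed) (X Y : ℕ) : List Ed :=
  force (Nat.sub 2097152 Y) fun N =>
  ifb (Nat.ble Y 1048576)
   (ifz (Nat.sub 1048576 Y)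
     (List.cons (Ed.mk 1048577 1048576 0 0) (nbrLoop mask d a X N Y resZero W List.nil))
     (force (Nat.sub 1048576 Y) fun y =>
        force (inv (Nat.add X (Nat.mul 1048576 (Nat.pred y))) y) fun s =>
        force (resNeg s y 1048577 1048576 y) fun al =>
        force (bit mask (Nat.add (Nat.mul 80 y) al) y 0) fun ec => force (tie d a al y) fun tc =>
        List.cons (Ed.mk 1048577 1048576 ec tc)
          (nbrLoop mask d a X N Y (resNeg s y) W List.nil)))
   (force (Nat.sub Y 1048576) fun y =>
        force (inv (Nat.add X (Nat.mul 1048576 (Nat.pred y))) y) fun s =>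
        List.cons (Ed.mk 1048577 1048576 0 0) (nbrLoop mask d a X N Y (resPos s y) W List.nil))

/-- The determinant of `(A, B)` and the packed vector `(P, Q)`, with the offset `2 ^ 41 * R`. -/
def lin (A B P Q R : ℕ) : ℕ :=
  Nat.sub (Nat.add (Nat.add (Nat.mul A Q) (Nat.mul (Nat.sub 2097152 B) P))
    (Nat.mul (Nat.mul 1048576 (Nat.sub (Nat.add 2097152 B) A)) R)) (Nat.mul 1048576 (Nat.add P Q))

/-- Rotation of the packed list `P` of length `n` by `m`. -/
def rot (P n m : ℕ) : ℕ :=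
  Nat.add (Nat.shiftLeft (Nat.mod P (Nat.shiftLeft 1 (Nat.mul 48 (Nat.sub n m)))) (Nat.mul 48 m))
    (Nat.shiftRight P (Nat.mul 48 (Nat.sub n m)))

/-- The comparison of the key of a flag with the key `(b₁, b₂)`. -/
def keyLE (Xu Yu Xv Yv P Q R b₁ b₂ : ℕ) : Bool :=
  ifb (Nat.ble (lin Xu Yu P Q R) b₁)
    (ifb (Nat.beq (lin Xu Yu P Q R) b₁) (Nat.ble (lin Yv Xv Q P R) b₂) true) false

/-- The comparison of the keys of all flags of the same type. -/
def check (n P Q P' Q' R b₁ b₂ : ℕ) (T : List Tie) : Bool :=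
  List.rec true (fun c _ ih => Tie.rec (fun j Xu Yu Xv Yv t =>
    ifb (ifz (Nat.land t 1) true
        (keyLE Xu Yu Xv Yv (rot P n (Nat.pred j)) (rot Q n (Nat.pred j)) R b₁ b₂))
      (ifb (ifz (Nat.div t 2) true
        (force (ifz (Nat.sub n j) (Nat.pred n) (Nat.pred (Nat.sub n j))) fun i =>
          keyLE Yv Xv Yu Xu (rot Q' n i) (rot P' n i) R b₁ b₂)) ih false) false) c) T

/-- The contribution of a polygon with `n` vertices. -/
def weight (B n area : ℕ) : ℕ :=
  force (Nat.land (Nat.shiftRight B (Nat.mul 8 n)) 255) fun bd =>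
  ifb (Nat.ble area bd)
    (Nat.add (Nat.add (Nat.shiftLeft 1 (Nat.mul 16 n))
      (ifb (Nat.beq area bd) (Nat.shiftLeft 1 (Nat.mul 16 (Nat.add 12 n))) 0))
      (Nat.add 1 (Nat.shiftLeft 1 400)))
    (Nat.shiftLeft 1 600)

/-- The contribution of a closed path. -/
def leaf (d a B n area : ℕ) (T : List Tie) (P Q P' Q' acc : ℕ) : ℕ :=
  ifb (List.rec true (fun _ _ _ =>
      force (Nat.div (Nat.pred (Nat.shiftLeft 1 (Nat.mul 48 n))) 281474976710655) fun R =>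
        check n P Q P' Q' R (lin 1048577 1048576 P Q R)
          (lin (Nat.add 1048576 d) (Nat.add 1048576 a) Q P R) T) T)
    (Nat.add acc (weight B n area)) acc

/-- The contribution of all extensions of a path that ends with `(Xp, Yp)`, `(Xq, Yq)`. -/
def dfs (mask d a B : ℕ) (W : List Ed) (fuel : ℕ) :
    (n Xp Yp e Xq Yq area : ℕ) → List Tie → (P Q P' Q' : ℕ) → ℕ → ℕ :=
  Nat.rec (motive := fun _ => (n Xp Yp e Xq Yq area : ℕ) → List Tie → (P Q P' Q' : ℕ) → ℕ → ℕ)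
   (fun _ _ _ _ _ _ _ _ _ _ _ _ acc => Nat.add acc (Nat.shiftLeft 1 600))
   (fun _ ih n Xp Yp e Xq Yq area T P Q P' Q' acc =>
     List.rec acc (fun ced nb _ => Ed.rec (fun _ _ ec tc =>
       force (Nat.sub (Nat.add Xq 1048576) Xp) fun C =>
       force (Nat.sub (Nat.add Yp 1048576) Yq) fun A =>
       force (Nat.succ n) fun n' => force (Nat.pred e) fun e₁ =>
       force (ifz ec acc (ifb (Nat.ble 524288 (Nat.mod (Nat.add (Nat.add (Nat.mul A 1048577)
            (Nat.mul C 1048576)) e₁) 1048576)) acc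
          (force (Nat.add area ec) fun area =>
            leaf d a B n area (ifz tc T (List.cons (Tie.mk n Xq Yq 1048577 1048576 tc) T))
              P Q P' Q' acc))) fun acc =>
       List.rec (motive := fun _ => ℕ → ℕ) (fun acc => acc)
        (fun ed _ ihl acc => Ed.rec (fun X Y e' t =>
          ifb (Nat.ble 524288 (Nat.mod (Nat.add (Nat.add (Nat.mul A X) (Nat.mul C Y)) e₁) 1048576))
            (ihl acc)
            (force (Nat.add area e') fun area =>
             force (ih n' Xq Yq e' X Y area (ifz t T (List.cons (Tie.mk n Xq Yq X Y t) T))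
               (Nat.add (Nat.shiftLeft P 48) X) (Nat.add (Nat.shiftLeft Q 48) Y)
               (Nat.add P' (Nat.shiftLeft X (Nat.mul 48 n)))
               (Nat.add Q' (Nat.shiftLeft Y (Nat.mul 48 n))) acc) fun acc => ihl acc)) ed)
        nb acc) ced) (nbr mask d a W Xq Yq)) fuel

/-- The contribution of all polygons with first edge of type `(d, a)`. -/
def start (MASK B M fuel d a acc : ℕ) : ℕ :=
  force (startMask MASK d a) fun mask =>
  force (Nat.add 1048576 a) fun X => force (Nat.add 1048576 d) fun Y =>
   dfs mask d a B (rows MASK M d a) fuel 2 1048577 1048576 d X Y d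
     -- The first edge need not be compared with itself. Its reversal has the same type exactly when
     -- `a * a ≡ 1` modulo `d`; the code 2 requests this comparison alone.
     (ifb (Nat.beq (Nat.mod (Nat.mul a a) d) (Nat.mod 1 d))
       (List.cons (Tie.mk 1 1048577 1048576 X Y 2) List.nil) List.nil)
     (Nat.add (Nat.shiftLeft 1048577 48) X) (Nat.add (Nat.shiftLeft 1048576 48) Y)
     (Nat.add 1048577 (Nat.shiftLeft X 48)) (Nat.add 1048576 (Nat.shiftLeft Y 48)) acc

/-- The contribution of all polygons with first edge of determinant `d` and residue below `n`. -/
def run (MASK B M fuel d n : ℕ) : ℕ → ℕ :=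
  Nat.rec (motive := fun _ => ℕ → ℕ) (fun acc => acc)
    (fun a ih acc => force a fun a => bit MASK (Nat.add (Nat.mul 80 d) a)
      (ifb (Nat.ble (inv a d) a) (force (start MASK B M fuel d a acc) fun acc => ih acc) (ih acc))
      (ih acc)) n

/-- The contribution of all polygons with first edge of determinant `d, …, d + cnt - 1`. -/
def runs (MASK B M fuel cnt : ℕ) : ℕ → ℕ → ℕ :=
  Nat.rec (motive := fun _ => ℕ → ℕ → ℕ) (fun _ acc => acc)
    (fun _ ih d acc => force d fun d => force (run MASK B M fuel d d acc) fun acc =>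
      ih (Nat.succ d) acc) cnt

end Prog
end
end LDP

namespace LDP
namespace Prog

/-! ### The specification of the search program -/

theorem force_eq {α : Type} (n : ℕ) (f : ℕ → α) : force n f = f n := by cases n <;> rfl

theorem ifb_eq {α : Type} (b : Bool) (t e : α) : ifb b t e = if b = true then t else e := by
  cases b <;> rfl

theorem ifz_eq {α : Type} (n : ℕ) (z s : α) : ifz n z s = if n = 0 then z else s := by
  cases n <;> rfl

theorem bit_eq {α : Type} (m i : ℕ) (t e : α) : bit m i t e = if m.testBit i then t else e := by
  have h : Nat.land (Nat.shiftRight m i) 1 = if m.testBit i then 1 else 0 := by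
    change (m >>> i) &&& 1 = _
    rw [Nat.and_one_is_mod, Nat.testBit_eq_decide_div_mod_eq, Nat.shiftRight_eq_div_pow]
    have := Nat.mod_two_eq_zero_or_one (m / 2 ^ i)
    rcases this with h | h <;> simp [h]
  unfold bit
  rw [h]
  split_ifs <;> rfl

/-- The evaluated forms of the control structures. -/
theorem ble_iff (a b : ℕ) : Nat.ble a b = true ↔ a ≤ b := by simp

theorem beq_iff (a b : ℕ) : Nat.beq a b = true ↔ a = b := by simp

/-! #### Inverses and residues -/

theorem invFrom_succ (x e n s : ℕ) :
    invFrom x e (n + 1) s = if s * x % e = 1 % e then s else invFrom x e n (s + 1) := by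
  change ifb (Nat.beq (s * x % e) (1 % e)) s (invFrom x e n (s + 1)) = _
  rw [ifb_eq]; simp only [beq_iff]

theorem invFrom_spec {x e : ℕ} : ∀ {n s t : ℕ}, s ≤ t → t < s + n → t * x % e = 1 % e →
    invFrom x e n s ≤ t ∧ invFrom x e n s * x % e = 1 % e
  | 0, s, t, h1, h2, _ => by omega
  | n + 1, s, t, h1, h2, h3 => by
    rw [invFrom_succ]
    split_ifs with h
    · exact ⟨h1, h⟩
    · have : s ≠ t := by rintro rfl; exact h h3
      exact invFrom_spec (by omega) (by omega) h3

theorem inv_spec {x e t : ℕ} (h1 : t < e) (h2 : t * x % e = 1 % e) :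
    inv x e < e ∧ inv x e * x % e = 1 % e := by
  have := invFrom_spec (x := x) (e := e) (n := e) (s := 0) (t := t) (by omega) (by omega) h2
  exact ⟨lt_of_le_of_lt this.1 h1, this.2⟩

theorem dvd_of_mod_eq {s x e : ℕ} (h : s * x % e = 1 % e) : (e : ℤ) ∣ s * x - 1 := by
  have := (Nat.modEq_iff_dvd.1 (show 1 ≡ s * x [MOD e] from h.symm))
  exact_mod_cast this

theorem mod_eq_of_dvd {s x e : ℕ} (h : (e : ℤ) ∣ s * x - 1) : s * x % e = 1 % e := by
  have : (e : ℤ) ∣ ((s * x : ℕ) : ℤ) - ((1 : ℕ) : ℤ) := by exact_mod_cast h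
  exact (Nat.modEq_iff_dvd.2 this).symm

theorem eq_of_dvd_of_dvd {e s t x : ℤ} (hs0 : 0 ≤ s) (hs : s < e) (ht0 : 0 ≤ t) (ht : t < e)
    (h1 : e ∣ s * x - 1) (h2 : e ∣ t * x - 1) : s = t := by
  have h3 : e ∣ s - t := by
    have : s - t = s * (1 - t * x) + t * (s * x - 1) := by ring
    rw [this]
    refine dvd_add (Dvd.dvd.mul_left ?_ _) (h1.mul_left _)
    rw [← neg_sub]; exact h2.neg_right
  have := Int.eq_zero_of_abs_lt_dvd h3 (by rw [abs_lt]; omega)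
  omega

/-- `inv` computes the residue of the reversed edge. -/
theorem inv_eq {al e : ℕ} {β : ℤ} (h0 : 0 ≤ β) (h1 : β < e) (h : (e : ℤ) ∣ β * al - 1) :
    (inv al e : ℤ) = β := by
  lift β to ℕ using h0
  have := inv_spec (x := al) (e := e) (t := β) (by exact_mod_cast h1) (mod_eq_of_dvd h)
  exact eq_of_dvd_of_dvd (by positivity) (by exact_mod_cast this.1) (by positivity) h1
    (dvd_of_mod_eq this.2) h

theorem inv_isCoprime {x : ℤ} {X e : ℕ} (he : 0 < e) (hX : (e : ℤ) ∣ X - x) (hc : IsCoprime x e) :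
    inv X e < e ∧ (e : ℤ) ∣ inv X e * x - 1 := by
  obtain ⟨s, t, hst⟩ := hc
  have he' : (0 : ℤ) < e := by exact_mod_cast he
  have hs0 := Int.emod_nonneg s he'.ne'
  have hs1 := Int.emod_lt_of_pos s he'
  obtain ⟨c, hc⟩ := hX
  have key : (e : ℤ) ∣ (s % e).toNat * X - 1 := by
    rw [Int.toNat_of_nonneg hs0, Int.emod_def]
    refine ⟨s * c - s / e * X - t, ?_⟩
    linear_combination s * hc + hst
  have := inv_spec (x := X) (e := e) (t := (s % e).toNat) (by omega) (mod_eq_of_dvd key)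
  refine ⟨this.1, ?_⟩
  have h2 := dvd_of_mod_eq this.2
  have : (inv X e : ℤ) * x - 1 = (inv X e * X - 1) - inv X e * (X - x) := by ring
  rw [this]
  exact dvd_sub h2 ⟨inv X e * c, by rw [hc]; ring⟩

/-- The coordinate `x` as a natural number. -/
def enc (x : ℤ) : ℕ := (x + 1048576).toNat

theorem enc_cast {x : ℤ} (h : -1048576 ≤ x) : (enc x : ℤ) = x + 1048576 := by
  unfold enc; omega

theorem enc_sub (X : ℕ) : enc ((X : ℤ) - 1048576) = X := by unfold enc; omega

/-- The multiple of all products used for the offsets. -/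
def period : ℕ := 31629866051130450412765931652953039939759386260334950013440000

theorem dvd_period : ∀ y < 73, ∀ c < 73, 1 ≤ y → 1 ≤ c → y * c ∣ period := by
  unfold period; decide +kernel

theorem offLo_eq : (offLo : ℤ) = 1048576 * period - 1048576 := by
  unfold offLo period; norm_num

theorem offHi_eq : (offHi : ℤ) = 1048576 * period + 1048576 := by
  unfold offHi period; norm_num

/-- The offset is a multiple of `y c`, so it affects neither the exact division by `y` nor the
remainder modulo `c`, but keeps the natural number positive. -/
theorem res_aux {y c m z : ℤ} {K : ℕ} (hy : 0 < y) (hy1 : y ≤ 72) (hc : 0 < c) (hc1 : c ≤ 72)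
    (hK : (K : ℤ) = 1048576 * period + z) (hz : z = y * m) : ((K : ℤ) / y) % c = m % c := by
  obtain ⟨q, hq⟩ := dvd_period y.toNat (by omega) c.toNat (by omega) (by omega) (by omega)
  have hq' : (period : ℤ) = y * c * q := by
    rw [hq]; push_cast; rw [Int.toNat_of_nonneg hy.le, Int.toNat_of_nonneg hc.le]
  have : (K : ℤ) = y * (m + c * (1048576 * q)) := by rw [hK, hz, hq']; ring
  rw [this, Int.mul_ediv_cancel_left _ hy.ne', Int.add_mul_emod_self_left]

/-- From `s p.1 - t p.2 = 1` the residue is `s w.1 - t w.2`, and this equals `(w.2 - s * cross p w)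
/ p.2`. Only `s` has to be known, not `t`. -/
theorem resPos_eq {p w : Pt} {s : ℕ} (hy : 0 < p.2) (hy1 : p.2 ≤ 72) (hs : s ≤ 72)
    (hs' : p.2 ∣ s * p.1 - 1) (hc : 0 < cross p w) (hc1 : cross p w ≤ 72) (hw : |w.2| ≤ 1000) (X : ℕ) :
    (resPos s p.2.toNat X (enc w.2) (cross p w).toNat : ℤ) = res p w := by
  rw [abs_le] at hw
  obtain ⟨t, ht⟩ := hs'
  rw [res_eq (s := s) (t := -t) (by linarith)]
  change (((offLo + enc w.2 - s * (cross p w).toNat) / p.2.toNat % (cross p w).toNat : ℕ) : ℤ) = _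
  have hsc : s * (cross p w).toNat ≤ 72 * 72 := Nat.mul_le_mul hs (by omega)
  have hoff : 72 * 72 ≤ offLo := by unfold offLo; norm_num
  rw [Int.natCast_mod, Int.natCast_div, Int.toNat_of_nonneg hc.le, Int.toNat_of_nonneg hy.le]
  refine res_aux (z := w.2 - s * cross p w) hy hy1 hc hc1 ?_ ?_
  · rw [Nat.cast_sub (by omega), Nat.cast_add, Nat.cast_mul, enc_cast (by omega), offLo_eq, Int.toNat_of_nonneg hc.le]
    ring
  · unfold cross; linear_combination (-w.2) * ht

theorem resNeg_eq {p w : Pt} {s : ℕ} (hy : p.2 < 0) (hy1 : -72 ≤ p.2)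
    (hs' : -p.2 ∣ s * p.1 - 1) (hc : 0 < cross p w) (hc1 : cross p w ≤ 72) (hw : |w.2| ≤ 1000) (X : ℕ) :
    (resNeg s (-p.2).toNat X (enc w.2) (cross p w).toNat : ℤ) = res p w := by
  rw [abs_le] at hw
  obtain ⟨t, ht⟩ := hs'
  rw [res_eq (s := s) (t := t) (by linarith)]
  change (((offHi + s * (cross p w).toNat - enc w.2) / (-p.2).toNat % (cross p w).toNat : ℕ) : ℤ) = _
  have hoff : 72 * 72 + 1048576 ≤ offHi := by unfold offHi; norm_num
  have he := enc_cast (x := w.2) (by omega)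
  rw [Int.natCast_mod, Int.natCast_div, Int.toNat_of_nonneg hc.le, Int.toNat_of_nonneg (show 0 ≤ -p.2 by omega)]
  refine res_aux (z := s * cross p w - w.2) (by omega) (by omega) hc hc1 ?_ ?_
  · rw [Nat.cast_sub (by omega), Nat.cast_add, Nat.cast_mul, he, offHi_eq, Int.toNat_of_nonneg hc.le]
    ring
  · unfold cross; linear_combination w.2 * ht

theorem resZero_eq {w : Pt} (hc : 0 < cross (-1, 0) w) (hc1 : cross (-1, 0) w ≤ 72) (hw : |w.1| ≤ 1000)
    (Y : ℕ) : (resZero (enc w.1) Y (cross (-1, 0) w).toNat : ℤ) = res (-1, 0) w := by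
  rw [abs_le] at hw
  rw [res_eq (s := -1) (t := 0) (by simp)]
  change (((offHi - enc w.1) % (cross (-1, 0) w).toNat : ℕ) : ℤ) = _
  have hoff : 72 * 72 + 1048576 ≤ offHi := by unfold offHi; norm_num
  have he := enc_cast (x := w.1) (by omega)
  rw [Int.natCast_mod, Int.toNat_of_nonneg hc.le]
  have := res_aux (K := offHi - enc w.1) (y := 1) (c := cross (-1, 0) w) (m := -w.1) (z := -w.1) (by omega) (by omega) hc hc1
    (by rw [Nat.cast_sub (by omega), he, offHi_eq]; ring) (by ring)
  rw [Int.ediv_one] at this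
  rw [this]; congr 1; ring

/-! #### Masks -/

theorem okLoop_succ (k d a n y : ℕ) : okLoop k d a (n + 1) y =
    if d ≤ k * y then true else if d ≤ k * (y + y * (d - a) % d) then okLoop k d a n (y + 1) else false := by
  change force y (fun y => ifb (Nat.ble d (k * y)) true (ifb (Nat.ble d (k * (y + y * (d - a) % d)))
    (okLoop k d a n (y + 1)) false)) = _
  simp only [force_eq, ifb_eq, ble_iff]

/-- The loop may stop at the first `y` with `d ≤ k y`, since no larger `j` is subject to a
condition. -/
theorem okLoop_iff {k d a : ℕ} : ∀ {n y : ℕ}, d ≤ k * (y + n) → (okLoop k d a n y = true ↔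
    ∀ j, y ≤ j → k * j < d → d ≤ k * (j + j * (d - a) % d))
  | 0, y, h => by
    refine ⟨fun _ j hj hd => ?_, fun _ => rfl⟩
    have := Nat.mul_le_mul_left k hj
    rw [add_zero] at h; omega
  | n + 1, y, h => by
    rw [okLoop_succ]
    split_ifs with h1 h2
    · refine ⟨fun _ j hj hd => ?_, fun _ => rfl⟩
      have := Nat.mul_le_mul_left k hj
      omega
    · rw [okLoop_iff (by rw [show y + 1 + n = y + (n + 1) by ring]; exact h)]
      constructor
      · intro h3 j hj hd
        rcases Nat.lt_or_ge y j with h4 | h4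
        · exact h3 j h4 hd
        · obtain rfl : y = j := by omega
          exact h2
      · intro h3 j hj hd
        exact h3 j (by omega) hd
    · simp only [false_iff]
      intro h3
      exact h2 (h3 y le_rfl (by omega))

/-- At height `j` only the least nonnegative value of `n d - j a` matters. It is the residue of `-j
a` modulo `d`, written by the program as that of `j (d - a)`. -/
theorem okLoop_hollow {k d a : ℕ} (hk : 0 < k) (had : a < d) :
    okLoop k d a d 1 = true ↔ Hollow k (1, 0) ((a : ℤ), (d : ℤ)) := by
  have hd : 0 < d := by omega
  rw [okLoop_iff (by nlinarith), hollow_normal_iff hk (by exact_mod_cast hd)]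
  have hmod : ∀ j : ℕ, ((j * (d - a) % d : ℕ) : ℤ) = (-(j * a : ℤ)) % d := by
    intro j
    rw [Int.natCast_mod, Nat.cast_mul, Nat.cast_sub had.le]
    have : (j : ℤ) * (d - a) = -(j * a) + d * j := by ring
    rw [this, Int.add_mul_emod_self_left]
  constructor
  · intro h j n hj hn
    lift j to ℕ using by omega
    by_cases hkj : k * j < d
    · have h1 := h j (by omega) hkj
      have h2 : (-(j * a : ℤ)) % d ≤ n * d - j * a := by
        have : (n * d - j * a : ℤ) = -(j * a) + d * n := by ring
        rw [this, ← Int.add_mul_emod_self_left (-(j * a : ℤ)) d n]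
        have h0 : 0 ≤ -(j * a : ℤ) + d * n := by linarith
        rw [Int.emod_def]
        have := mul_nonneg (show (0 : ℤ) ≤ d by positivity) (Int.ediv_nonneg h0 (show (0 : ℤ) ≤ d by positivity))
        linarith
      rw [← hmod] at h2
      have h3 : (d : ℤ) ≤ k * (j + (j * (d - a) % d : ℕ)) := by exact_mod_cast h1
      have : (k : ℤ) * (j + (j * (d - a) % d : ℕ)) ≤ k * (j + (n * d - j * a)) :=
        mul_le_mul_of_nonneg_left (by linarith) (by positivity)
      linarith
    · have : (d : ℤ) ≤ k * j := by exact_mod_cast not_lt.1 hkj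
      have h0 : (0 : ℤ) ≤ k * (n * d - j * a) := by positivity
      linarith
  · intro h j hj _
    have h1 := h j (-((-(j * a : ℤ)) / d)) (by exact_mod_cast hj)
    have h2 : -((-(j * a : ℤ)) / d) * d - j * a = (-(j * a : ℤ)) % d := by
      rw [Int.emod_def]; ring
    rw [h2, ← hmod] at h1
    exact_mod_cast h1 (by positivity)

theorem maskRow_succ (k d n m : ℕ) : maskRow k d (n + 1) m =
    maskRow k d n (if Nat.gcd n d = 1 ∧ okLoop k d n d 1 = true then m ||| 1 <<< (80 * d + n) else m) := by
  change force n (fun a => ifb (Nat.beq (Nat.gcd a d) 1) (ifb (okLoop k d a d 1)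
    (force (m ||| 1 <<< (80 * d + a)) fun m => maskRow k d n m) (maskRow k d n m)) (maskRow k d n m)) = _
  simp only [force_eq, ifb_eq, beq_iff]
  split_ifs <;> simp_all

theorem testBit_or_shift (m i j : ℕ) : (m ||| 1 <<< i).testBit j = (m.testBit j || decide (i = j)) := by
  rw [Nat.testBit_or, Nat.one_shiftLeft, Nat.testBit_two_pow]

theorem maskRow_testBit {k d i : ℕ} : ∀ {n m : ℕ}, ((maskRow k d n m).testBit i = true ↔
    m.testBit i = true ∨ ∃ a < n, i = 80 * d + a ∧ Nat.gcd a d = 1 ∧ okLoop k d a d 1 = true)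
  | 0, m => by
    change m.testBit i = true ↔ _
    simp
  | n + 1, m => by
    rw [maskRow_succ, maskRow_testBit]
    have hsplit : (∃ a < n + 1, i = 80 * d + a ∧ Nat.gcd a d = 1 ∧ okLoop k d a d 1 = true) ↔
        (i = 80 * d + n ∧ Nat.gcd n d = 1 ∧ okLoop k d n d 1 = true) ∨
        (∃ a < n, i = 80 * d + a ∧ Nat.gcd a d = 1 ∧ okLoop k d a d 1 = true) := by
      constructor
      · rintro ⟨a, ha, h⟩
        rcases Nat.lt_succ_iff_lt_or_eq.1 ha with h1 | rfl
        · exact Or.inr ⟨a, h1, h⟩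
        · exact Or.inl h
      · rintro (h | ⟨a, ha, h⟩)
        · exact ⟨n, by omega, h⟩
        · exact ⟨a, by omega, h⟩
    rw [hsplit]
    split_ifs with h
    · rw [testBit_or_shift]
      simp only [Bool.or_eq_true, decide_eq_true_eq, or_assoc]
      have : 80 * d + n = i ↔ i = 80 * d + n ∧ Nat.gcd n d = 1 ∧ okLoop k d n d 1 = true :=
        ⟨fun h' => ⟨h'.symm, h⟩, fun h' => h'.1.symm⟩
      rw [this]
    · have : ¬ (i = 80 * d + n ∧ Nat.gcd n d = 1 ∧ okLoop k d n d 1 = true) := fun h' => h h'.2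
      simp only [this, false_or]

theorem mask_testBit {k M i : ℕ} : (mask k M).testBit i = true ↔
    ∃ d, 1 ≤ d ∧ d ≤ M ∧ ∃ a < d, i = 80 * d + a ∧ Nat.gcd a d = 1 ∧ okLoop k d a d 1 = true := by
  have key : ∀ n m : ℕ, ((Nat.rec (motive := fun _ => ℕ → ℕ) (fun m => m)
    (fun d ih m => force (Nat.succ d) fun d => force (maskRow k d d m) fun m => ih m) n m : ℕ).testBit i = true ↔
      m.testBit i = true ∨ ∃ d, 1 ≤ d ∧ d ≤ n ∧ ∃ a < d, i = 80 * d + a ∧ Nat.gcd a d = 1 ∧ okLoop k d a d 1 = true) := by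
    intro n
    induction n with
    | zero =>
      intro m
      constructor
      · exact Or.inl
      · rintro (h | ⟨d, hd, hd', -⟩)
        · exact h
        · omega
    | succ n ih =>
      intro m
      change (force (n + 1) fun d => force (maskRow k d d m) fun m => Nat.rec (motive := fun _ => ℕ → ℕ) (fun m => m)
    (fun d ih m => force (Nat.succ d) fun d => force (maskRow k d d m) fun m => ih m) n m : ℕ).testBit i = true ↔ _
      rw [force_eq, force_eq, ih, maskRow_testBit, or_assoc]
      apply or_congr Iff.rfl
      constructor
      · rintro (h | ⟨d, h1, h2, h⟩)
        · exact ⟨n + 1, by omega, by omega, h⟩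
        · exact ⟨d, h1, by omega, h⟩
      · rintro ⟨d, h1, h2, h⟩
        by_cases hd : d = n + 1
        · subst hd; exact Or.inl h
        · exact Or.inr ⟨d, h1, by omega, h⟩
  have := key M 0
  rw [Nat.zero_testBit] at this
  exact this.trans (or_iff_right (by simp))

/-- The mask lists the types of edges. -/
theorem mask_iff {k M : ℕ} (hk : 0 < k) (hM : M < 80) {e α : ℕ} (he : e ≤ M) (hα : α < e) :
    (mask k M).testBit (80 * e + α) = true ↔ OkType k e α := by
  rw [mask_testBit]
  have hc : Nat.gcd α e = 1 ↔ IsCoprime (α : ℤ) e := by rw [Nat.isCoprime_iff_coprime]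
  constructor
  · rintro ⟨d, h1, h2, a, ha, hi, hg, ho⟩
    obtain ⟨rfl, rfl⟩ : e = d ∧ α = a := by omega
    exact ⟨by positivity, by exact_mod_cast hα, hc.1 hg, (okLoop_hollow hk hα).1 ho⟩
  · rintro ⟨-, -, hg, ho⟩
    exact ⟨e, by omega, he, α, hα, rfl, hc.2 hg, (okLoop_hollow hk hα).2 ho⟩

theorem startMask_testBit {m d a i : ℕ} : (startMask m d a).testBit i = true ↔
    (i < 80 * d ∧ m.testBit i = true) ∨
      ∃ al ≤ a, i = 80 * d + al ∧ m.testBit (80 * d + al) = true ∧ inv al d ≤ a := by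
  have key : ∀ n m' : ℕ, ((Nat.rec (motive := fun _ => ℕ → ℕ) (fun m => m)
    (fun al ih m' => force al fun al => bit m (Nat.add (Nat.mul 80 d) al)
      (ifb (Nat.ble (inv al d) a)
        (force (Nat.lor m' (Nat.shiftLeft 1 (Nat.add (Nat.mul 80 d) al))) fun m => ih m) (ih m'))
      (ih m')) n m' : ℕ).testBit i = true ↔ m'.testBit i = true ∨
      ∃ al < n, i = 80 * d + al ∧ m.testBit (80 * d + al) = true ∧ inv al d ≤ a) := by
    intro n
    induction n with
    | zero => intro m'; simp
    | succ n ih =>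
      intro m'
      set g := (Nat.rec (motive := fun _ => ℕ → ℕ) (fun m => m)
    (fun al ih m' => force al fun al => bit m (Nat.add (Nat.mul 80 d) al)
      (ifb (Nat.ble (inv al d) a)
        (force (Nat.lor m' (Nat.shiftLeft 1 (Nat.add (Nat.mul 80 d) al))) fun m => ih m) (ih m'))
      (ih m')) n : ℕ → ℕ)
      change (force n fun al => bit m (80 * d + al) (ifb (Nat.ble (inv al d) a)
        (force (m' ||| 1 <<< (80 * d + al)) fun m => g m) (g m')) (g m')).testBit i = true ↔ _
      simp only [force_eq, bit_eq, ifb_eq, ble_iff]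
      have hsplit : (∃ al < n + 1, i = 80 * d + al ∧ m.testBit (80 * d + al) = true ∧ inv al d ≤ a) ↔
        (i = 80 * d + n ∧ m.testBit (80 * d + n) = true ∧ inv n d ≤ a) ∨
        (∃ al < n, i = 80 * d + al ∧ m.testBit (80 * d + al) = true ∧ inv al d ≤ a) := by
        constructor
        · rintro ⟨a, ha, h⟩
          rcases Nat.lt_succ_iff_lt_or_eq.1 ha with h1 | rfl
          · exact Or.inr ⟨a, h1, h⟩
          · exact Or.inl h
        · rintro (h | ⟨a, ha, h⟩)
          · exact ⟨n, by omega, h⟩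
          · exact ⟨a, by omega, h⟩
      rw [hsplit]
      split_ifs with h1 h2
      · rw [ih, testBit_or_shift]
        simp only [Bool.or_eq_true, decide_eq_true_eq, or_assoc]
        have : 80 * d + n = i ↔ i = 80 * d + n ∧ m.testBit (80 * d + n) = true ∧ inv n d ≤ a :=
          ⟨fun h' => ⟨h'.symm, h1, h2⟩, fun h' => h'.1.symm⟩
        rw [this]
      · rw [ih]
        have : ¬ (i = 80 * d + n ∧ m.testBit (80 * d + n) = true ∧ inv n d ≤ a) := fun h' => h2 h'.2.2
        simp only [this, false_or]
      · rw [ih]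
        have : ¬ (i = 80 * d + n ∧ m.testBit (80 * d + n) = true ∧ inv n d ≤ a) := fun h' => h1 h'.2.1
        simp only [this, false_or]
  refine (key (a + 1) (m % 1 <<< (80 * d))).trans ?_
  apply or_congr
  · rw [Nat.one_shiftLeft, Nat.testBit_mod_two_pow]; simp
  · simp only [Nat.lt_succ_iff]

/-- The parameters of the search for a fixed first edge. -/
structure Params (k M m d a : ℕ) : Prop where
  k_pos : 0 < k
  le : M ≤ 72
  bound : (M : ℤ) = bound k
  mask : m = mask k M
  d_le : d ≤ M
  a_lt : a < d
  coprime : IsCoprime (a : ℤ) d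

/-- The bits below `80 d` are the types of smaller determinant. At determinant `d` the residue and
its inverse, which is the residue of the reversed edge, are both compared with `a`. -/
theorem Params.adm_iff {k M m d a : ℕ} (h : Params k M m d a) {u v : Pt}
    (hu : IsCoprime u.1 u.2) (hc : 0 < cross u v) (hc' : cross u v ≤ M) :
    (startMask m d a).testBit (80 * (cross u v).toNat + (res u v).toNat) = true ↔ Adm k d a u v := by
  have h1 := h.le
  have r0 := res_nonneg hc
  have r1 := res_lt hc
  have hm : m.testBit (80 * (cross u v).toNat + (res u v).toNat) = true ↔
      OkType k (cross u v) (res u v) := by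
    rw [h.mask, mask_iff h.k_pos (by omega) (by omega) (by omega), Int.toNat_of_nonneg hc.le, Int.toNat_of_nonneg r0]
  have hd := h.d_le
  rw [startMask_testBit, Adm]
  constructor
  · rintro (⟨h2, h3⟩ | ⟨al, h2, h3, h4, h5⟩)
    · exact ⟨hm.1 h3, Or.inl (by omega)⟩
    · have hal := h.a_lt
      obtain ⟨e1, e2⟩ : (cross u v).toNat = d ∧ (res u v).toNat = al := by omega
      subst e2
      rw [← e1] at h4
      have hok := hm.1 h4
      refine ⟨hok, Or.inr ⟨by omega, by omega, ?_⟩⟩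
      have hv := (hollow_of_okType hu hok).2.2
      have hsw : 0 < cross v.swap u.swap := by rwa [cross_swap]
      have := inv_eq (al := (res u v).toNat) (e := d) (β := res v.swap u.swap) (res_nonneg hsw)
        (by have := res_lt hsw; rw [cross_swap] at this; omega)
        (by have := res_swap_mul hu hv
            rw [Int.toNat_of_nonneg r0]
            convert this using 1; omega)
      omega
  · rintro ⟨hok, h2 | ⟨h2, h3, h4⟩⟩
    · exact Or.inl ⟨by omega, hm.2 hok⟩
    · refine Or.inr ⟨(res u v).toNat, by omega, by omega, ?_, ?_⟩
      · have := hm.2 hok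
        rwa [show (cross u v).toNat = d by omega] at this
      · have hv := (hollow_of_okType hu hok).2.2
        have hsw : 0 < cross v.swap u.swap := by rwa [cross_swap]
        have := inv_eq (al := (res u v).toNat) (e := d) (β := res v.swap u.swap) (res_nonneg hsw)
          (by have := res_lt hsw; rw [cross_swap] at this; omega)
          (by have := res_swap_mul hu hv
              rw [Int.toNat_of_nonneg r0]
              convert this using 1; omega)
        omega

end Prog
end LDP

namespace LDP
namespace Prog

/-! #### Candidates -/

/-- The test for candidates in `row`. -/
def rowTest (mask e c Y N s d A X : ℕ) : Bool :=
  mask.testBit (80 * e + (X + c) % e) && (decide (524288 ≤ (A * Y + N * X) % 1048576) ||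
    decide ((A * Y + N * X) % 1048576 = 0) ||
    mask.testBit (80 * ((A * Y + N * X) % 1048576) + resPos s d X Y ((A * Y + N * X) % 1048576)))

theorem row_eq (mask e c Y N s d A : ℕ) : ∀ (n X : ℕ) (acc : List Ed),
    row mask e c Y N s d A n X acc =
      (((List.range' X n).filter (rowTest mask e c Y N s d A)).reverse.map fun X => Ed.mk X Y 0 0) ++ acc
  | 0, X, acc => rfl
  | n + 1, X, acc => by
    have h : row mask e c Y N s d A (n + 1) X acc = row mask e c Y N s d A n (X + 1)
        (if rowTest mask e c Y N s d A X then Ed.mk X Y 0 0 :: acc else acc) := by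
      change force X (fun X => bit mask (80 * e + (X + c) % e)
        (force ((A * Y + N * X) % 1048576) fun e' =>
          ifb (Nat.ble 524288 e') (row mask e c Y N s d A n (X + 1) (Ed.mk X Y 0 0 :: acc))
           (ifz e' (row mask e c Y N s d A n (X + 1) (Ed.mk X Y 0 0 :: acc))
             (bit mask (80 * e' + resPos s d X Y e')
               (row mask e c Y N s d A n (X + 1) (Ed.mk X Y 0 0 :: acc))
               (row mask e c Y N s d A n (X + 1) acc))))
       (row mask e c Y N s d A n (X + 1) acc)) = _
      simp only [force_eq, bit_eq, ifb_eq, ifz_eq, ble_iff, rowTest, Bool.and_eq_true, Bool.or_eq_true,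
        decide_eq_true_eq]
      split_ifs <;> simp_all; omega
    rw [h, row_eq, List.range'_succ, List.filter_cons]
    split_ifs <;> simp

/-- The encoding of a candidate. -/
def toEd (w : Pt) : Ed := Ed.mk (enc w.1) (enc w.2) 0 0

/-- The offsets of the encoded coordinates only contribute multiples of `2 ^ 20`, so a determinant
of encoded vectors is correct modulo `2 ^ 20`. -/
theorem toNat_mod_eq {c : ℤ} {K : ℕ} (h : (1048576 : ℤ) ∣ K - c) :
    ((K % 1048576 : ℕ) : ℤ) = c % 1048576 := by
  obtain ⟨q, hq⟩ := h
  have : (K : ℤ) = c + 1048576 * q := by linarith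
  rw [Int.natCast_mod, this]
  exact Int.add_mul_emod_self_left _ _ _

theorem Params.mask_iff {k M m d a : ℕ} (h : Params k M m d a) {e α : ℕ} {e' α' : ℤ} (he : (e : ℤ) = e')
    (hα : (α : ℤ) = α') (h1 : e ≤ M) (h2 : α < e) : m.testBit (80 * e + α) = true ↔ OkType k e' α' := by
  have := h.le
  rw [h.mask, Prog.mask_iff h.k_pos (by omega) h1 h2, he, hα]

theorem mod_add_eq {x : ℤ} {X e : ℕ} (he : 0 < e) (hX : (X : ℤ) = x + 1048576) :
    (((X + 1048576 * (e - 1)) % e : ℕ) : ℤ) = x % e := by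
  rw [Int.natCast_mod, Nat.cast_add, Nat.cast_mul, Nat.cast_sub (by omega), hX]
  have : x + 1048576 + ((1048576 : ℕ) : ℤ) * ((e : ℤ) - (1 : ℕ)) = x + e * 1048576 := by push_cast; ring
  rw [this, Int.add_mul_emod_self_left]

/-- The determinant is bounded on both sides, so its residue modulo `2 ^ 20` reveals its sign:
residues from `524288 = 2 ^ 19` on stand for negative values. -/
theorem Params.rowTest_iff {k M m d a : ℕ} (h : Params k M m d a) {e X Y : ℕ} {w : Pt}
    (he : 0 < e) (heM : e ≤ M) (hew : (e : ℤ) = |w.2|) (hX : (X : ℤ) = w.1 + 1048576)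
    (hY : (Y : ℤ) = w.2 + 1048576)
    (h1 : cross (a, d) w ≤ M) (h2 : -1000 < cross (a, d) w) :
    rowTest m e (1048576 * (e - 1)) Y (1048576 - d) (inv a d) d (1048576 + a) X = true ↔
      OkType k |w.2| (w.1 % |w.2|) ∧ (0 < cross (a, d) w → OkType k (cross (a, d) w) (res (a, d) w)) := by
  have hM := h.le
  have hd := h.d_le
  have ha := h.a_lt
  have hmod : (((1048576 + a) * Y + (1048576 - d) * X) % 1048576 : ℕ) = cross (a, d) w % 1048576 := by
    apply toNat_mod_eq
    rw [Nat.cast_add, Nat.cast_mul, Nat.cast_mul, Nat.cast_sub (by omega), hX, hY]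
    refine ⟨w.2 + 1048576 + a + w.1 + 1048576 - d, ?_⟩
    unfold cross; push_cast; ring
  set e' := ((1048576 + a) * Y + (1048576 - d) * X) % 1048576 with he'
  have hlt : e' < 1048576 := Nat.mod_lt _ (by norm_num)
  rw [rowTest, ← he', Bool.and_eq_true, h.mask_iff hew (mod_add_eq he hX) heM (Nat.mod_lt _ he), hew]
  apply and_congr_right
  intro hok
  simp only [Bool.or_eq_true, decide_eq_true_eq]
  rcases lt_trichotomy (cross (a, d) w) 0 with hc | hc | hc
  · have : 524288 ≤ e' := by omega
    simp [this, hc.le]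
  · have : e' = 0 := by omega
    simp [this, hc]
  · have hee : (e' : ℤ) = cross (a, d) w := by omega
    have e1 : e' = (cross (a, d) w).toNat := by omega
    obtain ⟨hs, hs'⟩ := inv_isCoprime (X := a) (e := d) (x := a) (by omega) (by simp) h.coprime
    have hr : (resPos (inv a d) d X Y e' : ℤ) = res (a, d) w := by
      have := resPos_eq (p := ((a : ℤ), (d : ℤ))) (w := w) (s := inv a d) (by simp; omega) (by simp; omega)
        (by omega) hs' hc (by omega) (by omega) X
      rw [← this, e1]
      congr 2
      unfold enc; omega
    have hlt := res_lt hc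
    rw [h.mask_iff hee hr (by omega) (by omega)]
    have n1 : ¬ 524288 ≤ e' := by omega
    have n2 : ¬ e' = 0 := by omega
    simp [n1, n2, hc]

/-- Bounds for the coordinates of the vertices. -/
def Small (w : Pt) : Prop := |w.1| ≤ 200 ∧ |w.2| ≤ 72

/-- The ordinate is bounded directly. The abscissa is enclosed by the bound for `cross (a, d) w` and
by convexity at the first edge. All determinants are then small compared with `2 ^ 20`. -/
theorem Params.small_of_cand {k M m d a : ℕ} (h : Params k M m d a) {w : Pt} (hw : Cand k d a w) :
    Small w := by
  have hM := h.le
  have hd := h.d_le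
  have ha := h.a_lt
  have hb := h.bound
  obtain ⟨h1, rfl | ⟨⟨h2, h3, h4⟩, h5, h6⟩⟩ := hw
  · simp [Small]
  · rw [← hb] at h3 h5
    have h3' := abs_le.1 h3
    refine ⟨?_, by omega⟩
    simp only [orient, cross] at h1 h5
    rw [abs_le]
    have hd0 : (0 : ℤ) < d := by omega
    have b1 : (a : ℤ) * w.2 ≤ d * 72 := by
      calc (a : ℤ) * w.2 ≤ a * 72 := by apply mul_le_mul_of_nonneg_left <;> omega
        _ ≤ d * 72 := by omega
    have b2 : -(d * 72 : ℤ) ≤ a * w.2 := by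
      calc -(d * 72 : ℤ) ≤ a * (-72) := by omega
        _ ≤ a * w.2 := by apply mul_le_mul_of_nonneg_left <;> omega
    constructor
    · by_contra hc
      have : (d : ℤ) * w.1 ≤ d * (-201) := mul_le_mul_of_nonneg_left (by omega) hd0.le
      omega
    · by_contra hc
      have : (d : ℤ) * 201 ≤ d * w.1 := mul_le_mul_of_nonneg_left (by omega) hd0.le
      ring_nf at *
      omega

theorem isCoprime_of_cand {k : ℕ} {d a : ℤ} {w : Pt} (hw : Cand k d a w) : IsCoprime w.1 w.2 := by
  obtain ⟨-, rfl | ⟨⟨-, -, -, -, h, -⟩, -⟩⟩ := hw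
  · exact isCoprime_one_left.neg_left
  · rcases abs_choice w.2 with h' | h' <;> rw [h'] at h
    · rwa [Int.isCoprime_iff_gcd_eq_one, Int.gcd_emod, ← Int.isCoprime_iff_gcd_eq_one] at h
    · rw [Int.isCoprime_iff_gcd_eq_one, Int.gcd_emod, ← Int.isCoprime_iff_gcd_eq_one] at h
      simpa using h.neg_right

/-- The summand `d - 1` turns the rounding down of the division into rounding up, so the quotient
encodes the least integer `x` with `z ≤ d x`. -/
theorem div_le_iff_of_eq {K X d : ℕ} {z x : ℤ} (hd : 0 < d) (hX : (X : ℤ) = x + 1048576)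
    (hK : (K : ℤ) = 1048576 * d + (d - 1) + z) : K / d ≤ X ↔ z ≤ d * x := by
  rw [Nat.div_le_iff_le_mul_add_pred hd]
  zify [hd]
  rw [hK, hX]
  constructor <;> intro h <;> linarith

theorem Params.exists_row {k M m d a : ℕ} (h : Params k M m d a) {e Y lo hi : ℕ} {y zl zh : ℤ}
    (he : 0 < e) (heM : e ≤ M) (hy : |y| = e) (hY : (Y : ℤ) = y + 1048576)
    (hl : (lo : ℤ) = 1048576 * d + (d - 1) + zl) (hh : (hi : ℤ) = 1048576 * d + (d - 1) + zh)
    (hzl : zl = a * y - M) (hzh : zh = (a - 1) * y + d) :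
    ∃ R : List Pt, (∀ acc, row m e (1048576 * (e - 1)) Y (1048576 - d) (inv a d) d (1048576 + a)
      (hi / d - lo / d) (lo / d) acc = R.map toEd ++ acc) ∧ R.Nodup ∧
      ∀ w, w ∈ R ↔ Cand k d a w ∧ w.2 = y := by
  have hM := h.le
  have hd := h.d_le
  have ha := h.a_lt
  have hb := h.bound
  have hy' := abs_le.1 hy.le
  set t := rowTest m e (1048576 * (e - 1)) Y (1048576 - d) (inv a d) d (1048576 + a) with ht
  refine ⟨((List.range' (lo / d) (hi / d - lo / d)).filter t).reverse.map
    fun X : ℕ => ((X : ℤ) - 1048576, y), ?_, ?_, ?_⟩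
  · intro acc
    rw [row_eq, List.map_map]
    congr 1
    refine List.map_congr_left fun X _ => ?_
    rw [Function.comp_apply, toEd, enc_sub, show enc y = Y by unfold enc; omega]
  · refine List.Nodup.map ?_ ?_
    · intro X X' hX
      have := congrArg Prod.fst hX
      simp only at this
      omega
    · rw [List.nodup_reverse]
      exact (List.nodup_range').filter _
  · have key : ∀ (X : ℕ) (w : Pt), w.2 = y → (X : ℤ) = w.1 + 1048576 →
        ((lo / d ≤ X ∧ X < hi / d ∧ t X = true) ↔ Cand k d a w) := by
      intro X w hw hX
      rw [← not_le, div_le_iff_of_eq (by omega) hX hl, div_le_iff_of_eq (by omega) hX hh]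
      -- The ends of the row are these two inequalities: the determinant with `(a, d)` is bounded by
      -- `M`, and `w` lies to the left of the first edge.
      have e1 : zl ≤ d * w.1 ↔ cross (a, d) w ≤ M := by
        rw [hzl]; simp only [cross, hw]; constructor <;> intro h <;> linarith
      have e2 : ¬ zh ≤ d * w.1 ↔ 0 < orient (1, 0) (a, d) w := by
        rw [hzh, not_le]; simp only [orient, cross, hw]; constructor <;> intro h <;> linarith
      rw [e1, e2, Cand]
      have hne : w ≠ (-1, 0) := by
        rintro rfl
        simp only at hw
        rw [← hw] at hy; simp at hy; omega
      have hne2 : w.2 ≠ 0 := by rintro h'; rw [hw] at h'; rw [h'] at hy; simp at hy; omega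
      have hab : |w.2| ≤ M := by rw [hw, hy]; omega
      simp only [hne, false_or, hne2, ne_eq, not_false_eq_true, hab, true_and, ← hb]
      constructor
      · rintro ⟨h1, h2, h3⟩
        have h4 : -1000 < cross (a, d) w := by simp only [orient, cross] at h2 ⊢; simp only [hw] at h2 ⊢; linarith
        have := (h.rowTest_iff (w := w) he heM (by rw [hw, hy]) hX (by rw [hw, hY]) h1 h4).1 h3
        exact ⟨h2, this.1, h1, this.2⟩
      · rintro ⟨h2, h5, h1, h6⟩
        have h4 : -1000 < cross (a, d) w := by simp only [orient, cross] at h2 ⊢; simp only [hw] at h2 ⊢; linarith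
        exact ⟨h1, h2, (h.rowTest_iff (w := w) he heM (by rw [hw, hy]) hX (by rw [hw, hY]) h1 h4).2 ⟨h5, h6⟩⟩
    intro w
    simp only [List.mem_map, List.mem_reverse, List.mem_filter, List.mem_range'_1]
    constructor
    · rintro ⟨X, ⟨⟨h1, h2⟩, h3⟩, rfl⟩
      exact ⟨(key X _ rfl (by simp)).1 ⟨h1, by omega, h3⟩, rfl⟩
    · rintro ⟨h1, h2⟩
      have hs := h.small_of_cand h1
      have hs1 := abs_le.1 hs.1
      have := (key (w.1 + 1048576).toNat w h2 (by omega)).2 h1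
      refine ⟨(w.1 + 1048576).toNat, ⟨⟨this.1, by omega⟩, this.2.2⟩, ?_⟩
      refine Prod.ext ?_ h2.symm
      simp only
      omega

/-- The program `rows` lists the candidates. -/
theorem Params.exists_rows {k M m d a : ℕ} (h : Params k M m d a) :
    ∃ W : List Pt, rows m M d a = W.map toEd ∧ W.Nodup ∧ ∀ w, w ∈ W ↔ Cand k d a w := by
  have hM := h.le
  have hd := h.d_le
  have ha := h.a_lt
  have hb := h.bound
  set F : ℕ → List Ed → List Ed := fun n => Nat.rec (motive := fun _ => List Ed → List Ed) (fun acc => acc)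
   (fun e' ih acc => force (Nat.succ e') fun e => force (Nat.mul 1048576 e') fun c =>
     force (Nat.div (Nat.sub (Nat.add (1048576 * d + d.pred) (Nat.mul a e)) M) d) fun xl =>
     force (Nat.div (Nat.sub (Nat.add (1048576 * d + d.pred) (Nat.add (Nat.mul a e) d)) e) d) fun xh =>
     force (Nat.div (Nat.sub (1048576 * d + d.pred) (Nat.add (Nat.mul a e) M)) d) fun xl' =>
     force (Nat.div (Nat.sub (Nat.add (1048576 * d + d.pred) (Nat.add e d)) (Nat.mul a e)) d) fun xh' =>
     force (Nat.add 1048576 e) fun Y => force (Nat.sub 1048576 e) fun Y' =>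
     ih (row m e c Y' (1048576 - d) (inv a d) d (1048576 + a) (Nat.sub xh' xl') xl'
       (row m e c Y (1048576 - d) (inv a d) d (1048576 + a) (Nat.sub xh xl) xl acc))) n with hF
  have key : ∀ n ≤ M, ∃ R : List Pt, (∀ acc, F n acc = R.map toEd ++ acc) ∧ R.Nodup ∧
      ∀ w, w ∈ R ↔ Cand k d a w ∧ 0 < |w.2| ∧ |w.2| ≤ n := by
    intro n
    induction n with
    | zero =>
      refine fun _ => ⟨[], fun acc => rfl, List.nodup_nil, fun w => ?_⟩
      simp only [List.not_mem_nil, false_iff]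
      rintro ⟨-, h1, h2⟩
      simp at h2
      rw [h2] at h1; simp at h1
    | succ n ih =>
      intro hn
      obtain ⟨R, hR, hRn, hRm⟩ := ih (by omega)
      have hpd : (d.pred : ℤ) = d - 1 := by rw [Nat.pred_eq_sub_one, Nat.cast_sub (by omega)]; rfl
      have hae : a * (n + 1) ≤ d * 72 := Nat.mul_le_mul ha.le (by omega)
      obtain ⟨R1, hR1, hRn1, hRm1⟩ := h.exists_row (e := n + 1) (Y := 1048576 + (n + 1)) (y := n + 1)
        (lo := 1048576 * d + d.pred + a * (n + 1) - M) (hi := 1048576 * d + d.pred + (a * (n + 1) + d) - (n + 1))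
        (by omega) hn (by push_cast; rw [abs_of_pos (by omega)]) (by push_cast; ring)
        (zl := a * (n + 1) - M) (by rw [Nat.cast_sub (by omega)]; push_cast [hpd]; ring)
        (zh := a * (n + 1) + d - (n + 1)) (by rw [Nat.cast_sub (by omega)]; push_cast [hpd]; ring)
        (by ring) (by ring)
      obtain ⟨R2, hR2, hRn2, hRm2⟩ := h.exists_row (e := n + 1) (Y := 1048576 - (n + 1)) (y := -(n + 1))
        (lo := 1048576 * d + d.pred - (a * (n + 1) + M)) (hi := 1048576 * d + d.pred + ((n + 1) + d) - a * (n + 1))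
        (by omega) hn (by rw [abs_neg]; push_cast; rw [abs_of_pos (by omega)]) (by rw [Nat.cast_sub (by omega)]; push_cast; ring)
        (zl := -(a * (n + 1) + M)) (by rw [Nat.cast_sub (by omega)]; push_cast [hpd]; ring)
        (zh := n + 1 + d - a * (n + 1)) (by rw [Nat.cast_sub (by omega)]; push_cast [hpd]; ring)
        (by ring) (by ring)
      have hFn : ∀ acc, F (n + 1) acc = F n (R2.map toEd ++ (R1.map toEd ++ acc)) := by
        intro acc
        rw [← hR1, ← hR2]
        simp only [hF, force_eq]
        rfl
      refine ⟨R ++ (R2 ++ R1), ?_, ?_, ?_⟩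
      · intro acc
        rw [hFn, hR]; simp
      · rw [List.nodup_append, List.nodup_append]
        refine ⟨hRn, ⟨hRn2, hRn1, ?_⟩, ?_⟩
        · rintro w hw w' hw' rfl
          rw [hRm2] at hw
          rw [hRm1] at hw'
          omega
        · rintro w hw w' hw' rfl
          rw [hRm] at hw
          rw [List.mem_append, hRm1, hRm2] at hw'
          rcases hw' with hw' | hw' <;> rw [hw'.2] at hw
          · rw [abs_neg, abs_of_pos (by omega)] at hw; omega
          · rw [abs_of_pos (by omega)] at hw; omega
      · intro w
        rw [List.mem_append, List.mem_append, hRm, hRm1, hRm2]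
        constructor
        · rintro (⟨h1, h2, h3⟩ | ⟨h1, h2⟩ | ⟨h1, h2⟩)
          · exact ⟨h1, h2, by push_cast; omega⟩
          · rw [h2, abs_neg, abs_of_pos (by omega)]; exact ⟨h1, by omega, by push_cast; omega⟩
          · rw [h2, abs_of_pos (by omega)]; exact ⟨h1, by omega, by push_cast; omega⟩
        · rintro ⟨h1, h2, h3⟩
          rcases abs_choice w.2 with h4 | h4 <;> rw [h4] at h2 h3 ⊢
          · by_cases h5 : w.2 = n + 1
            · exact Or.inr (Or.inr ⟨h1, h5⟩)
            · exact Or.inl ⟨h1, h2, by push_cast at h3; omega⟩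
          · by_cases h5 : w.2 = -(n + 1)
            · exact Or.inr (Or.inl ⟨h1, h5⟩)
            · exact Or.inl ⟨h1, h2, by push_cast at h3; omega⟩
  obtain ⟨R, hR, hRn, hRm⟩ := key M le_rfl
  -- The accumulator starts with `(-1, 0)`, the only candidate on the horizontal axis.
  refine ⟨R ++ [(-1, 0)], ?_, ?_, ?_⟩
  · rw [List.map_append]
    refine Eq.trans ?_ (hR [toEd (-1, 0)])
    unfold rows
    simp only [force_eq, hF]
    rfl
  · rw [List.nodup_append]
    refine ⟨hRn, by simp, ?_⟩
    rintro w hw w' hw' rfl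
    simp at hw'
    rw [hRm, hw'] at hw
    simp at hw
  · intro w
    rw [List.mem_append, hRm, List.mem_singleton]
    constructor
    · rintro (h1 | rfl)
      · exact h1.1
      · exact ⟨by simp [orient, cross]; omega, Or.inl rfl⟩
    · intro h1
      have h2 := h1.2
      rcases h2 with h2 | ⟨⟨h2, h3, -⟩, -⟩
      · exact Or.inr h2
      · exact Or.inl ⟨h1, by positivity, by rw [hb]; exact h3⟩

end Prog
end LDP

namespace LDP
namespace Prog

/-! #### Neighbours -/

/-- The tie code of an edge: the directions in which its type is the type `(d, a)`. -/
def tieCode (d a : ℤ) (u v : Pt) : ℕ :=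
  if cross u v = d then (if res u v = a then 1 else 0) + (if res v.swap u.swap = a then 2 else 0)
  else 0

theorem Params.tie_eq {k M m d a : ℕ} (h : Params k M m d a) {u v : Pt} (hu : IsCoprime u.1 u.2)
    (hv : IsCoprime v.1 v.2) (hc : 0 < cross u v) {al e : ℕ} (hal : (al : ℤ) = res u v)
    (he : (e : ℤ) = cross u v) : tie d a al e = tieCode d a u v := by
  have ha := h.a_lt
  change ifb (Nat.beq e d) (ifb (Nat.beq al a) 1 0 +
    ifb (Nat.beq (al * a % d) (1 % d)) 2 0) 0 = _
  simp only [ifb_eq, beq_iff, tieCode, ← he, Nat.cast_inj, ← hal]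
  split_ifs with h1 _ h2 h3 h3 h2 h3 h3 <;> try rfl
  all_goals
    exfalso
    have hsw : 0 < cross v.swap u.swap := by rwa [cross_swap]
    have hl := res_lt hsw
    rw [cross_swap, ← he, h1] at hl
    have hd := res_swap_mul hu hv
    rw [← hal, ← he, h1] at hd
  · exact h3 (eq_of_dvd_of_dvd (res_nonneg hsw) hl (by positivity) (by exact_mod_cast ha) hd
      (by have := dvd_of_mod_eq h2; rwa [mul_comm] at this))
  · exact h2 (by rw [h3, mul_comm] at hd; exact mod_eq_of_dvd hd)
  · exact h3 (eq_of_dvd_of_dvd (res_nonneg hsw) hl (by positivity) (by exact_mod_cast ha) hd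
      (by have := dvd_of_mod_eq h2; rwa [mul_comm] at this))
  · exact h2 (by rw [h3, mul_comm] at hd; exact mod_eq_of_dvd hd)

theorem _root_.LDP.Adm.cross_pos {k : ℕ} {d a : ℤ} {u v : Pt} (h : Adm k d a u v) : 0 < cross u v :=
  lt_of_le_of_lt h.1.1 h.1.2.1

theorem _root_.LDP.Adm.cross_le {k : ℕ} {d a : ℤ} {u v : Pt} (h : Adm k d a u v) : cross u v ≤ d := by
  rcases h.2 with h | h <;> omega

/-- The edge from `q` to `w`. -/
def edgeTo (d a : ℤ) (q w : Pt) : Ed := Ed.mk (enc w.1) (enc w.2) (cross q w).toNat (tieCode d a q w)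

-- Admissibility forces `0 < e ≤ d` and is then a single bit of the mask. The inequality between `e
-- + Y` and `Y'` tests the orientation with `(1, 0)`, which equals `cross q w - w.2 + q.2`.
open Classical in
theorem Params.nbrLoop_eq {k M m d a : ℕ} (h : Params k M m d a) {q : Pt} (hq : Small q)
    (hqc : IsCoprime q.1 q.2) {N : ℕ} (hN : (N : ℤ) = 1048576 - q.2) {al : ℕ → ℕ → ℕ → ℕ} :
    ∀ {W : List Pt} {acc : List Ed}, (∀ w ∈ W, Small w) → (∀ w ∈ W, IsCoprime w.1 w.2) →
    (∀ w ∈ W, 0 < cross q w → cross q w ≤ M →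
      (al (enc w.1) (enc w.2) (cross q w).toNat : ℤ) = res q w) →
    nbrLoop (startMask m d a) d a (enc q.1) N (enc q.2) al (W.map toEd) acc =
      ((W.filter fun w => Adm k d a q w ∧ 0 < orient (1, 0) q w).map (edgeTo d a q)).reverse ++ acc
  | [], acc, _, _, _ => rfl
  | w :: W, acc, hW, hWc, hal => by
    have hd := h.d_le
    have hM := h.le
    have ih := fun acc => Params.nbrLoop_eq h hq hqc hN (W := W) (acc := acc) (fun w hw => hW w (by simp [hw]))
      (fun w hw => hWc w (by simp [hw])) (fun w hw => hal w (by simp [hw]))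
    have hw := hW w (by simp)
    have b1 := abs_le.1 hw.1
    have b2 := abs_le.1 hw.2
    have c1 := abs_le.1 hq.1
    have c2 := abs_le.1 hq.2
    have e1 := enc_cast (x := w.1) (by omega)
    have e2 := enc_cast (x := w.2) (by omega)
    have e3 := enc_cast (x := q.1) (by omega)
    have e4 := enc_cast (x := q.2) (by omega)
    have hmod : ((enc q.1 * enc w.2 + N * enc w.1) % 1048576 : ℕ) = cross q w % 1048576 := by
      apply toNat_mod_eq
      rw [Nat.cast_add, Nat.cast_mul, Nat.cast_mul, hN, e1, e2, e3]
      refine ⟨w.2 + 1048576 + q.1 + w.1 - q.2 + 1048576, ?_⟩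
      unfold cross; ring
    set g : List Ed → List Ed := nbrLoop (startMask m d a) d a (enc q.1) N (enc q.2) al (W.map toEd) with hg
    have hstep : nbrLoop (startMask m d a) d a (enc q.1) N (enc q.2) al ((w :: W).map toEd) acc =
        force ((enc q.1 * enc w.2 + N * enc w.1) % 1048576) fun e =>
         ifb (Nat.ble e d) (ifz e (g acc) (ifb (Nat.ble (e + enc q.2) (enc w.2)) (g acc)
        (force (al (enc w.1) (enc w.2) e) fun al => bit (startMask m d a) (80 * e + al)
          (force (tie d a al e) fun t => g (Ed.mk (enc w.1) (enc w.2) e t :: acc)) (g acc))))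
        (g acc) := rfl
    rw [hstep]
    simp only [force_eq, ifb_eq, ifz_eq, ble_iff, bit_eq]
    set e := (enc q.1 * enc w.2 + N * enc w.1) % 1048576 with he
    have hab : |cross q w| ≤ 200 * 72 + 72 * 200 := by
      unfold cross
      refine (abs_sub _ _).trans ?_
      rw [abs_mul, abs_mul]
      exact add_le_add (mul_le_mul hq.1 hw.2 (abs_nonneg _) (by norm_num)) (mul_le_mul hq.2 hw.1 (abs_nonneg _) (by norm_num))
    have hab' := abs_le.1 hab
    have hor : orient (1, 0) q w = cross q w - w.2 + q.2 := by simp [orient, cross]; ring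
    rw [List.filter_cons]
    by_cases hA : Adm k d a q w ∧ 0 < orient (1, 0) q w
    · have hpos := hA.1.cross_pos
      have hle := hA.1.cross_le
      have hee : e = (cross q w).toNat := by omega
      have hal' := hal w (by simp) hpos (by omega)
      rw [if_pos (by omega), if_neg (by omega), if_neg (by omega), hee]
      have hr : al (enc w.1) (enc w.2) (cross q w).toNat = (res q w).toNat := by omega
      have := (h.adm_iff (v := w) hqc hpos (by omega)).2 hA.1
      rw [hr, if_pos this, h.tie_eq hqc (hWc w (by simp)) hpos (by have := res_nonneg hpos; omega) (by omega), ih]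
      simp [hA, edgeTo]
    · rw [if_neg (show ¬ (decide _ = true) by rw [decide_eq_true_eq]; exact hA), ← ih acc]
      split_ifs with h1 h2 h3 h4 <;> try rfl
      exfalso
      have hpos : 0 < cross q w := by omega
      have hee : e = (cross q w).toNat := by omega
      have hal' := hal w (by simp) hpos (by omega)
      have hr : al (enc w.1) (enc w.2) (cross q w).toNat = (res q w).toNat := by omega
      rw [hee, hr] at h4
      exact hA ⟨(h.adm_iff hqc hpos (by omega)).1 h4, by omega⟩

/-- The specification of `nbr`. -/
theorem Params.exists_nbr {k M m d a : ℕ} (h : Params k M m d a) {W : List Pt} (hWn : W.Nodup)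
    (hWm : ∀ w, w ∈ W ↔ Cand k d a w) {q : Pt} (hq : Small q) (hqM : |q.2| ≤ M)
    (hqc : IsCoprime q.1 q.2) (hq0 : q ≠ (1, 0)) : ∃ (ec tc : ℕ) (N : List Pt),
    nbr (startMask m d a) d a (W.map toEd) (enc q.1) (enc q.2) =
      Ed.mk 1048577 1048576 ec tc :: N.map (edgeTo d a q) ∧
    (ec ≠ 0 → Adm k d a q (1, 0) ∧ (ec : ℤ) = cross q (1, 0) ∧ tc = tieCode d a q (1, 0)) ∧
    (ec = 0 → ¬ Adm k d a q (1, 0)) ∧ N.Nodup ∧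
    ∀ w, w ∈ N ↔ Cand k d a w ∧ Adm k d a q w ∧ 0 < orient (1, 0) q w := by
  classical
  have hM := h.le
  have hW : ∀ w ∈ W, Small w := fun w hw => h.small_of_cand ((hWm w).1 hw)
  have hWc : ∀ w ∈ W, IsCoprime w.1 w.2 := fun w hw => isCoprime_of_cand ((hWm w).1 hw)
  set N := (W.filter fun w => Adm k d a q w ∧ 0 < orient (1, 0) q w).reverse with hN
  have hNn : N.Nodup := by rw [hN, List.nodup_reverse]; exact hWn.filter _
  have hNm : ∀ w, w ∈ N ↔ Cand k d a w ∧ Adm k d a q w ∧ 0 < orient (1, 0) q w := by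
    intro w; rw [hN]; simp [hWm]
  have hq2 := abs_le.1 hq.2
  have e4 := enc_cast (x := q.2) (by omega)
  have hcr : cross q (1, 0) = -q.2 := by simp [cross]
  set Nn := 2097152 - enc q.2 with hNn'
  have hNz : (Nn : ℤ) = 1048576 - q.2 := by omega
  have main : ∀ al, (∀ w ∈ W, 0 < cross q w → cross q w ≤ M →
      (al (enc w.1) (enc w.2) (cross q w).toNat : ℤ) = res q w) →
      nbrLoop (startMask m d a) d a (enc q.1) Nn (enc q.2) al (W.map toEd) [] = N.map (edgeTo d a q) := by
    intro al hal
    rw [h.nbrLoop_eq hq hqc hNz hW hWc hal, hN, List.append_nil, List.map_reverse]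
  have hq1 := abs_le.1 hq.1
  have e3 := enc_cast (x := q.1) (by omega)
  have hstep : nbr (startMask m d a) d a (W.map toEd) (enc q.1) (enc q.2) =
    force Nn fun N =>
  ifb (Nat.ble (enc q.2) 1048576)
   (ifz (1048576 - enc q.2)
     (Ed.mk 1048577 1048576 0 0 :: nbrLoop (startMask m d a) d a (enc q.1) N (enc q.2) resZero (W.map toEd) [])
     (force (1048576 - enc q.2) fun y =>
        force (inv (enc q.1 + 1048576 * (y - 1)) y) fun s =>
        force (resNeg s y 1048577 1048576 y) fun al =>
        force (bit (startMask m d a) (80 * y + al) y 0) fun ec => force (tie d a al y) fun tc =>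
        Ed.mk 1048577 1048576 ec tc :: 
          nbrLoop (startMask m d a) d a (enc q.1) N (enc q.2) (resNeg s y) (W.map toEd) []))
   (force (enc q.2 - 1048576) fun y =>
        force (inv (enc q.1 + 1048576 * (y - 1)) y) fun s =>
        Ed.mk 1048577 1048576 0 0 ::
          nbrLoop (startMask m d a) d a (enc q.1) N (enc q.2) (resPos s y) (W.map toEd) []) := rfl
  rw [hstep]
  simp only [force_eq, ifb_eq, ifz_eq, ble_iff, bit_eq]
  have hinv : ∀ y : ℕ, (y : ℤ) = |q.2| → 0 < y → inv (enc q.1 + 1048576 * (y - 1)) y < y ∧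
      (y : ℤ) ∣ inv (enc q.1 + 1048576 * (y - 1)) y * q.1 - 1 := by
    intro y hy hy0
    apply inv_isCoprime hy0
    · rw [Nat.cast_add, e3, Nat.cast_mul, Nat.cast_sub (by omega)]
      exact ⟨1048576, by push_cast; ring⟩
    · rw [hy]
      rcases abs_choice q.2 with h' | h' <;> rw [h']
      · exact hqc
      · exact hqc.neg_right
  rcases lt_trichotomy q.2 0 with hs | hs | hs
  · rw [if_pos (by omega), if_neg (by omega)]
    rw [abs_of_neg hs] at hinv hqM
    have hy : 1048576 - enc q.2 = (-q.2).toNat := by omega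
    have hyz : ((-q.2).toNat : ℤ) = -q.2 := by omega
    rw [hy]
    obtain ⟨i1, i2⟩ := hinv _ hyz (by omega)
    set s := inv (enc q.1 + 1048576 * ((-q.2).toNat - 1)) (-q.2).toNat
    rw [hyz] at i2
    have hr0 : (resNeg s (-q.2).toNat 1048577 1048576 (-q.2).toNat : ℤ) = res q (1, 0) := by
      have := resNeg_eq (p := q) (w := (1, 0)) (s := s) hs (by omega) i2 (by omega) (by omega) (by simp) 1048577
      rw [hcr] at this
      exact this
    have hcp : 0 < cross q (1, 0) := by omega
    have hAd := h.adm_iff (v := (1, 0)) hqc hcp (by omega)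
    rw [hcr] at hAd
    have hr1 : (res q (1, 0)).toNat = resNeg s (-q.2).toNat 1048577 1048576 (-q.2).toNat := by omega
    rw [hr1] at hAd
    have htie := h.tie_eq hqc isCoprime_one_left hcp hr0 (e := (-q.2).toNat) (by omega)
    rw [main]
    rotate_left
    · intro w hw h1 h2
      have := abs_le.1 (hW w hw).2
      exact resNeg_eq hs (by omega) i2 h1 (by omega) (abs_le.2 (by omega)) _
    refine ⟨_, _, N, rfl, ?_, ?_, hNn, hNm⟩
    · intro hne
      split_ifs at hne ⊢ with hb
      · exact ⟨hAd.1 hb, by omega, htie⟩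
      · exact absurd rfl hne
    · intro he hA
      rw [if_pos (hAd.2 hA)] at he
      omega
  -- On the axis `q` is `(-1, 0)`. The determinant with `(1, 0)` vanishes, so there is no closing
  -- edge, which the entry `0` expresses.
  · rw [if_pos (by omega), if_pos (by omega)]
    refine ⟨0, 0, N, ?_, by simp, ?_, hNn, hNm⟩
    · rw [main]
      intro w hw h1 h2
      have hb := abs_le.1 (hW w hw).1
      obtain rfl : q = (-1, 0) := by
        rw [hs, isCoprime_zero_right, Int.isUnit_iff] at hqc
        rcases hqc with h | h
        · exact absurd (Prod.ext h hs) hq0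
        · exact Prod.ext h hs
      exact resZero_eq h1 (by omega) (abs_le.2 (by omega)) _
    · intro _ hA
      have := hA.cross_pos
      omega
  -- Above the axis the determinant with `(1, 0)` is negative, and again there is no closing edge.
  · rw [if_neg (by omega)]
    rw [abs_of_pos hs] at hinv hqM
    have hy : enc q.2 - 1048576 = q.2.toNat := by omega
    have hyz : (q.2.toNat : ℤ) = q.2 := by omega
    rw [hy]
    obtain ⟨i1, i2⟩ := hinv _ hyz (by omega)
    set s := inv (enc q.1 + 1048576 * (q.2.toNat - 1)) q.2.toNat
    rw [hyz] at i2
    refine ⟨0, 0, N, ?_, by simp, ?_, hNn, hNm⟩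
    · rw [main]
      intro w hw h1 h2
      have := abs_le.1 (hW w hw).2
      exact resPos_eq hs (by omega) (by omega) i2 h1 (by omega) (abs_le.2 (by omega)) _
    · intro _ hA
      have := hA.cross_pos
      omega

end Prog
end LDP

namespace LDP
namespace Prog

/-! #### Packed lists -/

/-- A list of numbers packed into a single number. -/
def packN (l : List ℕ) : ℕ := l.foldl (fun P x => P * 2 ^ 48 + x) 0

theorem packN_concat (l : List ℕ) (x : ℕ) : packN (l ++ [x]) = packN l * 2 ^ 48 + x := by
  simp [packN]

theorem packN_append (l l' : List ℕ) :
    packN (l ++ l') = packN l * 2 ^ (48 * l'.length) + packN l' := by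
  induction l' using List.reverseRecOn with
  | nil => simp [packN]
  | append_singleton l' x ih =>
    rw [← List.append_assoc, packN_concat, packN_concat, ih, List.length_append, List.length_singleton,
      Nat.mul_add, pow_add]
    ring

theorem packN_lt {l : List ℕ} (h : ∀ x ∈ l, x < 2 ^ 48) : packN l < 2 ^ (48 * l.length) := by
  induction l using List.reverseRecOn with
  | nil => simp [packN]
  | append_singleton l x ih =>
    have h1 := ih fun x hx => h x (by simp [hx])
    have h2 := h x (by simp)
    rw [packN_concat, List.length_append, List.length_singleton, Nat.mul_add, pow_add, mul_one]
    have : (packN l + 1) * 2 ^ 48 ≤ 2 ^ (48 * l.length) * 2 ^ 48 := Nat.mul_le_mul_right _ h1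
    omega

theorem rot_packN {l : List ℕ} (h : ∀ x ∈ l, x < 2 ^ 48) {m : ℕ} (hm : m ≤ l.length) :
    rot (packN l) l.length m = packN (l.rotate m) := by
  have h1 : packN l = packN (l.take m) * 2 ^ (48 * (l.length - m)) + packN (l.drop m) := by
    rw [← List.length_drop, ← packN_append, List.take_append_drop]
  have h2 := packN_lt (l := l.drop m) fun x hx => h x (List.mem_of_mem_drop hx)
  rw [List.length_drop] at h2
  change (packN l % 1 <<< (48 * (l.length - m))) <<< (48 * m) + packN l >>> (48 * (l.length - m)) = _
  rw [List.rotate_eq_drop_append_take hm, packN_append, List.length_take, min_eq_left hm, Nat.one_shiftLeft,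
    Nat.shiftRight_eq_div_pow, Nat.shiftLeft_eq, h1, Nat.mul_comm (packN (l.take m)), Nat.mul_add_mod,
    Nat.mod_eq_of_lt h2, Nat.mul_add_div (by positivity), Nat.div_eq_of_lt h2]
  rw [add_zero]

/-- The packed list of `n` ones. -/
def ones : ℕ → ℕ
  | 0 => 0
  | n + 1 => ones n * 2 ^ 48 + 1

/-- The divisor is `2 ^ 48 - 1`, and the quotient is a geometric sum. -/
theorem ones_eq (n : ℕ) : (2 ^ (48 * n) - 1) / 281474976710655 = ones n := by
  have : 2 ^ (48 * n) - 1 = 281474976710655 * ones n := by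
    have h : 2 ^ (48 * n) = 281474976710655 * ones n + 1 := by
      induction n with
      | zero => rfl
      | succ n ih =>
        rw [Nat.mul_add, pow_add, ih, ones]; ring
    omega
  rw [this, Nat.mul_div_cancel_left _ (by norm_num)]

/-- Bounds for the coordinates of the vertices, which are invariant under reflection. -/
def Near (w : Pt) : Prop := |w.1| ≤ 200 ∧ |w.2| ≤ 200

theorem packN_fst {L : List Pt} (h : ∀ w ∈ L, Near w) :
    (packN (L.map fun w => enc w.1) : ℤ) = (packP L).1 + 1048576 * ones L.length ∧
    |(packP L).1| ≤ 200 * ones L.length := by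
  induction L using List.reverseRecOn with
  | nil => simp [packN, packP, ones]
  | append_singleton l w ih =>
    have h1 := ih fun x hx => h x (by simp [hx])
    have h2 := abs_le.1 (h w (by simp)).1
    have h3 := abs_le.1 h1.2
    have e := enc_cast (x := w.1) (by omega)
    rw [List.map_append, List.map_singleton, packN_concat, packP_concat, List.length_append,
      List.length_singleton, ones, abs_le]
    simp only [radix]
    refine ⟨by push_cast; rw [h1.1, e]; ring, by push_cast; constructor <;> omega⟩

theorem packN_snd {L : List Pt} (h : ∀ w ∈ L, Near w) :
    (packN (L.map fun w => enc w.2) : ℤ) = (packP L).2 + 1048576 * ones L.length ∧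
    |(packP L).2| ≤ 200 * ones L.length := by
  induction L using List.reverseRecOn with
  | nil => simp [packN, packP, ones]
  | append_singleton l w ih =>
    have h1 := ih fun x hx => h x (by simp [hx])
    have h2 := abs_le.1 (h w (by simp)).2
    have h3 := abs_le.1 h1.2
    have e := enc_cast (x := w.2) (by omega)
    rw [List.map_append, List.map_singleton, packN_concat, packP_concat, List.length_append,
      List.length_singleton, ones, abs_le]
    simp only [radix]
    refine ⟨by push_cast; rw [h1.1, e]; ring, by push_cast; constructor <;> omega⟩

/-- The natural subtractions are harmless: the two products are bounded by `40000 R`, far below the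
offset `2 ^ 41 R`. -/
theorem lin_eq {A B P Q R : ℕ} {x y p q : ℤ} (hA : (A : ℤ) = x + 1048576) (hB : (B : ℤ) = y + 1048576)
    (hP : (P : ℤ) = p + 1048576 * R) (hQ : (Q : ℤ) = q + 1048576 * R) (hx : |x| ≤ 200) (hy : |y| ≤ 200)
    (hp : |p| ≤ 200 * R) (hq : |q| ≤ 200 * R) :
    (lin A B P Q R : ℤ) = x * q - y * p + 2199023255552 * R := by
  have hx' := abs_le.1 hx
  have hy' := abs_le.1 hy
  have h1 : |x * q| ≤ 40000 * R := by
    rw [abs_mul]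
    calc |x| * |q| ≤ 200 * (200 * R) := mul_le_mul hx hq (abs_nonneg _) (by norm_num)
      _ = 40000 * R := by ring
  have h2 : |y * p| ≤ 40000 * R := by
    rw [abs_mul]
    calc |y| * |p| ≤ 200 * (200 * R) := mul_le_mul hy hp (abs_nonneg _) (by norm_num)
      _ = 40000 * R := by ring
  have h1' := abs_le.1 h1
  have h2' := abs_le.1 h2
  change ((A * Q + (2097152 - B) * P + 1048576 * (2097152 + B - A) * R - 1048576 * (P + Q) : ℕ) : ℤ) = _
  have hB2 : ((2097152 - B : ℕ) : ℤ) = 1048576 - y := by omega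
  have hBA : ((2097152 + B - A : ℕ) : ℤ) = 2097152 + y - x := by omega
  have key : ((A * Q + (2097152 - B) * P + 1048576 * (2097152 + B - A) * R : ℕ) : ℤ) =
      (1048576 * (P + Q) : ℕ) + (x * q - y * p + 2199023255552 * R) := by
    rw [Nat.cast_add, Nat.cast_add, Nat.cast_mul, Nat.cast_mul (2097152 - B), hB2, Nat.cast_mul, Nat.cast_mul _ (2097152 + B - A), hBA]
    push_cast
    rw [hA, hP, hQ]; ring
  omega

/-- All flags of a polygon have equally many vertices, so the offsets on both sides of each
comparison agree and cancel. For the second component the arguments are exchanged, which accounts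
for the sign of `key₂`. -/
theorem keyLE_iff {u v u' v' : Pt} {F L : List Pt} {b₁ b₂ : ℕ} (hu : Near u) (hv : Near v)
    (hF : ∀ w ∈ F, Near w) (h₁ : (b₁ : ℤ) = key₁ u' L + 2199023255552 * ones F.length)
    (h₂ : (b₂ : ℤ) = key₂ v' L + 2199023255552 * ones F.length) :
    keyLE (enc u.1) (enc u.2) (enc v.1) (enc v.2) (packN (F.map fun w => enc w.1))
      (packN (F.map fun w => enc w.2)) (ones F.length) b₁ b₂ = true ↔ SubLE u v F u' v' L := by
  have hu1 := abs_le.1 hu.1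
  have hu2 := abs_le.1 hu.2
  have hv1 := abs_le.1 hv.1
  have hv2 := abs_le.1 hv.2
  obtain ⟨p1, p2⟩ := packN_fst hF
  obtain ⟨q1, q2⟩ := packN_snd hF
  have e1 := lin_eq (enc_cast (x := u.1) (by omega)) (enc_cast (x := u.2) (by omega)) p1 q1 hu.1
    hu.2 p2 q2
  have e2 := lin_eq (enc_cast (x := v.2) (by omega)) (enc_cast (x := v.1) (by omega)) q1 p1 
    hv.2 hv.1 q2 p2
  unfold keyLE
  simp only [ifb_eq, ble_iff, beq_iff]
  have k1 : key₁ u F = u.1 * (packP F).2 - u.2 * (packP F).1 := rfl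
  have k2 : key₂ v F = v.2 * (packP F).1 - v.1 * (packP F).2 := by simp only [key₂, cross]; ring
  rw [SubLE, k1, k2]
  split_ifs with h3 h4
  · rw [ble_iff]
    constructor
    · intro h; right; constructor <;> omega
    · rintro (h | h) <;> omega
  · simp only [true_iff]; left; omega
  · simp only [false_iff]
    rintro (h | h) <;> omega

theorem check_iff {n P Q P' Q' R b₁ b₂ : ℕ} : ∀ {T : List Tie}, check n P Q P' Q' R b₁ b₂ T = true ↔
    ∀ j Xu Yu Xv Yv t, Tie.mk j Xu Yu Xv Yv t ∈ T →
      (Nat.land t 1 ≠ 0 → keyLE Xu Yu Xv Yv (rot P n (j - 1)) (rot Q n (j - 1)) R b₁ b₂ = true) ∧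
      (t / 2 ≠ 0 → keyLE Yv Xv Yu Xu (rot Q' n (if n - j = 0 then n - 1 else n - j - 1))
        (rot P' n (if n - j = 0 then n - 1 else n - j - 1)) R b₁ b₂ = true)
  | [] => by simp [check]
  | Tie.mk j Xu Yu Xv Yv t :: T => by
    have h : check n P Q P' Q' R b₁ b₂ (Tie.mk j Xu Yu Xv Yv t :: T) =
      ifb (ifz (Nat.land t 1) true (keyLE Xu Yu Xv Yv (rot P n (j - 1)) (rot Q n (j - 1)) R b₁ b₂))
      (ifb (ifz (t / 2) true
        (force (ifz (n - j) (n - 1) (n - j - 1)) fun i =>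
          keyLE Yv Xv Yu Xu (rot Q' n i) (rot P' n i) R b₁ b₂)) (check n P Q P' Q' R b₁ b₂ T) false) false := rfl
    rw [h]
    simp only [force_eq, ifb_eq, ifz_eq, List.mem_cons, Tie.mk.injEq, ne_eq]
    have ih := check_iff (n := n) (P := P) (Q := Q) (P' := P') (Q' := Q') (R := R) (b₁ := b₁) (b₂ := b₂) (T := T)
    constructor
    · intro h1 j' Xu' Yu' Xv' Yv' t' hm
      rcases hm with ⟨rfl, rfl, rfl, rfl, rfl, rfl⟩ | hm
      · constructor
        · intro h2; rw [if_neg h2] at h1; by_contra h3; rw [if_neg h3] at h1; exact absurd h1 (by simp)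
        · intro h2; by_contra h3; rw [if_neg h2, if_neg h3] at h1; simp at h1
      · refine ih.1 ?_ j' Xu' Yu' Xv' Yv' t' hm
        by_contra h3; rw [Bool.not_eq_true] at h3; rw [h3] at h1; simp at h1
    · intro h1
      have h2 := h1 j Xu Yu Xv Yv t (Or.inl ⟨rfl, rfl, rfl, rfl, rfl, rfl⟩)
      have h3 := ih.2 fun j' Xu' Yu' Xv' Yv' t' hm => h1 j' Xu' Yu' Xv' Yv' t' (Or.inr hm)
      rw [if_pos, if_pos]
      · exact h3
      · by_cases h4 : t / 2 = 0
        · rw [if_pos h4]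
        · rw [if_neg h4]; exact h2.2 h4
      · by_cases h4 : Nat.land t 1 = 0
        · rw [if_pos h4]
        · rw [if_neg h4]; exact h2.1 h4

/-! #### The comparison of flags -/

/-- The part of the tie code of the `j`-th edge that has to be checked. -/
def cellCode (d a : ℤ) (j : ℕ) (u v : Pt) : ℕ :=
  if j = 1 then tieCode d a u v / 2 * 2 else tieCode d a u v

/-- The entry of the list of ties for the `j`-th edge. -/
def cell (j : ℕ) (u v : Pt) (t : ℕ) : Tie := Tie.mk j (enc u.1) (enc u.2) (enc v.1) (enc v.2) t

/-- `T` lists the ties of the path `P`. -/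
def IsTieList (d a : ℤ) (P : List Pt) (T : List Tie) : Prop :=
  ∀ c, c ∈ T ↔ ∃ j u v, 0 < j ∧ P[j - 1]? = some u ∧ P[j]? = some v ∧ cellCode d a j u v ≠ 0 ∧
    c = cell j u v (cellCode d a j u v)

/-- The new edge leads from position `n - 1` to position `n`. The hypothesis `2 ≤ n` rules out the
first edge, whose tie code is treated differently. -/
theorem IsTieList.concat {d a : ℤ} {P : List Pt} {q w : Pt} {T : List Tie} {n t : ℕ}
    (h : IsTieList d a (P ++ [q]) T) (hn : P.length + 1 = n) (hn2 : 2 ≤ n) (ht : t = tieCode d a q w) :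
    IsTieList d a (P ++ [q] ++ [w])
      (ifz t T (Tie.mk n (enc q.1) (enc q.2) (enc w.1) (enc w.2) t :: T)) := by
  have hc : cellCode d a n q w = t := by rw [cellCode, if_neg (by omega), ht]
  intro c
  have e1 : ∀ j, 0 < j → j < n → (P ++ [q] ++ [w])[j - 1]? = (P ++ [q])[j - 1]? ∧
      (P ++ [q] ++ [w])[j]? = (P ++ [q])[j]? := by
    intro j hj hj2
    have hl : (P ++ [q]).length = n := by simp; omega
    exact ⟨List.getElem?_append_left (by omega), List.getElem?_append_left (by omega)⟩
  have e2 : (P ++ [q] ++ [w])[n - 1]? = some q := by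
    rw [List.getElem?_append_left (by simp; omega), ← hn]; simp
  have e3 : (P ++ [q] ++ [w])[n]? = some w := by rw [← hn]; simp
  have key : (∃ j u v, 0 < j ∧ (P ++ [q] ++ [w])[j - 1]? = some u ∧ (P ++ [q] ++ [w])[j]? = some v ∧
      cellCode d a j u v ≠ 0 ∧ c = cell j u v (cellCode d a j u v)) ↔
      c ∈ T ∨ (t ≠ 0 ∧ c = Tie.mk n (enc q.1) (enc q.2) (enc w.1) (enc w.2) t) := by
    rw [h c]
    constructor
    · rintro ⟨j, u, v, hj, h1, h2, h3, h4⟩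
      rcases lt_trichotomy j n with hjn | rfl | hjn
      · rw [(e1 j hj hjn).1] at h1
        rw [(e1 j hj hjn).2] at h2
        exact Or.inl ⟨j, u, v, hj, h1, h2, h3, h4⟩
      · rw [e2, Option.some_inj] at h1
        rw [e3, Option.some_inj] at h2
        subst h1 h2
        rw [hc] at h3 h4
        exact Or.inr ⟨h3, h4⟩
      · rw [List.getElem?_eq_none (by simp; omega)] at h2
        simp at h2
    · rintro (⟨j, u, v, hj, h1, h2, h3, h4⟩ | ⟨h1, h2⟩)
      · have hjn : j < n := by
          by_contra hc
          rw [List.getElem?_eq_none (by simp; omega)] at h2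
          simp at h2
        exact ⟨j, u, v, hj, (e1 j hj hjn).1.trans h1, (e1 j hj hjn).2.trans h2, h3, h4⟩
      · exact ⟨n, q, w, by omega, e2, e3, by rwa [hc], by rw [hc]; exact h2⟩
  rw [key, ifz_eq]
  split_ifs with h0
  · simp [h0]
  · simp [h0, or_comm]

theorem cell_ok_iff {d a : ℤ} {u v : Pt} {p q : Prop} :
    (Nat.land (tieCode d a u v) 1 ≠ 0 → p) ∧ (tieCode d a u v / 2 ≠ 0 → q) ↔
      (cross u v = d → res u v = a → p) ∧ (cross u v = d → res v.swap u.swap = a → q) := by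
  unfold tieCode
  by_cases h1 : cross u v = d <;> by_cases h2 : res u v = a <;> by_cases h3 : res v.swap u.swap = a <;>
    simp [h1, h2, h3]

theorem near_of_mem_mirror {L : List Pt} (hL : ∀ w ∈ L, Near w) : ∀ w ∈ mirror L, Near w := by
  intro w hw
  rw [mem_mirror] at hw
  exact (hL _ hw).symm

theorem map_rotate_fst (L : List Pt) (i : ℕ) : ((L.map fun w => enc w.1).rotate i) =
    (L.rotate i).map fun w => enc w.1 := (List.map_rotate _ _ _).symm

theorem map_rotate_snd (L : List Pt) (i : ℕ) : ((L.map fun w => enc w.2).rotate i) =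
    (L.rotate i).map fun w => enc w.2 := (List.map_rotate _ _ _).symm

theorem enc_lt {w : Pt} (hw : Near w) : enc w.1 < 2 ^ 48 ∧ enc w.2 < 2 ^ 48 := by
  have h1 := abs_le.1 hw.1
  have h2 := abs_le.1 hw.2
  unfold enc
  omega

/-- The specification of `leaf`. -/
theorem leaf_eq {d a B area : ℕ} {l : List Pt} {T : List Tie} {acc : ℕ} (ha : a < d) (hd : d ≤ 72)
    (hL : ∀ w ∈ ((1, 0) :: ((a : ℤ), (d : ℤ)) :: l : List Pt), Near w)
    (hT : ∀ c, c ∈ T ↔ ∃ j u v, 0 < j ∧ ((1, 0) :: ((a : ℤ), (d : ℤ)) :: l)[j - 1]? = some u ∧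
      ((1, 0) :: ((a : ℤ), (d : ℤ)) :: l ++ [(1, 0)])[j]? = some v ∧ cellCode d a j u v ≠ 0 ∧
      c = cell j u v (cellCode d a j u v)) :
    leaf d a B ((1, 0) :: ((a : ℤ), (d : ℤ)) :: l).length area T
      (packN (((1, 0) :: ((a : ℤ), (d : ℤ)) :: l).map fun w => enc w.1))
      (packN (((1, 0) :: ((a : ℤ), (d : ℤ)) :: l).map fun w => enc w.2))
      (packN (((1, 0) :: ((a : ℤ), (d : ℤ)) :: l).reverse.map fun w => enc w.1))
      (packN (((1, 0) :: ((a : ℤ), (d : ℤ)) :: l).reverse.map fun w => enc w.2)) acc =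
    acc + open Classical in if TiesOK d a ((1, 0) :: ((a : ℤ), (d : ℤ)) :: l) then
      weight B ((1, 0) :: ((a : ℤ), (d : ℤ)) :: l).length area else 0 := by
  have hn2 : 2 ≤ ((1, 0) :: ((a : ℤ), (d : ℤ)) :: l : List Pt).length := by simp
  have hL0 : ((1, 0) :: ((a : ℤ), (d : ℤ)) :: l : List Pt)[0]? = some ((1, 0) : Pt) := rfl
  have hL1 : ((1, 0) :: ((a : ℤ), (d : ℤ)) :: l : List Pt)[1]? = some ((a, d) : Pt) := rfl
  generalize ((1, 0) :: ((a : ℤ), (d : ℤ)) :: l : List Pt) = L at *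
  set n := L.length with hn
  set P := packN (L.map fun w => enc w.1) with hP
  set Q := packN (L.map fun w => enc w.2) with hQ
  set P' := packN (L.reverse.map fun w => enc w.1) with hP'
  set Q' := packN (L.reverse.map fun w => enc w.2) with hQ'
  set b₁ := lin 1048577 1048576 P Q (ones n) with hb₁
  set b₂ := lin (1048576 + d) (1048576 + a) Q P (ones n) with hb₂
  have hstep : leaf d a B n area T P Q P' Q' acc = ifb (List.rec true (fun _ _ _ =>
      force ((1 <<< (48 * n)).pred / 281474976710655) fun R =>
        check n P Q P' Q' R (lin 1048577 1048576 P Q R)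
          (lin (1048576 + d) (1048576 + a) Q P R) T) T) (acc + weight B n area) acc := rfl
  have hcheck : (List.rec true (fun _ _ _ =>
      force ((1 <<< (48 * n)).pred / 281474976710655) fun R =>
        check n P Q P' Q' R (lin 1048577 1048576 P Q R)
          (lin (1048576 + d) (1048576 + a) Q P R) T) T : Bool) = check n P Q P' Q' (ones n) b₁ b₂ T := by
    cases T with
    | nil => rfl
    | cons c T =>
      simp only [force_eq]
      rw [Nat.one_shiftLeft, Nat.pred_eq_sub_one, ones_eq]
  rw [hstep, hcheck, ifb_eq]
  obtain ⟨p1, p2⟩ := packN_fst hL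
  obtain ⟨q1, q2⟩ := packN_snd hL
  have hB1 : (b₁ : ℤ) = key₁ (1, 0) L + 2199023255552 * ones n := by
    rw [hb₁, lin_eq (x := 1) (y := 0) (by norm_num) (by norm_num) p1 q1 (by norm_num) (by norm_num) p2 q2]
    simp [key₁, cross]
    rfl
  have hB2 : (b₂ : ℤ) = key₂ (a, d) L + 2199023255552 * ones n := by
    rw [hb₂, lin_eq (x := d) (y := a) (by push_cast; ring) (by push_cast; ring) q1 p1
      (by rw [Nat.abs_cast]; omega) (by rw [Nat.abs_cast]; omega) q2 p2]
    simp [key₂, cross]; ring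
  have hml := length_mirror L
  have fwd : ∀ i ≤ n, ∀ u v, Near u → Near v →
      (keyLE (enc u.1) (enc u.2) (enc v.1) (enc v.2) (rot P n i) (rot Q n i) (ones n) b₁ b₂ = true ↔
        SubLE u v (L.rotate i) (1, 0) (a, d) L) := by
    intro i hi u v hu hv
    have r1 : rot P n i = packN ((L.rotate i).map fun w => enc w.1) := by
      rw [← map_rotate_fst, ← rot_packN, List.length_map]
      · intro x hx; obtain ⟨w, hw, rfl⟩ := List.mem_map.1 hx; exact (enc_lt (hL w hw)).1
      · rw [List.length_map]; exact hi
    have r2 : rot Q n i = packN ((L.rotate i).map fun w => enc w.2) := by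
      rw [← map_rotate_snd, ← rot_packN, List.length_map]
      · intro x hx; obtain ⟨w, hw, rfl⟩ := List.mem_map.1 hx; exact (enc_lt (hL w hw)).2
      · rw [List.length_map]; exact hi
    have hlen : (L.rotate i).length = n := List.length_rotate ..
    have := keyLE_iff (F := L.rotate i) hu hv (fun w hw => hL w (List.mem_rotate.1 hw)) (by rw [hlen]; exact hB1) (by rw [hlen]; exact hB2)
    rwa [hlen, ← r1, ← r2] at this
  have bwd : ∀ i ≤ n, ∀ u v, Near u → Near v →
      (keyLE (enc v.2) (enc v.1) (enc u.2) (enc u.1) (rot Q' n i) (rot P' n i) (ones n) b₁ b₂ = true ↔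
        SubLE v.swap u.swap ((mirror L).rotate i) (1, 0) (a, d) L) := by
    intro i hi u v hu hv
    have m1 : (mirror L).map (fun w => enc w.1) = L.reverse.map fun w => enc w.2 := by
      simp [mirror, Function.comp_def, List.map_reverse]
    have m2 : (mirror L).map (fun w => enc w.2) = L.reverse.map fun w => enc w.1 := by
      simp [mirror, Function.comp_def, List.map_reverse]
    have hML := near_of_mem_mirror hL
    have r1 : rot Q' n i = packN (((mirror L).rotate i).map fun w => enc w.1) := by
      rw [← map_rotate_fst, ← rot_packN, List.length_map, hml, m1]
      · intro x hx; obtain ⟨w, hw, rfl⟩ := List.mem_map.1 hx; exact (enc_lt (hML w hw)).1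
      · rw [List.length_map, hml]; exact hi
    have r2 : rot P' n i = packN (((mirror L).rotate i).map fun w => enc w.2) := by
      rw [← map_rotate_snd, ← rot_packN, List.length_map, hml, m2]
      · intro x hx; obtain ⟨w, hw, rfl⟩ := List.mem_map.1 hx; exact (enc_lt (hML w hw)).2
      · rw [List.length_map, hml]; exact hi
    have hlen : ((mirror L).rotate i).length = n := (List.length_rotate ..).trans hml
    have := keyLE_iff (u := v.swap) (v := u.swap) (F := (mirror L).rotate i) hv.symm hu.symm (fun w hw => hML w (List.mem_rotate.1 hw))
      (by rw [hlen]; exact hB1) (by rw [hlen]; exact hB2)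
    rwa [hlen, ← r1, ← r2] at this
  have hnext : ∀ j, 0 < j → ∀ hj : j ≤ n,
      (L ++ [(1, 0)])[j]? = some (L[j % n]'(Nat.mod_lt _ (by omega))) := by
    intro j hj0 hj
    rcases hj.lt_or_eq with h | h
    · rw [List.getElem?_append_left (by omega)]
      simp only [Nat.mod_eq_of_lt h]
      exact List.getElem?_eq_getElem h
    · subst h
      simp only [Nat.mod_self]
      rw [List.getElem?_append_right (by omega), ← hn, Nat.sub_self]
      rw [List.getElem?_eq_getElem (by omega), Option.some_inj] at hL0
      simp [hL0]
  have main : check n P Q P' Q' (ones n) b₁ b₂ T = true ↔ TiesOK d a L := by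
    rw [check_iff]
    have cellOK : ∀ j (h0 : 0 < j) (hj : j ≤ n), 
        (cellCode d a j (L[j - 1]) (L[j % n]'(Nat.mod_lt _ (by omega))) ≠ 0 →
        (Nat.land (cellCode d a j (L[j - 1]) (L[j % n]'(Nat.mod_lt _ (by omega)))) 1 ≠ 0 → 
          keyLE (enc L[j - 1].1) (enc L[j - 1].2) (enc (L[j % n]'(Nat.mod_lt _ (by omega))).1)
            (enc (L[j % n]'(Nat.mod_lt _ (by omega))).2) (rot P n (j - 1)) (rot Q n (j - 1)) (ones n) b₁ b₂ = true) ∧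
      (cellCode d a j (L[j - 1]) (L[j % n]'(Nat.mod_lt _ (by omega))) / 2 ≠ 0 → 
          keyLE (enc (L[j % n]'(Nat.mod_lt _ (by omega))).2)
            (enc (L[j % n]'(Nat.mod_lt _ (by omega))).1) (enc L[j - 1].2) (enc L[j - 1].1)
            (rot Q' n (if n - j = 0 then n - 1 else n - j - 1))
            (rot P' n (if n - j = 0 then n - 1 else n - j - 1)) (ones n) b₁ b₂ = true)) ↔
        TieOK d a L j (L[j - 1]) (L[j % n]'(Nat.mod_lt _ (by omega))) := by
      intro j h0 hj
      have n1 := hL _ (List.getElem_mem (l := L) (n := j - 1) (by omega))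
      have n2 := hL _ (List.getElem_mem (l := L) (n := j % n) (Nat.mod_lt _ (by omega)))
      rw [fwd (j - 1) (by omega) _ _ n1 n2, bwd _ (by split_ifs <;> omega) _ _ n1 n2]
      have hi : (if n - j = 0 then n - 1 else n - j - 1) = if j = L.length then L.length - 1 else L.length - 1 - j := by
        rw [← hn]; split_ifs <;> omega
      rw [hi, TieOK, ← cell_ok_iff]
      -- The forward flag of the first edge is the list itself, so its comparison holds trivially
      -- and may be dropped from the code.
      by_cases h1 : j = 1
      · have hlt : 1 % n = 1 := Nat.mod_eq_of_lt (by omega)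
        have hself : SubLE (L[j - 1]) (L[j % n]'(Nat.mod_lt _ (by omega))) (L.rotate (j - 1)) (1, 0) (a, d) L := by
          subst h1
          rw [List.getElem?_eq_getElem (by omega), Option.some_inj] at hL0 hL1
          simp only [hlt, Nat.sub_self, List.rotate_zero, hL0, hL1]
          exact Or.inr ⟨rfl, le_rfl⟩
        rw [cellCode, if_pos h1]
        have hland : ∀ c, Nat.land (c / 2 * 2) 1 = 0 := by
          intro c
          change (c / 2 * 2) &&& 1 = 0
          rw [Nat.and_one_is_mod]; omega
        constructor
        · intro h
          refine ⟨fun _ => hself, fun h' => (h ?_).2 ?_⟩ <;> omega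
        · intro h hne
          exact ⟨fun h' => absurd (hland _) h', fun h' => h.2 (by omega)⟩
      · rw [cellCode, if_neg h1]
        constructor
        · intro h
          refine ⟨fun h' => (h ?_).1 h', fun h' => (h ?_).2 h'⟩
          · intro h0; rw [h0] at h'; exact h' rfl
          · intro h0; rw [h0] at h'; exact h' rfl
        · exact fun h _ => h
    constructor
    · intro h j h0 hj
      rw [← cellOK j h0 hj]
      intro hc
      refine h j _ _ _ _ _ ((hT _).2 ⟨j, _, _, h0, List.getElem?_eq_getElem (by omega), hnext j h0 hj, hc, rfl⟩)
    · intro h j Xu Yu Xv Yv t hm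
      obtain ⟨j', u, v, h0, h1, h2, h3, h4⟩ := (hT _).1 hm
      have hj : j' ≤ n := by
        by_contra hc
        rw [List.getElem?_eq_none (by omega)] at h1
        simp at h1
      rw [hnext j' h0 hj, Option.some_inj] at h2
      rw [List.getElem?_eq_getElem (by omega), Option.some_inj] at h1
      rw [cell, Tie.mk.injEq] at h4
      obtain ⟨rfl, rfl, rfl, rfl, rfl, rfl⟩ := h4
      subst h1 h2
      exact (cellOK j h0 hj).2 (h j h0 hj) h3
  by_cases h : TiesOK d a L
  · rw [if_pos (main.2 h), if_pos h]
  · rw [if_neg (fun h' => h (main.1 h')), if_neg h, add_zero]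

end Prog
end LDP

namespace LDP
namespace Prog

/-! #### The depth first search -/

/-- The part of `dfs` that runs through the candidates for the next vertex. -/
def branch (ih : (n Xp Yp e Xq Yq area : ℕ) → List Tie → (P Q P' Q' : ℕ) → ℕ → ℕ)
    (n C A e₁ Xq Yq area : ℕ) (T : List Tie) (P Q P' Q' : ℕ) : List Ed → ℕ → ℕ
  | [], acc => acc
  | Ed.mk X Y e' t :: nb, acc =>
    if 524288 ≤ (A * X + C * Y + e₁) % 1048576 then branch ih n C A e₁ Xq Yq area T P Q P' Q' nb acc
    else branch ih n C A e₁ Xq Yq area T P Q P' Q' nb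
      (ih (n + 1) Xq Yq e' X Y (area + e') (ifz t T (Tie.mk n Xq Yq X Y t :: T)) (P <<< 48 + X)
        (Q <<< 48 + Y) (P' + X <<< (48 * n)) (Q' + Y <<< (48 * n)) acc)

theorem branch_eq (ih : (n Xp Yp e Xq Yq area : ℕ) → List Tie → (P Q P' Q' : ℕ) → ℕ → ℕ)
    (n C A e₁ Xq Yq area : ℕ) (T : List Tie) (P Q P' Q' : ℕ) : ∀ (nb : List Ed) (acc : ℕ),
    (List.rec (motive := fun _ => ℕ → ℕ) (fun acc => acc)
        (fun ed _ ihl acc => Ed.rec (fun X Y e' t =>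
          ifb (Nat.ble 524288 (Nat.mod (Nat.add (Nat.add (Nat.mul A X) (Nat.mul C Y)) e₁) 1048576))
            (ihl acc)
            (force (Nat.add area e') fun area =>
             force (ih (Nat.succ n) Xq Yq e' X Y area (ifz t T (List.cons (Tie.mk n Xq Yq X Y t) T))
               (Nat.add (Nat.shiftLeft P 48) X) (Nat.add (Nat.shiftLeft Q 48) Y)
               (Nat.add P' (Nat.shiftLeft X (Nat.mul 48 n)))
               (Nat.add Q' (Nat.shiftLeft Y (Nat.mul 48 n))) acc) fun acc => ihl acc)) ed)
        nb acc : ℕ) = branch ih n C A e₁ Xq Yq area T P Q P' Q' nb acc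
  | [], acc => rfl
  | Ed.mk X Y e' t :: nb, acc => by
    have h := branch_eq ih n C A e₁ Xq Yq area T P Q P' Q' nb
    simp only [force_eq, ifb_eq, ble_iff] at h ⊢
    rw [h, h]
    rfl

theorem dfs_succ {mask d a B fuel n Xp Yp e Xq Yq area P Q P' Q' acc X₀ Y₀ ec tc : ℕ} {W nb : List Ed}
    {T : List Tie} (h : nbr mask d a W Xq Yq = Ed.mk X₀ Y₀ ec tc :: nb) :
    dfs mask d a B W (fuel + 1) n Xp Yp e Xq Yq area T P Q P' Q' acc =
      branch (dfs mask d a B W fuel) n (Xq + 1048576 - Xp) (Yp + 1048576 - Yq) (e - 1) Xq Yq area T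
        P Q P' Q' nb (if ec = 0 then acc else if 524288 ≤ ((Yp + 1048576 - Yq) * 1048577 +
          (Xq + 1048576 - Xp) * 1048576 + (e - 1)) % 1048576 then acc else
            leaf d a B n (area + ec) (ifz tc T (Tie.mk n Xq Yq 1048577 1048576 tc :: T)) P Q P' Q' acc) := by
  have hstep : dfs mask d a B W (fuel + 1) n Xp Yp e Xq Yq area T P Q P' Q' acc =
     List.rec (motive := fun _ => ℕ) acc (fun ced nb _ => Ed.rec (motive := fun _ => ℕ) (fun _ _ ec tc =>
       force (Xq + 1048576 - Xp) fun C =>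
       force (Yp + 1048576 - Yq) fun A =>
       force (Nat.succ n) fun n' => force (e - 1) fun e₁ =>
       force (ifz ec acc (ifb (Nat.ble 524288 ((A * 1048577 + C * 1048576 + e₁) % 1048576)) acc
          (force (area + ec) fun area =>
            leaf d a B n area (ifz tc T (List.cons (Tie.mk n Xq Yq 1048577 1048576 tc) T))
              P Q P' Q' acc))) fun acc =>
       List.rec (motive := fun _ => ℕ → ℕ) (fun acc => acc)
        (fun ed _ ihl acc => Ed.rec (fun X Y e' t =>
          ifb (Nat.ble 524288 (Nat.mod (Nat.add (Nat.add (Nat.mul A X) (Nat.mul C Y)) e₁) 1048576))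
            (ihl acc)
            (force (Nat.add area e') fun area =>
             force (dfs mask d a B W fuel n' Xq Yq e' X Y area (ifz t T (List.cons (Tie.mk n Xq Yq X Y t) T))
               (Nat.add (Nat.shiftLeft P 48) X) (Nat.add (Nat.shiftLeft Q 48) Y)
               (Nat.add P' (Nat.shiftLeft X (Nat.mul 48 n)))
               (Nat.add Q' (Nat.shiftLeft Y (Nat.mul 48 n))) acc) fun acc => ihl acc)) ed)
        nb acc) ced) (nbr mask d a W Xq Yq) := rfl
  rw [hstep, h, ← branch_eq]
  simp only [force_eq, ifb_eq, ifz_eq, ble_iff]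

/-- The weight of a closed path. -/
def wt (B : ℕ) (F : List Pt) : ℕ := weight B F.length (area2 F).toNat

theorem pathSum_concat : ∀ (P : List Pt) (q w : Pt), pathSum (P ++ [q] ++ [w]) = pathSum (P ++ [q]) + cross q w
  | [], q, w => by simp [pathSum]
  | [p], q, w => by simp [pathSum]
  | p :: p' :: P, q, w => by
    have := pathSum_concat (p' :: P) q w
    simp only [List.cons_append, pathSum] at this ⊢
    rw [this]; ring

/-- The program computes `orient p q w - 1` modulo `2 ^ 20`. Through the shift by one, the value
zero of the orientation counts as negative and is rejected as well. -/
theorem Params.orient_test {p q w : Pt} (hp : Small p) (hq : Small q) (hw : Small w)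
    (h0 : 0 < cross p q) (h1 : cross p q ≤ 72) :
    524288 ≤ ((enc p.2 + 1048576 - enc q.2) * enc w.1 + (enc q.1 + 1048576 - enc p.1) * enc w.2 +
      ((cross p q).toNat - 1)) % 1048576 ↔ ¬ 0 < orient p q w := by
  have p1 := abs_le.1 hp.1
  have p2 := abs_le.1 hp.2
  have q1 := abs_le.1 hq.1
  have q2 := abs_le.1 hq.2
  have w1 := abs_le.1 hw.1
  have w2 := abs_le.1 hw.2
  have e1 := enc_cast (x := p.1) (by omega)
  have e2 := enc_cast (x := p.2) (by omega)
  have e3 := enc_cast (x := q.1) (by omega)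
  have e4 := enc_cast (x := q.2) (by omega)
  have e5 := enc_cast (x := w.1) (by omega)
  have e6 := enc_cast (x := w.2) (by omega)
  have hA : ((enc p.2 + 1048576 - enc q.2 : ℕ) : ℤ) = p.2 - q.2 + 1048576 := by omega
  have hC : ((enc q.1 + 1048576 - enc p.1 : ℕ) : ℤ) = q.1 - p.1 + 1048576 := by omega
  have hE : (((cross p q).toNat - 1 : ℕ) : ℤ) = cross p q - 1 := by omega
  have hor : orient p q w = cross p q + w.1 * (p.2 - q.2) + w.2 * (q.1 - p.1) := by
    unfold orient cross; ring
  have hmod := toNat_mod_eq (c := orient p q w - 1) (K := (enc p.2 + 1048576 - enc q.2) * enc w.1 +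
    (enc q.1 + 1048576 - enc p.1) * enc w.2 + ((cross p q).toNat - 1)) (by
      rw [Nat.cast_add, Nat.cast_add, Nat.cast_mul, Nat.cast_mul, hA, hC, hE, e5, e6, hor]
      refine ⟨p.2 - q.2 + 1048576 + w.1 + (q.1 - p.1) + 1048576 + w.2, ?_⟩
      ring)
  have b1 : |w.1 * (p.2 - q.2)| ≤ 200 * 144 := by
    rw [abs_mul]; exact mul_le_mul hw.1 (abs_le.2 (by omega)) (abs_nonneg _) (by norm_num)
  have b2 : |w.2 * (q.1 - p.1)| ≤ 72 * 400 := by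
    rw [abs_mul]; exact mul_le_mul hw.2 (abs_le.2 (by omega)) (abs_nonneg _) (by norm_num)
  rw [abs_le] at b1 b2
  omega

theorem small_one : Small (1, 0) := by simp [Small]

theorem Small.near {w : Pt} (h : Small w) : Near w := ⟨h.1, h.2.trans (by norm_num)⟩

/-- The contribution that marks an incomplete search. -/
def overflow : ℕ := Nat.shiftLeft 1 600

/-- The result of a part of the search: the contribution of the lists in `E`. -/
def Contributes (B : ℕ) (E : List (List Pt)) (b acc r : ℕ) : Prop :=
  r = acc + (E.map (wt B)).sum + b * overflow

/-- `E` lists the elements of `S` without repetitions. -/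
def Lists (S : List Pt → Prop) (E : List (List Pt)) : Prop := E.Nodup ∧ ∀ F, F ∈ E ↔ S F

theorem Lists.append {S S' : List Pt → Prop} {E E' : List (List Pt)} (h : Lists S E) (h' : Lists S' E')
    (hd : ∀ F, S F → ¬ S' F) : Lists (fun F => S F ∨ S' F) (E ++ E') := by
  refine ⟨List.nodup_append.2 ⟨h.1, h'.1, ?_⟩, fun F => ?_⟩
  · rintro F hF F' hF' rfl
    exact hd F ((h.2 F).1 hF) ((h'.2 F).1 hF')
  · rw [List.mem_append, h.2, h'.2]

theorem Contributes.append {B : ℕ} {E E' : List (List Pt)} {b b' acc r r' : ℕ}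
    (h : Contributes B E b acc r) (h' : Contributes B E' b' r r') :
    Contributes B (E ++ E') (b + b') acc r' := by
  unfold Contributes at *
  rw [h', h, List.map_append, List.sum_append]; ring

theorem Lists.congr {S S' : List Pt → Prop} {E : List (List Pt)} (h : Lists S E) (he : ∀ F, S F ↔ S' F) :
    Lists S' E := ⟨h.1, fun F => (h.2 F).trans (he F)⟩

theorem lists_nil {S : List Pt → Prop} (h : ∀ F, ¬ S F) : Lists S [] :=
  ⟨List.nodup_nil, fun F => by simpa using h F⟩

theorem contributes_nil (B acc : ℕ) : Contributes B [] 0 acc acc := by simp [Contributes]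

/-- The specification of `dfs`. -/
theorem Params.exists_dfs {k M m d a : ℕ} (h : Params k M m d a) {W : List Pt} (hWn : W.Nodup)
    (hWm : ∀ w, w ∈ W ↔ Cand k d a w) (B : ℕ) : ∀ (fuel : ℕ) {L l P₂ : List Pt} {p q : Pt} {T : List Tie}
    {area : ℕ} (acc : ℕ),
    L = (1, 0) :: ((a : ℤ), (d : ℤ)) :: l → L = P₂ ++ [p] ++ [q] → (∀ w ∈ L, Small w) → |q.2| ≤ M →
    IsCoprime q.1 q.2 → q ≠ (1, 0) → 0 < cross p q → cross p q ≤ d → (area : ℤ) = pathSum L →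
    IsTieList d a L T → ∃ E b,
    Contributes B E b acc (dfs (startMask m d a) d a B (W.map toEd) fuel L.length (enc p.1) (enc p.2)
      (cross p q).toNat (enc q.1) (enc q.2) area T (packN (L.map fun w => enc w.1))
      (packN (L.map fun w => enc w.2)) (packN (L.reverse.map fun w => enc w.1))
      (packN (L.reverse.map fun w => enc w.2)) acc) ∧
    (b = 0 → Lists (fun F => ∃ s, F = L ++ s ∧ Good k d a p q s ∧ TiesOK d a F) E)
  | 0, L, l, P₂, p, q, T, area, acc, _, _, _, _, _, _, _, _, _, _ => by
    refine ⟨[], 1, ?_, by simp⟩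
    change acc + overflow = _
    simp
  | fuel + 1, L, l, P₂, p, q, T, area, acc, hL, hL2, hS, hqM, hqc, hq0, hc0, hcd, har, hT => by
    classical
    have hM := h.le
    have hd := h.d_le
    have ha := h.a_lt
    have hp : Small p := hS p (by simp [hL2])
    have hq : Small q := hS q (by simp [hL2])
    have hn : (P₂ ++ [p]).length + 1 = L.length := by rw [hL2]; simp
    have hn2 : 2 ≤ L.length := by rw [hL]; simp
    obtain ⟨ec, tc, N, hnbr, hec1, hec0, hNn, hNm⟩ := h.exists_nbr hWn hWm hq hqM hqc hq0
    rw [dfs_succ hnbr]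
    set n := L.length with hnL
    set P := packN (L.map fun w => enc w.1) with hP
    set Q := packN (L.map fun w => enc w.2) with hQ
    set P' := packN (L.reverse.map fun w => enc w.1) with hP'
    set Q' := packN (L.reverse.map fun w => enc w.2) with hQ'
    -- An inner induction runs over the possible next vertices. The lists found for different next
    -- vertices are disjoint.
    have hbr : ∀ (N : List Pt) (acc : ℕ), N.Nodup →
        (∀ w ∈ N, Cand k d a w ∧ Adm k d a q w ∧ 0 < orient (1, 0) q w) → ∃ E b,
        Contributes B E b acc (branch (dfs (startMask m d a) d a B (W.map toEd) fuel) n (enc q.1 + 1048576 - enc p.1)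
          (enc p.2 + 1048576 - enc q.2) ((cross p q).toNat - 1) (enc q.1) (enc q.2) area T P Q P' Q'
          (N.map (edgeTo d a q)) acc) ∧
        (b = 0 → Lists (fun F => ∃ w ∈ N, 0 < orient p q w ∧ ∃ s, F = L ++ w :: s ∧ Good k d a q w s ∧ TiesOK d a F) E) := by
      intro N
      induction N with
      | nil => exact fun acc _ _ => ⟨[], 0, contributes_nil _ _, fun _ => lists_nil (by simp)⟩
      | cons w N ihN =>
        intro acc hnd hmem
        obtain ⟨hw1, hw2, hw3⟩ := hmem w (by simp)
        have hws := h.small_of_cand hw1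
        have ht := orient_test hp hq hws hc0 (by omega)
        rw [List.nodup_cons] at hnd
        have ihN' := fun acc => ihN acc hnd.2 fun w hw => hmem w (by simp [hw])
        rw [List.map_cons, edgeTo, branch]
        by_cases hor : 0 < orient p q w
        · rw [if_neg (fun h' => ht.1 h' hor)]
          have hLw : L ++ [w] = P₂ ++ [p] ++ [q] ++ [w] := by rw [hL2]
          have hwM : |w.2| ≤ M := by
            obtain ⟨-, rfl | ⟨⟨-, h3, -⟩, -⟩⟩ := hw1
            · simp
            · rw [h.bound]; exact h3
          have hw0 : w ≠ (1, 0) := by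
            rintro rfl
            have := hw1.1
            simp [orient, cross] at this
          have harea : ((area + (cross q w).toNat : ℕ) : ℤ) = pathSum (L ++ [w]) := by
            rw [hLw, pathSum_concat, ← hL2, ← har]
            have := hw2.cross_pos
            push_cast; omega
          have htie : IsTieList d a (L ++ [w]) (ifz (tieCode d a q w) T (Tie.mk n (enc q.1) (enc q.2) (enc w.1) (enc w.2) (tieCode d a q w) :: T)) := by
            rw [hL2]
            exact IsTieList.concat (by rw [← hL2]; exact hT) hn hn2 rfl
          have ih := exists_dfs h hWn hWm B fuel (L := L ++ [w]) (l := l ++ [w]) (P₂ := P₂ ++ [p]) (p := q) (q := w) acc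
            (by rw [hL]; simp) (by rw [hLw]) (by
              intro x hx
              rcases List.mem_append.1 hx with hx | hx
              · exact hS x hx
              · rw [List.mem_singleton.1 hx]; exact hws) hwM (isCoprime_of_cand hw1) hw0 hw2.cross_pos hw2.cross_le
            harea htie
          have k1 : packN ((L ++ [w]).map fun w => enc w.1) = P <<< 48 + enc w.1 := by
            rw [List.map_append, List.map_singleton, packN_concat, Nat.shiftLeft_eq]
          have k2 : packN ((L ++ [w]).map fun w => enc w.2) = Q <<< 48 + enc w.2 := by
            rw [List.map_append, List.map_singleton, packN_concat, Nat.shiftLeft_eq]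
          -- In the reversed list the new vertex comes first, so it is added at the top of the
          -- packed number.
          have hpk : ∀ x l, packN (x :: l) = packN l + x <<< (48 * l.length) := by
            intro x l
            have := packN_append [x] l
            rw [List.singleton_append] at this
            rw [this, Nat.shiftLeft_eq]; simp [packN, add_comm]
          have k3 : packN ((L ++ [w]).reverse.map fun w => enc w.1) = P' + enc w.1 <<< (48 * n) := by
            rw [List.reverse_append, List.reverse_singleton, List.singleton_append, List.map_cons, hpk]; simp [hP', hnL]
          have k4 : packN ((L ++ [w]).reverse.map fun w => enc w.2) = Q' + enc w.2 <<< (48 * n) := by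
            rw [List.reverse_append, List.reverse_singleton, List.singleton_append, List.map_cons, hpk]; simp [hQ', hnL]
          have hl : (L ++ [w]).length = n + 1 := by simp [hnL]
          rw [k1, k2, k3, k4, hl] at ih
          obtain ⟨E, b, hE, hb⟩ := ih
          obtain ⟨E', b', hE', hb'⟩ := ihN' _
          refine ⟨E ++ E', b + b', hE.append hE', fun h0 => ?_⟩
          -- No list occurs twice: the vertex after `L` is `w` in the first part and belongs to the
          -- remaining candidates in the second.
          refine ((hb (by omega)).append (hb' (by omega)) ?_).congr ?_
          · rintro F ⟨s, rfl, -⟩ ⟨w', hw', -, s', hs', -⟩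
            rw [List.append_assoc, List.append_cancel_left_eq] at hs'
            simp only [List.singleton_append, List.cons.injEq] at hs'
            exact hnd.1 (hs'.1 ▸ hw')
          · intro F
            simp only [List.mem_cons, exists_eq_or_imp, hor, true_and, List.append_assoc, List.singleton_append]
        · rw [if_pos (ht.2 hor)]
          obtain ⟨E, b, hE, hb⟩ := ihN' acc
          refine ⟨E, b, hE, fun h0 => (hb h0).congr fun F => ?_⟩
          simp only [List.mem_cons, exists_eq_or_imp, hor, false_and, false_or]
    have hleaf : ∃ E, Contributes B E 0 acc (if ec = 0 then acc else if 524288 ≤ ((enc p.2 + 1048576 - enc q.2) * 1048577 +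
          (enc q.1 + 1048576 - enc p.1) * 1048576 + ((cross p q).toNat - 1)) % 1048576 then acc else
            leaf d a B n (area + ec) (ifz tc T (Tie.mk n (enc q.1) (enc q.2) 1048577 1048576 tc :: T)) P Q P' Q' acc) ∧
        Lists (fun F => F = L ∧ Closing k d a p q ∧ TiesOK d a F) E := by
      have ht := orient_test hp hq small_one hc0 (by omega)
      change 524288 ≤ ((enc p.2 + 1048576 - enc q.2) * 1048577 + (enc q.1 + 1048576 - enc p.1) * 1048576 +
        ((cross p q).toNat - 1)) % 1048576 ↔ _ at ht
      by_cases h0 : ec = 0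
      · rw [if_pos h0]
        exact ⟨[], contributes_nil _ _, lists_nil fun F hF => hec0 h0 hF.2.1.1⟩
      rw [if_neg h0]
      obtain ⟨hA, hecz, rfl⟩ := hec1 h0
      by_cases hor : 0 < orient p q (1, 0)
      · rw [if_neg (fun h' => ht.1 h' hor)]
        have htie : IsTieList d a (L ++ [(1, 0)]) (ifz (tieCode d a q (1, 0)) T (Tie.mk n (enc q.1) (enc q.2) 1048577 1048576 (tieCode d a q (1, 0)) :: T)) := by
          rw [hL2]
          exact IsTieList.concat (by rw [← hL2]; exact hT) hn hn2 rfl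
        have hlf := leaf_eq (B := B) (area := area + ec) (acc := acc) (l := l) ha (by omega)
          (fun w hw => (hS w (by rw [hL]; exact hw)).near) 
          (T := ifz (tieCode d a q (1, 0)) T (Tie.mk n (enc q.1) (enc q.2) 1048577 1048576 (tieCode d a q (1, 0)) :: T)) (by
            intro c
            rw [htie c, ← hL]
            refine exists_congr fun j => exists_congr fun u => exists_congr fun v => and_congr_right fun hj => ?_
            by_cases hjn : j - 1 < n
            · rw [List.getElem?_append_left (by omega)]
            · rw [List.getElem?_eq_none (l := L ++ [(1, 0)]) (i := j) (by simp; omega)]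
              simp)
        rw [← hL] at hlf
        rw [hlf]
        have harea : (area2 L).toNat = area + ec := by
          have : area2 L = pathSum (L ++ [(1, 0)]) := by rw [hL]; rfl
          rw [this, hL2, pathSum_concat, ← hL2, ← har]; omega
        by_cases hTo : TiesOK d a L
        · rw [if_pos hTo]
          refine ⟨[L], by simp [Contributes, wt, harea], by simp, fun F => ?_⟩
          rw [List.mem_singleton]
          exact ⟨fun h => ⟨h, ⟨hA, hor⟩, h ▸ hTo⟩, fun h => h.1⟩
        · rw [if_neg hTo]
          refine ⟨[], contributes_nil _ _, lists_nil ?_⟩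
          rintro F ⟨rfl, -, h⟩
          exact hTo h
      · rw [if_pos (ht.2 hor)]
        exact ⟨[], contributes_nil _ _, lists_nil fun F hF => hor hF.2.1.2⟩
    obtain ⟨E, hE, hE'⟩ := hleaf
    obtain ⟨E', b', hb, hb'⟩ := hbr N _ hNn fun w hw => (hNm w).1 hw
    refine ⟨E ++ E', b', by simpa using hE.append hb, fun h0 => (hE'.append (hb' h0) ?_).congr ?_⟩
    · rintro F ⟨rfl, -⟩ ⟨w, -, -, s, hs, -⟩
      simp at hs
    · intro F
      constructor
      · rintro (⟨rfl, h1, h2⟩ | ⟨w, hw, h1, s, h2, h3, h4⟩)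
        · exact ⟨[], by simp, h1, h2⟩
        · obtain ⟨c1, c2, c3⟩ := (hNm w).1 hw
          exact ⟨w :: s, h2, ⟨c1, ⟨c2, c3, h1⟩, h3⟩, h4⟩
      · rintro ⟨_ | ⟨w, s⟩, h1, h2, h3⟩
        · exact Or.inl ⟨by simpa using h1, h2, h3⟩
        · exact Or.inr ⟨w, (hNm w).2 ⟨h2.1, h2.2.1.1, h2.2.1.2.1⟩, h2.2.1.2.2, s, h1, h2.2.2, h3⟩

end Prog
end LDP

/-! ### The search over all first edges -/

namespace LDP
namespace Prog

theorem res_one {a d : ℕ} (h : a < d) : cross (1, 0) ((a : ℤ), (d : ℤ)) = d ∧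
    res (1, 0) ((a : ℤ), (d : ℤ)) = a :=
  ⟨by simp [cross], res_one_zero (by positivity) (by exact_mod_cast h)⟩

theorem Params.exists_start {k M m d a : ℕ} (h : Params k M m d a) (B fuel acc : ℕ) : ∃ E b,
    Contributes B E b acc (start m B M fuel d a acc) ∧
    (b = 0 → Lists (fun F => ∃ l, F = (1, 0) :: ((a : ℤ), (d : ℤ)) :: l ∧
      Good k d a (1, 0) (a, d) l ∧ TiesOK d a F) E) := by
  have hM := h.le
  have hd := h.d_le
  have ha := h.a_lt
  obtain ⟨W, hW, hWn, hWm⟩ := h.exists_rows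
  obtain ⟨hc, hr⟩ := res_one ha
  have o1 : enc 1 = 1048577 := enc_sub 1048577
  have o2 : enc 0 = 1048576 := enc_sub 1048576
  have e1 : enc (a : ℤ) = 1048576 + a := by unfold enc; omega
  have e2 : enc (d : ℤ) = 1048576 + d := by unfold enc; omega
  have hstep : start m B M fuel d a acc =
    force (startMask m d a) fun mask =>
    force (1048576 + a) fun X => force (1048576 + d) fun Y =>
    dfs mask d a B (rows m M d a) fuel 2 1048577 1048576 d X Y d
     (ifb (Nat.beq (a * a % d) (1 % d)) [Tie.mk 1 1048577 1048576 X Y 2] [])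
     (1048577 <<< 48 + X) (1048576 <<< 48 + Y) (1048577 + X <<< 48) (1048576 + Y <<< 48) acc := rfl
  rw [hstep, hW]
  clear hstep
  simp only [force_eq, ifb_eq, beq_iff]
  have htie := h.tie_eq (u := (1, 0)) (v := (a, d)) (al := a) (e := d) isCoprime_one_left h.coprime
    (by omega) hr.symm hc.symm
  have htie2 : tie d a a d = 1 + if a * a % d = 1 % d then 2 else 0 := by
    change ifb (Nat.beq d d) (ifb (Nat.beq a a) 1 0 + ifb (Nat.beq (a * a % d) (1 % d)) 2 0) 0 = _
    simp only [ifb_eq, beq_iff, if_true]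
  rw [htie2] at htie
  have hcode : cellCode d a 1 (1, 0) ((a : ℤ), (d : ℤ)) = if a * a % d = 1 % d then 2 else 0 := by
    rw [cellCode, if_pos rfl, ← htie]
    split_ifs <;> rfl
  have hT : IsTieList d a [(1, 0), ((a : ℤ), (d : ℤ))]
      (if a * a % d = 1 % d then [Tie.mk 1 1048577 1048576 (1048576 + a) (1048576 + d) 2] else []) := by
    intro c
    constructor
    · intro hm
      split_ifs at hm with h0
      · rw [List.mem_singleton] at hm
        rw [if_pos h0] at hcode
        refine ⟨1, (1, 0), (a, d), one_pos, rfl, rfl, by rw [hcode]; norm_num, ?_⟩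
        rw [hm, hcode, cell, e1, e2, o1, o2]
      · simp at hm
    · rintro ⟨j, u, v, hj, h1, h2, h3, h4⟩
      obtain rfl : j = 1 := by
        by_contra hne
        rw [List.getElem?_eq_none (by simp; omega)] at h2
        simp at h2
      simp at h1 h2
      subst h1 h2
      rw [hcode] at h3 h4
      split_ifs at h3 h4 ⊢ with h0
      · rw [h4, cell, e1, e2, o1, o2]; exact List.mem_singleton_self _
      · exact absurd rfl h3
  have hsm : Small ((a : ℤ), (d : ℤ)) := ⟨by rw [Nat.abs_cast]; omega, by rw [Nat.abs_cast]; omega⟩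
  have main := h.exists_dfs hWn hWm B fuel (L := [(1, 0), ((a : ℤ), (d : ℤ))]) (l := []) (P₂ := [])
    (p := (1, 0)) (q := (a, d)) (area := d) acc rfl rfl (by
      intro w hw
      rcases List.mem_cons.1 hw with rfl | hw
      · exact small_one
      · rw [List.mem_singleton.1 hw]; exact hsm) (by rw [Nat.abs_cast]; exact_mod_cast hd) h.coprime
    (by intro h'; have := congrArg Prod.snd h'; simp at this; omega) (by omega) (by omega)
    (by simp [pathSum, cross]) hT
  have k1 : ∀ x y, packN [x, y] = x <<< 48 + y := fun x y => by
    simp only [packN, List.foldl_cons, List.foldl_nil, Nat.shiftLeft_eq, zero_mul, zero_add]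
  have k2 : ∀ x y, packN [y, x] = x + y <<< 48 := fun x y => by
    simp only [packN, List.foldl_cons, List.foldl_nil, Nat.shiftLeft_eq, zero_mul, zero_add]; exact add_comm _ _
  simp only [hc, Int.toNat_natCast, e1, e2, o1, o2, List.map_cons, List.map_nil, List.reverse_cons, List.reverse_nil,
    List.nil_append, List.singleton_append, List.length_cons, List.length_nil, zero_add, Nat.reduceAdd] at main
  rw [k1, k1, k2, k2] at main
  obtain ⟨E, b, hE, hb⟩ := main
  exact ⟨E, b, hE, fun h0 => (hb h0).congr fun F => by simp⟩

/-- The parameters of the search for a fixed bound. -/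
structure Setup (k M : ℕ) : Prop where
  k_pos : 0 < k
  le : M ≤ 72
  bound : (M : ℤ) = bound k

/-- Compared with itself, the first edge imposes only one condition: the residue of its reversal
does not exceed `a`. -/
theorem Setup.adm_start {k M : ℕ} (h : Setup k M) {d a : ℕ} (hd : d ≤ M) (ha : a < d) :
    (mask k M).testBit (80 * d + a) = true ∧ inv a d ≤ a ↔ Adm k d a (1, 0) ((a : ℤ), (d : ℤ)) := by
  have hM := h.le
  obtain ⟨hc, hr⟩ := res_one ha
  rw [mask_iff h.k_pos (by omega) hd ha, Adm, hc, hr]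
  apply and_congr_right
  intro hok
  have hsw : 0 < cross (Prod.swap ((a : ℤ), (d : ℤ))) (Prod.swap ((1 : ℤ), (0 : ℤ))) := by
    rw [cross_swap, hc]; omega
  have := inv_eq (al := a) (e := d) (res_nonneg hsw) (by
    have := res_lt hsw
    rwa [cross_swap, hc] at this) (by
    have := res_swap_mul (u := (1, 0)) (v := ((a : ℤ), (d : ℤ))) isCoprime_one_left hok.2.2.1
    rwa [hc, hr] at this)
  rw [← this]
  simp

theorem Setup.params {k M : ℕ} (h : Setup k M) {d a : ℕ} (hd : d ≤ M) (ha : a < d)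
    (hc : IsCoprime (a : ℤ) d) : Params k M (mask k M) d a :=
  ⟨h.k_pos, h.le, h.bound, rfl, hd, ha, hc⟩

theorem Setup.exists_run {k M : ℕ} (h : Setup k M) {d : ℕ} (hd : d ≤ M) (B fuel : ℕ) :
    ∀ (n acc : ℕ), n ≤ d → ∃ E b, Contributes B E b acc (run (mask k M) B M fuel d n acc) ∧
    (b = 0 → Lists (fun F => ∃ a < n, ∃ l, F = (1, 0) :: ((a : ℤ), (d : ℤ)) :: l ∧ Canon k F) E)
  | 0, acc, _ => ⟨[], 0, contributes_nil _ _, fun _ => lists_nil (by simp)⟩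
  | a + 1, acc, ha => by
    have ih := fun acc => h.exists_run hd B fuel a acc (by omega)
    have hstep : run (mask k M) B M fuel d (a + 1) acc =
      force a (fun a' => bit (mask k M) (80 * d + a') (ifb (Nat.ble (inv a' d) a')
        (force (start (mask k M) B M fuel d a' acc) fun acc => run (mask k M) B M fuel d a acc)
        (run (mask k M) B M fuel d a acc)) (run (mask k M) B M fuel d a acc)) := rfl
    have hadm := h.adm_start hd (show a < d by omega)
    have hcan : ∀ l, Canon k ((1, 0) :: ((a : ℤ), (d : ℤ)) :: l) ↔ _ :=
      fun l => canon_iff_good h.k_pos (by positivity) (by exact_mod_cast (show a < d by omega))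
    rw [hstep]
    simp only [force_eq, bit_eq, ifb_eq, ble_iff]
    by_cases hA : Adm k d a (1, 0) ((a : ℤ), (d : ℤ))
    · have h1 := hadm.2 hA
      rw [if_pos h1.1, if_pos h1.2]
      have hco : IsCoprime (a : ℤ) d := by
        have := hA.1.2.2.1
        obtain ⟨hc, hr⟩ := res_one (show a < d by omega)
        rwa [hc, hr] at this
      obtain ⟨E, b, hE, hb⟩ := (h.params hd (show a < d by omega) hco).exists_start B fuel acc
      obtain ⟨E', b', hE', hb'⟩ := ih (start (mask k M) B M fuel d a acc)
      refine ⟨E ++ E', b + b', hE.append hE', fun h0 => ((hb (by omega)).append (hb' (by omega)) ?_).congr ?_⟩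
      · rintro F ⟨l, rfl, -⟩ ⟨a', ha', l', hl', -⟩
        simp at hl'
        omega
      · intro F
        constructor
        · rintro (⟨l, rfl, h1, h2⟩ | ⟨a', ha', h1⟩)
          · exact ⟨a, by omega, l, rfl, (hcan l).2 ⟨hA, h1, h2⟩⟩
          · exact ⟨a', by omega, h1⟩
        · rintro ⟨a', ha', l, rfl, hcl⟩
          by_cases haa : a' = a
          · subst haa
            exact Or.inl ⟨l, rfl, ((hcan l).1 hcl).2⟩
          · exact Or.inr ⟨a', by omega, l, rfl, hcl⟩
    -- If the first edge is not admissible with respect to itself, no canonical list starts with it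
    -- and the program skips it.
    · have hif : ∀ x y : ℕ, (if (mask k M).testBit (80 * d + a) = true then if inv a d ≤ a then x else y else y) = y := by
        intro x y
        split_ifs with h1 h2
        · exact absurd (hadm.1 ⟨h1, h2⟩) hA
        · rfl
        · rfl
      rw [hif]
      obtain ⟨E, b, hE, hb⟩ := ih acc
      refine ⟨E, b, hE, fun h0 => (hb h0).congr fun F => ?_⟩
      constructor
      · rintro ⟨a', ha', h1⟩; exact ⟨a', by omega, h1⟩
      · rintro ⟨a', ha', l, rfl, h1⟩
        by_cases haa : a' = a
        · subst haa
          exact absurd ((hcan l).1 h1).1 hA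
        · exact ⟨a', by omega, l, rfl, h1⟩

/-- The canonical lists whose first edge has determinant in `[d, d + n)`. -/
def Segment (k d n : ℕ) (F : List Pt) : Prop :=
  ∃ d', d ≤ d' ∧ d' < d + n ∧ ∃ a < d', ∃ l, F = (1, 0) :: ((a : ℤ), (d' : ℤ)) :: l ∧ Canon k F

theorem Setup.exists_runs {k M : ℕ} (h : Setup k M) (B fuel : ℕ) :
    ∀ (n d acc : ℕ), d + n ≤ M + 1 → ∃ E b, Contributes B E b acc (runs (mask k M) B M fuel n d acc) ∧
    (b = 0 → Lists (Segment k d n) E)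
  | 0, d, acc, _ => ⟨[], 0, contributes_nil _ _, fun _ => lists_nil (by rintro F ⟨d', h1, h2, -⟩; omega)⟩
  | n + 1, d, acc, hn => by
    have hstep : runs (mask k M) B M fuel (n + 1) d acc = force d fun d =>
      force (run (mask k M) B M fuel d d acc) fun acc => runs (mask k M) B M fuel n (d + 1) acc := rfl
    rw [hstep, force_eq, force_eq]
    obtain ⟨E, b, hE, hb⟩ := h.exists_run (show d ≤ M by omega) B fuel d acc le_rfl
    obtain ⟨E', b', hE', hb'⟩ := h.exists_runs B fuel n (d + 1) (run (mask k M) B M fuel d d acc) (by omega)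
    refine ⟨E ++ E', b + b', hE.append hE', fun h0 => ((hb (by omega)).append (hb' (by omega)) ?_).congr ?_⟩
    · rintro F ⟨a, ha, l, rfl, -⟩ ⟨d', h1, h2, a', ha', l', hl', -⟩
      simp at hl'
      omega
    · intro F
      constructor
      · rintro (h1 | ⟨d', h1, h2, h3⟩)
        · exact ⟨d, le_rfl, by omega, h1⟩
        · exact ⟨d', by omega, by omega, h3⟩
      · rintro ⟨d', h1, h2, h3⟩
        by_cases hdd : d' = d
        · subst hdd; exact Or.inl h3
        · exact Or.inr ⟨d', by omega, by omega, h3⟩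

/-- The lists in a segment have the total weight `S`. -/
def Total (k B d n S : ℕ) : Prop := ∃ E, Lists (Segment k d n) E ∧ (E.map (wt B)).sum = S

/-- Each incomplete branch adds `overflow`, so a result below `overflow` proves that no branch ran
out of fuel. -/
theorem Setup.total {k M m : ℕ} (h : Setup k M) {B fuel n d S : ℕ} (hm : mask k M = m) (hd : d + n ≤ M + 1)
    
    (hr : Nat.beq (force m fun m => force B fun B => runs m B M fuel n d 0) S = true) (hS : Nat.blt S overflow = true) : Total k B d n S := by
  subst hm
  obtain ⟨E, b, hE, hb⟩ := h.exists_runs B fuel n d 0 hd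
  rw [force_eq, force_eq, beq_iff] at hr
  have hS' : S < overflow := by simpa [Nat.blt] using hS
  rw [hr, Contributes] at hE
  have : b = 0 := by
    by_contra h0
    have : 1 * overflow ≤ b * overflow := Nat.mul_le_mul_right _ (by omega)
    omega
  refine ⟨E, hb this, ?_⟩
  rw [this] at hE; omega

theorem Total.append {k B d n n' S S' : ℕ} (h : Total k B d n S) (h' : Total k B (d + n) n' S') :
    Total k B d (n + n') (S + S') := by
  obtain ⟨E, hE, hs⟩ := h
  obtain ⟨E', hE', hs'⟩ := h'
  refine ⟨E ++ E', (hE.append hE' ?_).congr ?_, by rw [List.map_append, List.sum_append, hs, hs']⟩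
  · rintro F ⟨d', h1, h2, a, ha, l, rfl, -⟩ ⟨d'', h1', h2', a', ha', l', hl', -⟩
    simp at hl'
    omega
  · intro F
    constructor
    · rintro (⟨d', h1, h2, h3⟩ | ⟨d', h1, h2, h3⟩)
      · exact ⟨d', by omega, by omega, h3⟩
      · exact ⟨d', by omega, by omega, h3⟩
    · rintro ⟨d', h1, h2, h3⟩
      by_cases hdd : d' < d + n
      · exact Or.inl ⟨d', h1, hdd, h3⟩
      · exact Or.inr ⟨d', by omega, by omega, h3⟩

theorem Setup.det_le {k M : ℕ} (h : Setup k M) {d a : ℤ} {l : List Pt}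
    (hL : IsCycle k ((1, 0) :: (a, d) :: l)) : d ≤ M := by
  have h1 := cross_le h.k_pos hL (v := (1, 0)) (w := (a, d)) (by simp) (by simp)
  have h2 := h.bound
  simp only [cross] at h1
  rw [h2, LDP.bound]; linarith

/-- The entries of the first edge are at most `M`, and all other vertices are candidates, so 47 bits
are ample. -/
theorem Setup.bounded {k M : ℕ} (h : Setup k M) : Bounded k := by
  rintro L hL ⟨a, d, l, rfl, h0, h1⟩ p hp
  have hd := h.det_le hL
  have hM := h.le
  lift a to ℕ using h0
  lift d to ℕ using by omega
  have hP := h.params (by exact_mod_cast hd) (by exact_mod_cast h1) (hL.prim (a, d) (by simp))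
  simp only [List.mem_cons] at hp
  rcases hp with rfl | rfl | hp
  · simp
  · simp only [Nat.abs_cast]; constructor <;> norm_cast <;> omega
  · have := hP.small_of_cand (hL.cand h.k_pos hp)
    exact ⟨this.1.trans_lt (by norm_num), this.2.trans_lt (by norm_num)⟩

theorem Setup.exists_enumerates {k M B S : ℕ} (h : Setup k M) (hT : Total k B 1 M S) :
    ∃ E, Enumerates k E ∧ (E.map (wt B)).sum = S := by
  obtain ⟨E, hE, hs⟩ := hT
  refine ⟨E, ⟨h.k_pos, h.bounded, hE.1, fun L => (hE.2 L).trans ?_⟩, hs⟩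
  constructor
  · rintro ⟨d, -, -, a, -, l, -, hc⟩; exact hc
  · intro hc
    obtain ⟨a, d, l, rfl, h0, h1⟩ := hc.normalized
    have hd := h.det_le hc.isCycle
    lift a to ℕ using h0
    lift d to ℕ using by omega
    exact ⟨d, by omega, by omega, a, by omega, l, rfl, hc⟩

end Prog
end LDP

namespace LDP
namespace Prog

/-! ### Reading off the numbers from the result of the search -/

theorem digit_eq {b : ℕ} : ∀ (N : ℕ) (c : ℕ → ℕ), (∀ i, c i < b) → ∀ j < N,
    (∑ i ∈ Finset.range N, c i * b ^ i) / b ^ j % b = c j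
  | 0, _, _, j, hj => by omega
  | N + 1, c, hc, j, hj => by
    have hb : 0 < b := (Nat.zero_le _).trans_lt (hc 0)
    have h : ∑ i ∈ Finset.range (N + 1), c i * b ^ i =
        c 0 + b * ∑ i ∈ Finset.range N, c (i + 1) * b ^ i := by
      rw [Finset.sum_range_succ', Finset.mul_sum, add_comm]
      simp only [pow_zero, mul_one, pow_succ]
      congr 1
      exact Finset.sum_congr rfl fun i _ => by ring
    rw [h]
    cases j with
    | zero => rw [pow_zero, Nat.div_one, Nat.add_mul_mod_self_left, Nat.mod_eq_of_lt (hc 0)]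
    | succ j =>
      rw [pow_succ', ← Nat.div_div_eq_div_mul, Nat.add_mul_div_left _ _ hb, Nat.div_eq_of_lt (hc 0), zero_add]
      exact digit_eq N (fun i => c (i + 1)) (fun i => hc _) j (by omega)

theorem sum_map_ite {α : Type*} (P : α → Prop) [DecidablePred P] (E : List α) :
    (E.map fun F => if P F then 1 else 0).sum = (E.filter fun F => P F).length := by
  induction E with
  | nil => rfl
  | cons F E ih =>
    rw [List.map_cons, List.sum_cons, List.filter_cons, ih]
    by_cases h : P F <;> simp [h, add_comm]

theorem sum_map_sum {α : Type*} (f : α → ℕ → ℕ) (N : ℕ) (E : List α) :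
    (E.map fun F => ∑ i ∈ Finset.range N, f F i).sum = ∑ i ∈ Finset.range N, (E.map fun F => f F i).sum := by
  induction E with
  | nil => simp
  | cons F E ih => simp only [List.map_cons, List.sum_cons, ih, Finset.sum_add_distrib]

/-- The bound for the area of polygons with `n` vertices. -/
def areaBound (B n : ℕ) : ℕ := B / 256 ^ n % 256

/-- The digits of the weight of a polygon. -/
def digit (B n area i : ℕ) : ℕ :=
  if i = 0 ∨ i = n ∨ (i = n + 12 ∧ area = areaBound B n) ∨ i = 25 then 1 else 0

theorem weight_eq (B n area : ℕ) : weight B n area = if area ≤ areaBound B n then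
    65536 ^ n + (if area = areaBound B n then 65536 ^ (n + 12) else 0) + (1 + 65536 ^ 25) else overflow := by
  have hb : Nat.land (Nat.shiftRight B (8 * n)) 255 = areaBound B n := by
    change (B >>> (8 * n)) &&& 255 = _
    rw [Nat.shiftRight_eq_div_pow, pow_mul, areaBound]
    exact Nat.and_two_pow_sub_one_eq_mod _ 8
  have hs : ∀ n, Nat.shiftLeft 1 (16 * n) = 65536 ^ n := by
    intro n
    change 1 <<< (16 * n) = _
    rw [Nat.one_shiftLeft, pow_mul]; norm_num
  have hstep : weight B n area = force (Nat.land (Nat.shiftRight B (8 * n)) 255) fun bd =>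
    ifb (Nat.ble area bd) (Nat.shiftLeft 1 (16 * n) + ifb (Nat.beq area bd) (Nat.shiftLeft 1 (16 * (12 + n))) 0 +
      (1 + Nat.shiftLeft 1 (16 * 25))) overflow := rfl
  rw [hstep, force_eq, hb]
  simp only [ifb_eq, beq_iff, ble_iff, hs, add_comm n 12]

theorem weight_eq_sum {B n area : ℕ} (h0 : 0 < n) (h1 : n ≤ 12) (h : area ≤ areaBound B n) :
    weight B n area = ∑ i ∈ Finset.range 26, digit B n area i * 65536 ^ i := by
  have hd : ∀ i, digit B n area i * 65536 ^ i = (if i = 0 then 65536 ^ 0 else 0) + (if i = n then 65536 ^ n else 0) +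
      (if i = n + 12 then if area = areaBound B n then 65536 ^ (n + 12) else 0 else 0) +
      (if i = 25 then 65536 ^ 25 else 0) := by
    intro i
    unfold digit
    by_cases i0 : i = 0
    · subst i0; rw [if_neg (show ¬ 0 = n by omega), if_neg (show ¬ 0 = n + 12 by omega)]; simp
    by_cases i1 : i = n
    · subst i1
      rw [if_neg i0, if_neg (show ¬ i = i + 12 by omega), if_neg (show ¬ i = 25 by omega), if_pos rfl, if_pos (by simp)]
      simp
    by_cases i2 : i = 25
    · subst i2; rw [if_neg i0, if_neg i1, if_neg (show ¬ 25 = n + 12 by omega), if_pos rfl, if_pos (by simp)]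
      simp only [one_mul, zero_add]
    rw [if_neg i0, if_neg i1, if_neg i2]
    by_cases i3 : i = n + 12
    · subst i3
      by_cases i4 : area = areaBound B n
      · simp [i4]
      · simp [i4, i2]
    · simp [i0, i1, i2, i3]
  simp only [hd, Finset.sum_add_distrib, Finset.sum_ite_eq', Finset.mem_range]
  have a1 : n < 26 := by omega
  have a2 : n + 12 < 26 := by omega
  have a3 : 0 < 26 := by norm_num
  have a4 : 25 < 26 := by norm_num
  rw [weight_eq, if_pos h, if_pos a1, if_pos a2, if_pos a3, if_pos a4]
  ring

theorem pow_le_overflow : 65536 ^ 26 ≤ overflow := by decide +kernel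

/-- The numbers that can be read off from a result of the search. -/
structure Reading (E : List (List Pt)) (B S : ℕ) : Prop where
  area_le : ∀ L ∈ E, area2 L ≤ areaBound B L.length
  area_pos : ∀ L ∈ E, 0 < areaBound B L.length
  length_le : ∀ L ∈ E, L.length ≤ 12
  total : E.length = S % 65536
  count : ∀ n, 3 ≤ n → n ≤ 12 → (E.filter fun L => L.length = n).length = S / 65536 ^ n % 65536
  hits : ∀ n, 3 ≤ n → n ≤ 12 →
    (E.filter fun L => L.length = n ∧ (area2 L).toNat = areaBound B n).length = S / 65536 ^ (n + 12) % 65536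

/-- The result is read in base 65536. The weight of a polygon has digits 0 and 1 only, so the digits
of the sum are counts, provided that no carry occurs. -/
theorem reading {k B S : ℕ} {E : List (List Pt)} (hE : Enumerates k E) (hsum : (E.map (wt B)).sum = S)
    (hB : Nat.blt B (256 ^ 13) = true) (hS : Nat.blt S (65536 ^ 26) = true) : Reading E B S := by
  have hS' : S < 65536 ^ 26 := by simpa [Nat.blt, Nat.succ_le_iff] using hS
  have hB' : B < 256 ^ 13 := by simpa [Nat.blt, Nat.succ_le_iff] using hB
  have hcyc : ∀ L ∈ E, IsCycle k L := fun L hL => ((hE.mem L).1 hL).isCycle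
  have hge : ∀ L ∈ E, 3 ≤ L.length := fun L hL => (hcyc L hL).three
  have hpos : ∀ L ∈ E, 0 < area2 L := fun L hL => (volume_hull (hcyc L hL).three (hcyc L hL).triple).1
  have hle : ∀ L ∈ E, (area2 L).toNat ≤ areaBound B L.length := by
    intro L hL
    -- A polygon with larger area would have the weight `overflow`, which exceeds the whole sum `S`.
    by_contra hc
    have h1 : wt B L ≤ S := by
      rw [← hsum]; exact List.single_le_sum (fun _ _ => Nat.zero_le _) _ (List.mem_map_of_mem hL)
    rw [wt, weight_eq, if_neg hc] at h1
    exact absurd (hS'.trans_le (pow_le_overflow.trans h1)) (lt_irrefl _)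
  have hbp : ∀ L ∈ E, 0 < areaBound B L.length := fun L hL => by
    have := hle L hL
    have := hpos L hL
    omega
  -- Since `B` has only 13 digits in base 256, the area bound for longer lists is zero, whereas
  -- areas are positive.
  have hlen : ∀ L ∈ E, L.length ≤ 12 := by
    intro L hL
    by_contra hc
    have h1 := hbp L hL
    have h2 : (256 : ℕ) ^ 13 ≤ 256 ^ L.length := Nat.pow_le_pow_right (by norm_num) (by omega)
    rw [areaBound, Nat.div_eq_of_lt (hB'.trans_le h2)] at h1
    simp at h1
  set c : ℕ → ℕ := fun i => (E.map fun L => digit B L.length (area2 L).toNat i).sum with hc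
  have hcS : S = ∑ i ∈ Finset.range 26, c i * 65536 ^ i := by
    have h1 : ∀ i, c i * 65536 ^ i = (E.map fun L => digit B L.length (area2 L).toNat i * 65536 ^ i).sum := by
      intro i; rw [hc, List.sum_map_mul_right]
    rw [Finset.sum_congr rfl fun i _ => h1 i,
      ← sum_map_sum (fun L i => digit B L.length (area2 L).toNat i * 65536 ^ i), ← hsum]
    refine congrArg List.sum (List.map_congr_left fun L hL => ?_)
    exact weight_eq_sum (by have := hge L hL; omega) (hlen L hL) (hle L hL)
  have hcE : ∀ i, c i ≤ E.length := by
    intro i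
    have := List.sum_le_card_nsmul (E.map fun L => digit B L.length (area2 L).toNat i) 1 (by
      intro x hx
      obtain ⟨L, -, rfl⟩ := List.mem_map.1 hx
      unfold digit; split_ifs <;> omega)
    simpa using this
  have hcP : ∀ (i : ℕ) (P : List Pt → Prop) [DecidablePred P],
      (∀ L ∈ E, digit B L.length (area2 L).toNat i = if P L then 1 else 0) → c i = (E.filter fun L => P L).length := by
    intro i P _ h
    rw [← sum_map_ite, hc]
    exact congrArg _ (List.map_congr_left h)
  have hall : ∀ i, (∀ L ∈ E, digit B L.length (area2 L).toNat i = 1) → c i = E.length := by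
    intro i h
    rw [hcP i (fun _ => True) (by simpa using h)]
    simp
  have h25 := hall 25 fun L _ => by simp [digit]
  have h0 := hall 0 fun L _ => by simp [digit]
  -- The top digit 25 counts every polygon, like the digit 0. From `S < 65536 ^ 26` it follows that
  -- there are fewer than 65536 polygons, so no digit of the sum carries over.
  have hEl : E.length < 65536 := by
    have h1 : c 25 * 65536 ^ 25 ≤ S := by
      rw [hcS]
      exact Finset.single_le_sum (f := fun i => c i * 65536 ^ i) (fun _ _ => Nat.zero_le _) (Finset.mem_range.2 (by norm_num))
    rw [h25] at h1
    have h2 : E.length * 65536 ^ 25 < 65536 * 65536 ^ 25 := by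
      rw [← pow_succ']; exact h1.trans_lt hS'
    exact Nat.lt_of_mul_lt_mul_right h2
  have hdig : ∀ j < 26, S / 65536 ^ j % 65536 = c j := by
    intro j hj
    rw [hcS]
    exact digit_eq 26 c (fun i => (hcE i).trans_lt hEl) j hj
  refine ⟨fun L hL => ?_, hbp, hlen, ?_, fun n h1 h2 => ?_, fun n h1 h2 => ?_⟩
  · have := hle L hL; omega
  · rw [← h0, ← hdig 0 (by norm_num), pow_zero, Nat.div_one]
  · rw [hdig n (by omega)]
    refine (hcP n _ fun L hL => ?_).symm
    have := hge L hL
    have := hlen L hL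
    unfold digit
    congr 1
    apply propext
    omega
  · rw [hdig (n + 12) (by omega)]
    refine (hcP (n + 12) _ fun L hL => ?_).symm
    have := hge L hL
    have := hlen L hL
    unfold digit
    congr 1
    apply propext
    constructor
    · rintro (h | h | ⟨h, h'⟩ | h)
      · omega
      · omega
      · have hn : L.length = n := by omega
        exact ⟨hn, by rw [← hn]; exact h'⟩
      · omega
    · rintro ⟨h, h'⟩
      exact Or.inr (Or.inr (Or.inl ⟨by omega, by rw [h]; exact h'⟩))

/-- A column of the table. -/
theorem Reading.tableColumn {k B S : ℕ} {E : List (List Pt)} (hE : Enumerates k E) (h : Reading E B S) (n N m : ℕ)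
    (V : ENNReal) (h3 : 3 ≤ n) (h12 : n ≤ 12) (hN : S / 65536 ^ n % 65536 = N)
    (hm : areaBound B n = m) (hhit : S / 65536 ^ (n + 12) % 65536 ≠ 0) (hV : V = ENNReal.ofReal ((m : ℤ) / 2)) :
    TableColumn k n N V := by
  constructor
  · rw [hE.classCount_with, h.count n h3 h12, hN]
  · rw [hV]
    apply hE.maxVolume_with
    · rw [← h.hits n h3 h12] at hhit
      obtain ⟨L, hL⟩ := List.exists_mem_of_length_pos (Nat.pos_of_ne_zero hhit)
      simp only [List.mem_filter, decide_eq_true_eq] at hL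
      have := h.area_pos L hL.1
      exact ⟨L, hL.1, hL.2.1, by rw [← hm]; rw [hL.2.1] at this; omega⟩
    · intro L hL hn
      have := h.area_le L hL
      rwa [hn, hm] at this

theorem Reading.exists_hit {B S : ℕ} {E : List (List Pt)} (h : Reading E B S) (n : ℕ) (h3 : 3 ≤ n)
    (h12 : n ≤ 12) (hhit : S / 65536 ^ (n + 12) % 65536 ≠ 0) :
    ∃ L ∈ E, L.length = n ∧ area2 L = areaBound B n := by
  rw [← h.hits n h3 h12] at hhit
  obtain ⟨L, hL⟩ := List.exists_mem_of_length_pos (Nat.pos_of_ne_zero hhit)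
  simp only [List.mem_filter, decide_eq_true_eq] at hL
  have := h.area_pos L hL.1
  exact ⟨L, hL.1, hL.2.1, by rw [hL.2.1] at this; omega⟩

/-- A zero entry in the list of area bounds excludes polygons with that number of vertices, because
areas are positive. -/
theorem Reading.maxVertices {k B S : ℕ} {E : List (List Pt)} (hE : Enumerates k E) (h : Reading E B S) (n : ℕ)
    (h3 : 3 ≤ n) (h12 : n ≤ 12) (hhit : S / 65536 ^ (n + 12) % 65536 ≠ 0)
    (hz : ∀ i < 13, n < i → areaBound B i = 0) : MaxVertices (hollowLDP k) n := by
  apply hE.maxVertices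
  · obtain ⟨L, hL, hn, -⟩ := h.exists_hit n h3 h12 hhit
    exact ⟨L, hL, hn⟩
  · intro L hL
    by_contra hc
    have h1 := hz L.length (by have := h.length_le L hL; omega) (by omega)
    have h2 := h.area_pos L hL
    omega

theorem Reading.maxVolume {k B S : ℕ} {E : List (List Pt)} (hE : Enumerates k E) (h : Reading E B S) (n m : ℕ)
    (V : ENNReal) (h3 : 3 ≤ n) (h12 : n ≤ 12) (hm : areaBound B n = m)
    (hhit : S / 65536 ^ (n + 12) % 65536 ≠ 0) (hz : ∀ i < 13, areaBound B i ≤ m)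
    (hV : V = ENNReal.ofReal ((m : ℤ) / 2)) : MaxVolume (hollowLDP k) V := by
  rw [hV]
  apply hE.maxVolume_all
  · obtain ⟨L, hL, hn, ha⟩ := h.exists_hit n h3 h12 hhit
    exact ⟨L, hL, by rw [ha, hm]⟩
  · intro L hL
    have h1 := h.area_le L hL
    have h2 := hz L.length (by have := h.length_le L hL; omega)
    omega

end Prog
end LDP

namespace LDP
namespace Prog

/-! ### The results of the search -/

/-- The types of the edges of almost `1`-hollow polygons. -/
def types_one : ℕ :=
  4271974071841820164790046946033233785974068211311230029005776676448640573673555728912267798904832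

/-- The maximal areas of almost `1`-hollow polygons. -/
def areas_one : ℕ := 9 * 256 ^ 3 + 8 * 256 ^ 4 + 7 * 256 ^ 5 + 6 * 256 ^ 6

theorem setup_one : Setup 1 4 := ⟨by norm_num, by norm_num, by norm_num [LDP.bound]⟩

theorem mask_one : mask 1 4 = types_one := Nat.eq_of_beq_eq_true (by decide +kernel)

theorem total_one : Total 1 areas_one 1 4
    41315998049390537434494706752048190486606117877000420436553246231016284738331240438192887328208307575653631778360888655888 :=
  -- The fuel limits the length of the paths. If it were too small, the result would contain an
  -- overflow mark and the last check would fail.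
  setup_one.total (fuel := 7) mask_one (by norm_num) (by decide +kernel) (by decide +kernel)

/-- The result of the search for `k = 1`. -/
def result_one : ℕ :=
  41315998049390537434494706752048190486606117877000420436553246231016284738331240438192887328208307575653631778360888655888

/-- The types of the edges of almost `2`-hollow polygons. -/
def types_two : ℕ :=
  778193563611386224676420385370187210776254815585924023543313969144807202388565932663789898898842068042880645965779972290031678715948608019324119975340162241671771972939491080855457227863777787276081823624442029240026234269852697016798658527719939875486840835201809066215277511651160105549803963725348372075982004129950012601229772678628557790066930023919820688026024739115665877606069907943803781439874914209659803582213563014843400294953170110856897599097577342168084120161506406115708381299429916963067506337791134057972379331445676327235447324958100395788396656080140602838089728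

/-- The maximal areas of almost `2`-hollow polygons. -/
def areas_two : ℕ := 32 * 256 ^ 3 + 32 * 256 ^ 4 + 34 * 256 ^ 5 + 33 * 256 ^ 6 + 28 * 256 ^ 7 + 28 * 256 ^ 8

theorem setup_two : Setup 2 24 := ⟨by norm_num, by norm_num, by norm_num [LDP.bound]⟩

theorem mask_two : mask 2 24 = types_two := Nat.eq_of_beq_eq_true (by decide +kernel)

theorem total_two : Total 2 areas_two 1 24
    1304036188433888837776239183997540625530363684858684808748628531656245302764205917392751544151434794649295291390056053342713 :=
  setup_two.total (fuel := 9) mask_two (by norm_num) (by decide +kernel) (by decide +kernel)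

/-- The result of the search for `k = 2`. -/
def result_two : ℕ :=
  1304036188433888837776239183997540625530363684858684808748628531656245302764205917392751544151434794649295291390056053342713

/-- The types of the edges of almost `3`-hollow polygons. -/
def types_three : ℕ :=
  4823373066056405016973491569170345506069944872057715753192936195718354804270227710825645866797038432985799000267789644060269274712030286250938803061641410846035220896146496145927445716327690748031494963227456175587377019652383959894161690355375086150893592713645280099804051360818886816571024590024279140334563727032296214049651746247367181317934614403966763251432321338064398991429203377267082228066537975059903060826561280173766020597798697067198854870351993089853888213308510071945429117005449086642522253718828781972151553214810360966976495171619702242057781629286772843764832929983992428590883980510658750078805715945818315508763132314277747715339281093427580007764211893349562494197252409690337653891350073651228514717318328483233771800769070454016951164950825207556543516171482894808193910708212698761656454770403378915334636459869189847990133811825903239802222292498661599107927880738473089395627626644427234423184046849738701445210006312481338533067913729716095329888901581948664778392364210805384055002496728431545640438725239677075321331313227846498027823174635001206181225841187341258695340478450712506256376300876985505755487386765009622502263479637357256931824654803947454449372969483882107100488900495981949637916843625538782720896159555454712105136439095649264299130270444057176416478221350244355119776208465413020007590597065681721583808138562853582661520345067610180440750148323559064996308380565939427666590500069784205113029876055037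21180419145213507664172344527967492682795331071476163883817384125137132636359226218496835564255582294404910235355200612667945569283564617369282610167569838423922058033416114811467212125121146786283322899509236925472711113066375882255380067396374271032754813387851723842143644337906584908868878336

/-- The maximal areas of almost `3`-hollow polygons. -/
def areas_three : ℕ := 88 * 256 ^ 3 + 91 * 256 ^ 4 + 94 * 256 ^ 5 + 86 * 256 ^ 6 + 78 * 256 ^ 7 + 70 * 256 ^ 8 + 60 * 256 ^ 9 + 58 * 256 ^ 10 + 47 * 256 ^ 11 + 48 * 256 ^ 12

theorem setup_three : Setup 3 72 := ⟨by norm_num, by norm_num, by norm_num [LDP.bound]⟩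

theorem mask_three : mask 3 72 = types_three := Nat.eq_of_beq_eq_true (by decide +kernel)

/-- For `k = 3` the search is divided, according to the determinant of the first edge, into ten
separate kernel computations, which are added up in `total_three`. -/
theorem total_three_1 : Total 3 areas_three 1 7
    5964997257783366265400842600912337236878012256794253759836790311450367675125772705398349267063638463340328789728151115663622 :=
  setup_three.total (fuel := 13) mask_three (by norm_num) (by decide +kernel) (by decide +kernel)

theorem total_three_8 : Total 3 areas_three 8 3
    15550308765839363526907945253802137507213488284417583994266230645087779979802958013193796642843732943401325811329400731342726 :=
  setup_three.total (fuel := 13) mask_three (by norm_num) (by decide +kernel) (by decide +kernel)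

theorem total_three_11 : Total 3 areas_three 11 1
    16642600464270125860332399063559411530054953834784345540193599552904473923908773705894201112408889377798380805305190370515245 :=
  setup_three.total (fuel := 13) mask_three (by norm_num) (by decide +kernel) (by decide +kernel)

theorem total_three_12 : Total 3 areas_three 12 1
    9624045295629908322821745202061897414833256911225399323273509981343695347813285365889287468396719353486384031507685421616783 :=
  setup_three.total (fuel := 13) mask_three (by norm_num) (by decide +kernel) (by decide +kernel)

theorem total_three_13 : Total 3 areas_three 13 2
    17252011435498636287491195988152122332396764401892042289221635161048066762694516289014681175903128623370727619237695918709273 :=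
  setup_three.total (fuel := 13) mask_three (by norm_num) (by decide +kernel) (by decide +kernel)

theorem total_three_15 : Total 3 areas_three 15 2
    7553080893404207624743563578108809732414389444025478775029678617881394294399260516620363534505176324281034401141075853970285 :=
  setup_three.total (fuel := 13) mask_three (by norm_num) (by decide +kernel) (by decide +kernel)

theorem total_three_17 : Total 3 areas_three 17 3
    27464809703332359759580356313424034295370750812531621282466892916166328107771122990767478447746011346279626178729794015865228 :=
  setup_three.total (fuel := 13) mask_three (by norm_num) (by decide +kernel) (by decide +kernel)

theorem total_three_20 : Total 3 areas_three 20 5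
    10455529756373892879516816727440195079160978755165526003451339734633082221546190019381022873977498201106926840006213504077777 :=
  setup_three.total (fuel := 13) mask_three (by norm_num) (by decide +kernel) (by decide +kernel)

theorem total_three_25 : Total 3 areas_three 25 10
    9673108043313559576851073220459269517159987982333292985233202064203970514431739885038882859260143710509684985808828223196834 :=
  setup_three.total (fuel := 13) mask_three (by norm_num) (by decide +kernel) (by decide +kernel)

theorem total_three_35 : Total 3 areas_three 35 38
    3850134568227580707176975485456555890771488102148860245041870949952875029293537555422039150782036063373446007092735863948755 :=
  setup_three.total (fuel := 13) mask_three (by norm_num) (by decide +kernel) (by decide +kernel)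

/-- The result of the search for `k = 3`. -/
def result_three : ℕ :=
  5964997257783366265400842600912337236878012256794253759836790311450367675125772705398349267063638463340328789728151115663622 +
  15550308765839363526907945253802137507213488284417583994266230645087779979802958013193796642843732943401325811329400731342726 +
  16642600464270125860332399063559411530054953834784345540193599552904473923908773705894201112408889377798380805305190370515245 +
  9624045295629908322821745202061897414833256911225399323273509981343695347813285365889287468396719353486384031507685421616783 +
  17252011435498636287491195988152122332396764401892042289221635161048066762694516289014681175903128623370727619237695918709273 +
  7553080893404207624743563578108809732414389444025478775029678617881394294399260516620363534505176324281034401141075853970285 +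
  27464809703332359759580356313424034295370750812531621282466892916166328107771122990767478447746011346279626178729794015865228 +
  10455529756373892879516816727440195079160978755165526003451339734633082221546190019381022873977498201106926840006213504077777 +
  9673108043313559576851073220459269517159987982333292985233202064203970514431739885038882859260143710509684985808828223196834 +
  3850134568227580707176975485456555890771488102148860245041870949952875029293537555422039150782036063373446007092735863948755

theorem total_three : Total 3 areas_three 1 72 result_three :=
  ((((((((total_three_1.append total_three_8).append total_three_11).append total_three_12).append total_three_13).append total_three_15).append total_three_17).append total_three_20).append total_three_25).append total_three_35

end Prog
end LDP

/-! ### The tables for k = 1, 2, 3 -/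

namespace LDP
namespace Prog

theorem eq_ofReal_half {V : ENNReal} {m : ℕ} (h : V * 2 = m) : V = ENNReal.ofReal ((m : ℤ) / 2) := by
  rw [ENNReal.ofReal_div_of_pos (by norm_num), Int.cast_natCast, ENNReal.ofReal_natCast, ENNReal.ofReal_ofNat,
    ← h, ENNReal.mul_div_cancel_right (by norm_num) (by norm_num)]

theorem div_two_mul_two (m : ℕ) : (m : ENNReal) / 2 * 2 = m :=
  ENNReal.div_mul_cancel (by norm_num) (by norm_num)

theorem table_one : classCount (hollowLDP 1) = 16 ∧
    MaxVertices (hollowLDP 1) 6 ∧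
    MaxVolume (hollowLDP 1) (9 / 2) ∧
    TableColumn 1 3 5 (9 / 2) ∧
    TableColumn 1 4 7 4 ∧
    TableColumn 1 5 3 (7 / 2) ∧
    TableColumn 1 6 1 3 := by
  obtain ⟨E, hE, hs⟩ := setup_one.exists_enumerates (S := result_one) total_one
  have h := reading hE hs (by decide +kernel) (by decide +kernel)
  have hT : E.length = 16 := h.total.trans (by decide +kernel)
  exact ⟨by rw [hE.classCount_all, hT]; rfl,
    h.maxVertices hE 6 (by norm_num) (by norm_num) (by decide +kernel) (by decide +kernel),
    h.maxVolume hE 3 9 _ (by norm_num) (by norm_num) (by decide +kernel) (by decide +kernel) (by decide +kernel)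
      (eq_ofReal_half (div_two_mul_two 9)),
    h.tableColumn hE 3 5 9 _ (by norm_num) (by norm_num) (by decide +kernel) (by decide +kernel)
      (by decide +kernel) (eq_ofReal_half (div_two_mul_two 9)),
    h.tableColumn hE 4 7 8 _ (by norm_num) (by norm_num) (by decide +kernel) (by decide +kernel)
      (by decide +kernel) (eq_ofReal_half (by norm_num)),
    h.tableColumn hE 5 3 7 _ (by norm_num) (by norm_num) (by decide +kernel) (by decide +kernel)
      (by decide +kernel) (eq_ofReal_half (div_two_mul_two 7)),
    h.tableColumn hE 6 1 6 _ (by norm_num) (by norm_num) (by decide +kernel) (by decide +kernel)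
      (by decide +kernel) (eq_ofReal_half (by norm_num))⟩

theorem table_two : classCount (hollowLDP 2) = 505 ∧
    MaxVertices (hollowLDP 2) 8 ∧
    MaxVolume (hollowLDP 2) 17 ∧
    TableColumn 2 3 42 16 ∧
    TableColumn 2 4 181 16 ∧
    TableColumn 2 5 202 17 ∧
    TableColumn 2 6 74 (33 / 2) ∧
    TableColumn 2 7 5 14 ∧
    TableColumn 2 8 1 14 := by
  obtain ⟨E, hE, hs⟩ := setup_two.exists_enumerates (S := result_two) total_two
  have h := reading hE hs (by decide +kernel) (by decide +kernel)
  have hT : E.length = 505 := h.total.trans (by decide +kernel)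
  exact ⟨by rw [hE.classCount_all, hT]; rfl,
    h.maxVertices hE 8 (by norm_num) (by norm_num) (by decide +kernel) (by decide +kernel),
    h.maxVolume hE 5 34 _ (by norm_num) (by norm_num) (by decide +kernel) (by decide +kernel) (by decide +kernel)
      (eq_ofReal_half (by norm_num)),
    h.tableColumn hE 3 42 32 _ (by norm_num) (by norm_num) (by decide +kernel) (by decide +kernel)
      (by decide +kernel) (eq_ofReal_half (by norm_num)),
    h.tableColumn hE 4 181 32 _ (by norm_num) (by norm_num) (by decide +kernel) (by decide +kernel)
      (by decide +kernel) (eq_ofReal_half (by norm_num)),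
    h.tableColumn hE 5 202 34 _ (by norm_num) (by norm_num) (by decide +kernel) (by decide +kernel)
      (by decide +kernel) (eq_ofReal_half (by norm_num)),
    h.tableColumn hE 6 74 33 _ (by norm_num) (by norm_num) (by decide +kernel) (by decide +kernel)
      (by decide +kernel) (eq_ofReal_half (div_two_mul_two 33)),
    h.tableColumn hE 7 5 28 _ (by norm_num) (by norm_num) (by decide +kernel) (by decide +kernel)
      (by decide +kernel) (eq_ofReal_half (by norm_num)),
    h.tableColumn hE 8 1 28 _ (by norm_num) (by norm_num) (by decide +kernel) (by decide +kernel)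
      (by decide +kernel) (eq_ofReal_half (by norm_num))⟩

theorem table_three : classCount (hollowLDP 3) = 48032 ∧
    MaxVertices (hollowLDP 3) 12 ∧
    MaxVolume (hollowLDP 3) 47 ∧
    TableColumn 3 3 355 44 ∧
    TableColumn 3 4 3983 (91 / 2) ∧
    TableColumn 3 5 13454 47 ∧
    TableColumn 3 6 17791 43 ∧
    TableColumn 3 7 9653 39 ∧
    TableColumn 3 8 2465 35 ∧
    TableColumn 3 9 292 30 ∧
    TableColumn 3 10 37 29 ∧
    TableColumn 3 11 1 (47 / 2) ∧
    TableColumn 3 12 1 24 := by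
  obtain ⟨E, hE, hs⟩ := setup_three.exists_enumerates total_three
  have h := reading hE hs (by decide +kernel) (by decide +kernel)
  have hT : E.length = 48032 := h.total.trans (by decide +kernel)
  exact ⟨by rw [hE.classCount_all, hT]; rfl,
    h.maxVertices hE 12 (by norm_num) (by norm_num) (by decide +kernel) (by decide +kernel),
    h.maxVolume hE 5 94 _ (by norm_num) (by norm_num) (by decide +kernel) (by decide +kernel) (by decide +kernel)
      (eq_ofReal_half (by norm_num)),
    h.tableColumn hE 3 355 88 _ (by norm_num) (by norm_num) (by decide +kernel) (by decide +kernel)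
      (by decide +kernel) (eq_ofReal_half (by norm_num)),
    h.tableColumn hE 4 3983 91 _ (by norm_num) (by norm_num) (by decide +kernel) (by decide +kernel)
      (by decide +kernel) (eq_ofReal_half (div_two_mul_two 91)),
    h.tableColumn hE 5 13454 94 _ (by norm_num) (by norm_num) (by decide +kernel) (by decide +kernel)
      (by decide +kernel) (eq_ofReal_half (by norm_num)),
    h.tableColumn hE 6 17791 86 _ (by norm_num) (by norm_num) (by decide +kernel) (by decide +kernel)
      (by decide +kernel) (eq_ofReal_half (by norm_num)),
    h.tableColumn hE 7 9653 78 _ (by norm_num) (by norm_num) (by decide +kernel) (by decide +kernel)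
      (by decide +kernel) (eq_ofReal_half (by norm_num)),
    h.tableColumn hE 8 2465 70 _ (by norm_num) (by norm_num) (by decide +kernel) (by decide +kernel)
      (by decide +kernel) (eq_ofReal_half (by norm_num)),
    h.tableColumn hE 9 292 60 _ (by norm_num) (by norm_num) (by decide +kernel) (by decide +kernel)
      (by decide +kernel) (eq_ofReal_half (by norm_num)),
    h.tableColumn hE 10 37 58 _ (by norm_num) (by norm_num) (by decide +kernel) (by decide +kernel)
      (by decide +kernel) (eq_ofReal_half (by norm_num)),
    h.tableColumn hE 11 1 47 _ (by norm_num) (by norm_num) (by decide +kernel) (by decide +kernel)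
      (by decide +kernel) (eq_ofReal_half (div_two_mul_two 47)),
    h.tableColumn hE 12 1 48 _ (by norm_num) (by norm_num) (by decide +kernel) (by decide +kernel)
      (by decide +kernel) (eq_ofReal_half (by norm_num))⟩

end Prog
end LDP

namespace LDP
open Set

/-! ### Reflexive polygons -/

theorem dotProduct_eq (x y : Plane) : x ⬝ᵥ y = x 0 * y 0 + x 1 * y 1 := by
  simp [dotProduct, Fin.sum_univ_two]

/-- The determinant bound for `k = 1` is 4, and in the mask computed for the search every type has
residue 1 modulo its determinant. -/
theorem okType_one {e α : ℕ} (he : e ≤ 4) (hα : α < e) (h : OkType 1 e α) : (e : ℤ) ∣ α - 1 := by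
  have ht := (Prog.mask_iff one_pos (by norm_num) he hα).2 h
  rw [Prog.mask_one] at ht
  have key : ∀ e < 5, ∀ α < e, Prog.types_one.testBit (80 * e + α) = true → (e : ℤ) ∣ α - 1 := by
    decide +kernel
  exact key e (by omega) α hα ht

/-- The normal of an edge, scaled to be `-1` on it if the edge has lattice distance one. -/
def normal (p q : Pt) : Pt := ((p.2 - q.2) / cross p q, (q.1 - p.1) / cross p q)

/-- Modulo `cross p q` one has `q ≡ α p ≡ p`. This says that the edge has lattice distance one from
the origin and makes its normal integral. -/
theorem IsCycle.cross_dvd_sub {L : List Pt} (hL : IsCycle 1 L) {p q : Pt} (e : Edge L p q) :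
    cross p q ∣ q.1 - p.1 ∧ cross p q ∣ q.2 - p.2 := by
  have hpos := hL.pos p q e
  have hok := okType_of_hollow (hL.prim p e.left_mem) (hL.prim q e.right_mem) hpos (hL.hollow p q e)
  have hle := cross_le one_pos hL e.left_mem e.right_mem
  have h1 : cross p q ∣ res p q - 1 := by
    obtain ⟨n, hn⟩ := Int.eq_ofNat_of_zero_le hpos.le
    obtain ⟨α, hα⟩ := Int.eq_ofNat_of_zero_le hok.1
    rw [hn, hα] at hok ⊢
    rw [hn] at hle
    exact okType_one (by norm_num at hle; exact_mod_cast hle) (by exact_mod_cast hok.2.1) hok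
  obtain ⟨h2, h3⟩ := cross_dvd_res_sub (q := q) (hL.prim p e.left_mem)
  constructor
  · have := dvd_add h2 (h1.mul_right p.1)
    rwa [show q.1 - res p q * p.1 + (res p q - 1) * p.1 = q.1 - p.1 by ring] at this
  · have := dvd_add h3 (h1.mul_right p.2)
    rwa [show q.2 - res p q * p.2 + (res p q - 1) * p.2 = q.2 - p.2 by ring] at this

theorem IsCycle.orientR_eq {L : List Pt} (hL : IsCycle 1 L) {p q : Pt} (e : Edge L p q)
    (x : Plane) : orientR p q x = cross p q * (1 + x ⬝ᵥ toP (normal p q)) := by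
  obtain ⟨h1, h2⟩ := hL.cross_dvd_sub e
  have h3 : cross p q ∣ p.2 - q.2 := by rw [← neg_sub, dvd_neg]; exact h2
  have e1 : (cross p q : ℝ) * ((normal p q).1 : ℝ) = p.2 - q.2 := by
    exact_mod_cast Int.mul_ediv_cancel' h3
  have e2 : (cross p q : ℝ) * ((normal p q).2 : ℝ) = q.1 - p.1 := by
    exact_mod_cast Int.mul_ediv_cancel' h1
  simp only [orientR, crossR, dotProduct_eq, toP_zero, toP_one]
  linear_combination -(x 0) * e1 - x 1 * e2

theorem convex_polarDual (A : Set Plane) : Convex ℝ (polarDual A) := by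
  intro y hy z hz a b ha hb hab x hx
  have h1 := hy x hx
  have h2 := hz x hx
  rw [dotProduct_add, dotProduct_smul, dotProduct_smul, smul_eq_mul, smul_eq_mul]
  nlinarith

theorem finite_edges (L : List Pt) : {e : Pt × Pt | Edge L e.1 e.2}.Finite := by
  refine ((List.finite_toSet L).prod (List.finite_toSet L)).subset ?_
  rintro ⟨p, q⟩ e
  exact ⟨e.left_mem, e.right_mem⟩

/-- The polygon is the polar of its edge normals by `IsCycle.orientR_eq`, so the claim is a bipolar
theorem; a point outside the hull of the normals is separated from them by a linear functional `x`.
-/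
theorem IsCycle.polarDual_hull {L : List Pt} (hL : IsCycle 1 L) :
    polarDual (hull L) =
      convexHull ℝ ((fun e : Pt × Pt => toP (normal e.1 e.2)) '' {e | Edge L e.1 e.2}) := by
  have hfin := (finite_edges L).image fun e : Pt × Pt => toP (normal e.1 e.2)
  apply subset_antisymm
  · intro y hy
    by_contra hc
    obtain ⟨f, u, hu, hf⟩ := geometric_hahn_banach_point_closed (convex_convexHull ℝ _)
      (hfin.isClosed_convexHull ℝ) hc
    set x : Plane := ![f ![1, 0], f ![0, 1]] with hx
    have hfx : ∀ z, f z = x ⬝ᵥ z := by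
      intro z
      have : z = z 0 • (![1, 0] : Plane) + z 1 • (![0, 1] : Plane) := by
        apply plane_ext <;> simp
      conv_lhs => rw [this]
      rw [map_add, map_smul, map_smul, dotProduct_eq]
      simp [hx]; ring
    have hedge : ∀ p q, Edge L p q → u < x ⬝ᵥ toP (normal p q) := by
      intro p q e
      rw [← hfx]
      exact hf _ (subset_convexHull ℝ _ ⟨(p, q), e, rfl⟩)
    -- Since `x` exceeds `u` on all normals, `t x` satisfies every edge inequality as long as `t u ≥
    -- -1`.
    have hmem : ∀ t : ℝ, 0 ≤ t → -1 ≤ t * u → t • x ∈ hull L := by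
      intro t ht htu
      refine mem_hull hL.three hL.triple fun p q e => ?_
      rw [hL.orientR_eq e, smul_dotProduct, smul_eq_mul]
      have h1 : (0 : ℝ) < cross p q := by exact_mod_cast hL.pos p q e
      have h2 := mul_le_mul_of_nonneg_left (hedge p q e).le ht
      exact mul_nonneg h1.le (by linarith)
    rw [hfx] at hu
    -- For negative `u`, the factor `t = -1 / u` gives a point of the polygon whose product with `y`
    -- is below `-1`. For `u ≥ 0` the polygon would contain a whole ray.
    rcases lt_or_ge u 0 with hneg | hnonneg
    · have h1 := hy _ (hmem (-u⁻¹) (by simpa using hneg.le) (by rw [neg_mul, inv_mul_cancel₀ hneg.ne]))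
      rw [smul_dotProduct, smul_eq_mul] at h1
      have h2 : u⁻¹ < 0 := inv_lt_zero.2 hneg
      have h3 := mul_lt_mul_of_neg_left hu h2
      rw [inv_mul_cancel₀ hneg.ne] at h3
      linarith
    · obtain ⟨a, ha⟩ : ∃ a, a ∈ L := List.exists_mem_of_length_pos (by have := hL.three; omega)
      obtain ⟨b, e⟩ := exists_edge_from (by have := hL.three; omega) ha
      have hx0 : x ≠ 0 := by
        intro h0
        have := hedge a b e
        rw [h0, zero_dotProduct] at this
        linarith
      obtain ⟨R, hR⟩ := ((finite_toP L).isCompact_convexHull ℝ).isBounded.exists_norm_le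
      have hn : 0 < ‖x‖ := norm_pos_iff.2 hx0
      have hR0 : 0 ≤ R := (norm_nonneg _).trans (hR _ (toP_mem_hull ha))
      have h1 := hR _ (hmem ((R + 1) / ‖x‖) (by positivity)
        (le_trans (by norm_num) (mul_nonneg (by positivity) hnonneg)))
      rw [norm_smul, Real.norm_of_nonneg (by positivity), div_mul_cancel₀ _ hn.ne'] at h1
      linarith
  · refine convexHull_min ?_ (convex_polarDual _)
    rintro _ ⟨⟨p, q⟩, e, rfl⟩ x hx
    have h1 := orientR_nonneg hL.triple e hx
    rw [hL.orientR_eq e] at h1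
    have h2 : (0 : ℝ) < cross p q := by exact_mod_cast hL.pos p q e
    have := nonneg_of_mul_nonneg_right h1 h2
    change -1 ≤ x ⬝ᵥ toP (normal p q)
    linarith

theorem isReflexive_of_mem_hollowLDP {A : Set Plane} (hA : A ∈ hollowLDP 1) : IsReflexive A := by
  obtain ⟨L, hL, rfl⟩ := exists_isCycle one_pos hA
  refine ⟨⟨hA.1.isPolytope, fun v hv => ?_⟩, hA.1.zero_mem_interior, ?_⟩
  · obtain ⟨a, b, -, h⟩ := hA.1.primitive_vertices v hv
    exact ⟨a, b, h⟩
  · rw [hL.polarDual_hull]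
    refine ⟨⟨_, (finite_edges L).image _, rfl⟩, fun v hv => ?_⟩
    obtain ⟨e, -, rfl⟩ := extremePoints_convexHull_subset hv
    exact ⟨_, _, rfl⟩

/-! ### From reflexive polygons to almost 1-hollow ones -/

theorem exists_smul_mem_of_mem_interior {A : Set Plane} {x : Plane} (hx : x ∈ interior A)
    (d : Plane) : ∃ ε : ℝ, 0 < ε ∧ x + ε • d ∈ A ∧ x - ε • d ∈ A := by
  have hcont : Continuous fun t : ℝ => x + t • d := by fun_prop
  have h0 : (fun t : ℝ => x + t • d) ⁻¹' (interior A) ∈ nhds (0 : ℝ) :=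
    (isOpen_interior.preimage hcont).mem_nhds (by simpa using hx)
  obtain ⟨ε, hε, hball⟩ := Metric.mem_nhds_iff.1 h0
  have h1 : ε / 2 ∈ Metric.ball (0 : ℝ) ε := by
    rw [Metric.mem_ball, Real.dist_eq, sub_zero, abs_of_pos (by positivity)]; linarith
  have h2 : -(ε / 2) ∈ Metric.ball (0 : ℝ) ε := by
    rw [Metric.mem_ball, Real.dist_eq, sub_zero, abs_neg, abs_of_pos (by positivity)]; linarith
  refine ⟨ε / 2, by positivity, interior_subset (hball h1), ?_⟩
  have := interior_subset (hball h2)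
  simpa only [mem_preimage, neg_smul, ← sub_eq_add_neg] using this

/-- The only interior lattice point of a reflexive polygon is the origin. -/
theorem IsReflexive.eq_zero_of_mem_interior {A : Set Plane} (hA : IsReflexive A) {a b : ℤ}
    (h : latticePoint a b ∈ interior A) : latticePoint a b = 0 := by
  obtain ⟨ε, hε, hmem, -⟩ := exists_smul_mem_of_mem_interior h (latticePoint a b)
  have hB := (convexHull_vertices hA.2.2.1).2
  -- A slightly larger multiple of the interior lattice point still lies in `A`, so its product with
  -- a vertex of the dual is strictly greater than `-1`. Both vectors are integral, hence the
  -- product is nonnegative.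
  have hpos : polarDual A ⊆ {y | 0 ≤ latticePoint a b ⬝ᵥ y} := by
    rw [← hB]
    refine convexHull_min (fun v hv => ?_) ?_
    · have hvB : v ∈ polarDual A := hv.1
      have h1 := hvB _ hmem
      obtain ⟨c, d, rfl⟩ := hA.2.2.2 v hv
      have h2 : latticePoint a b ⬝ᵥ latticePoint c d = ((a * c + b * d : ℤ) : ℝ) := by
        rw [dotProduct_eq]; simp [latticePoint]
      rw [add_dotProduct, smul_dotProduct, smul_eq_mul, h2] at h1
      rw [mem_ofPred_eq, h2]
      by_contra hc
      have h3 : a * c + b * d ≤ -1 := by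
        have : a * c + b * d < 0 := by rw [not_le] at hc; exact_mod_cast hc
        omega
      have h4 : ((a * c + b * d : ℤ) : ℝ) ≤ -1 := by exact_mod_cast h3
      nlinarith
    · intro y hy z hz s t hs ht hst
      rw [mem_ofPred_eq] at *
      rw [dotProduct_add, dotProduct_smul, dotProduct_smul, smul_eq_mul, smul_eq_mul]
      positivity
  obtain ⟨S, hS, rfl⟩ := hA.1.1
  have hcont : Continuous fun x : Plane => x ⬝ᵥ latticePoint a b := by
    simp only [dotProduct_eq]; fun_prop
  obtain ⟨C, hC⟩ := ((hS.isCompact_convexHull ℝ).image hcont).isBounded.exists_norm_le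
  have hC' : ∀ x ∈ convexHull ℝ S, |x ⬝ᵥ latticePoint a b| ≤ C := fun x hx => hC _ ⟨x, hx, rfl⟩
  have hC0 : 0 ≤ C := (abs_nonneg _).trans (hC' _ (interior_subset h))
  -- The dual of a bounded set contains a small negative multiple of any vector. For the given
  -- lattice point its product with the point is nonnegative only if the point is zero.
  have hm : (-(C + 1)⁻¹) • latticePoint a b ∈ polarDual (convexHull ℝ S) := by
    intro x hx
    rw [dotProduct_smul, smul_eq_mul, neg_mul, neg_le_neg_iff, inv_mul_le_iff₀ (by positivity)]
    linarith [le_abs_self (x ⬝ᵥ latticePoint a b), hC' x hx]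
  have h5 := hpos hm
  rw [mem_ofPred_eq, dotProduct_smul, smul_eq_mul, dotProduct_eq] at h5
  have h6 : 0 < (C + 1)⁻¹ := by positivity
  have h7 : latticePoint a b 0 * latticePoint a b 0 + latticePoint a b 1 * latticePoint a b 1 ≤ 0 := by
    nlinarith
  have h8 := mul_self_nonneg (latticePoint a b 0)
  have h9 := mul_self_nonneg (latticePoint a b 1)
  exact plane_ext (mul_self_eq_zero.1 (by linarith)) (mul_self_eq_zero.1 (by linarith))

/-- If a vertex were `g` times a lattice vector with `g > 1`, that vector would be an interior
lattice point, hence zero; but the interior point `0` is not a vertex. -/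
theorem mem_hollowLDP_of_isReflexive {A : Set Plane} (hA : IsReflexive A) : A ∈ hollowLDP 1 := by
  have hconv : Convex ℝ A := by
    obtain ⟨S, -, rfl⟩ := hA.1.1
    exact convex_convexHull ℝ S
  refine ⟨⟨hA.1.1, hA.2.1, fun v hv => ?_⟩, ?_⟩
  · obtain ⟨a, b, rfl⟩ := hA.1.2 v hv
    have hv0 : latticePoint a b ≠ 0 := by
      intro h0
      rw [h0] at hv
      obtain ⟨ε, hε, h1, h2⟩ := exists_smul_mem_of_mem_interior hA.2.1 ![1, 0]
      have h3 : (0 : Plane) ∈ openSegment ℝ (0 + ε • (![1, 0] : Plane)) (0 - ε • (![1, 0] : Plane)) :=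
        ⟨1 / 2, 1 / 2, by norm_num, by norm_num, by norm_num, by simp⟩
      have h4 := congrFun ((mem_extremePoints.1 hv).2 _ h1 _ h2 h3).1 0
      simp at h4
      exact hε.ne' h4
    refine ⟨a, b, ?_, rfl⟩
    rw [Int.isCoprime_iff_gcd_eq_one]
    by_contra hg
    obtain ⟨c, hc⟩ := Int.gcd_dvd_left a b
    obtain ⟨d, hd⟩ := Int.gcd_dvd_right a b
    set g := Int.gcd a b with hgdef
    have hg0 : g ≠ 0 := by
      intro h0
      rw [h0] at hc hd
      apply hv0
      rw [hc, hd]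
      apply plane_ext <;> simp [latticePoint]
    have hg2 : (1 : ℝ) < g := by
      have : 1 < g := by omega
      exact_mod_cast this
    have heq : latticePoint a b = (g : ℝ) • latticePoint c d := by
      apply plane_ext
      · simp only [latticePoint, Pi.smul_apply, Matrix.cons_val_zero, smul_eq_mul]
        exact_mod_cast hc
      · simp only [latticePoint, Pi.smul_apply, Matrix.cons_val_one, Matrix.cons_val_zero, smul_eq_mul]
        exact_mod_cast hd
    have hin := combo_mem_interior hconv hA.2.1 hv.1 hv.1 (a := (g : ℝ)⁻¹) (b := 0) (by positivity)
      le_rfl (by rw [add_zero]; exact inv_lt_one_of_one_lt₀ hg2)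
    rw [zero_smul, add_zero] at hin
    have h1 : (g : ℝ)⁻¹ • latticePoint a b = latticePoint c d := by
      rw [heq, inv_smul_smul₀ (by positivity)]
    rw [h1] at hin
    apply hv0
    rw [heq, hA.eq_zero_of_mem_interior hin, smul_zero]
  · apply subset_antisymm
    · rintro _ ⟨hx, a, b, rfl⟩
      rw [Nat.cast_one, one_smul] at hx ⊢
      exact hA.eq_zero_of_mem_interior hx
    · rintro _ rfl
      exact ⟨hA.2.1, 0, 0, by apply plane_ext <;> simp [latticePoint]⟩

/-- The almost `1`-hollow LDP-polygons are the reflexive polygons. -/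
theorem mem_hollowLDP_one_iff (A : Set Plane) : A ∈ hollowLDP 1 ↔ IsReflexive A :=
  ⟨isReflexive_of_mem_hollowLDP, mem_hollowLDP_of_isReflexive⟩

end LDP

theorem theorem4p10 :
    (LDP.classCount (LDP.hollowLDP 1) = 16 ∧
      (∀ A : Set LDP.Plane, A ∈ LDP.hollowLDP 1 ↔ LDP.IsReflexive A) ∧
      LDP.MaxVertices (LDP.hollowLDP 1) 6 ∧
      LDP.MaxVolume (LDP.hollowLDP 1) (9 / 2) ∧
      LDP.TableColumn 1 3 5 (9 / 2) ∧
      LDP.TableColumn 1 4 7 4 ∧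
      LDP.TableColumn 1 5 3 (7 / 2) ∧
      LDP.TableColumn 1 6 1 3) ∧
    (LDP.classCount (LDP.hollowLDP 2) = 505 ∧
      LDP.MaxVertices (LDP.hollowLDP 2) 8 ∧
      LDP.MaxVolume (LDP.hollowLDP 2) 17 ∧
      LDP.TableColumn 2 3 42 16 ∧
      LDP.TableColumn 2 4 181 16 ∧
      LDP.TableColumn 2 5 202 17 ∧
      LDP.TableColumn 2 6 74 (33 / 2) ∧
      LDP.TableColumn 2 7 5 14 ∧
      LDP.TableColumn 2 8 1 14) ∧
    (LDP.classCount (LDP.hollowLDP 3) = 48032 ∧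
      LDP.MaxVertices (LDP.hollowLDP 3) 12 ∧
      LDP.MaxVolume (LDP.hollowLDP 3) 47 ∧
      LDP.TableColumn 3 3 355 44 ∧
      LDP.TableColumn 3 4 3983 (91 / 2) ∧
      LDP.TableColumn 3 5 13454 47 ∧
      LDP.TableColumn 3 6 17791 43 ∧
      LDP.TableColumn 3 7 9653 39 ∧
      LDP.TableColumn 3 8 2465 35 ∧
      LDP.TableColumn 3 9 292 30 ∧
      LDP.TableColumn 3 10 37 29 ∧
      LDP.TableColumn 3 11 1 (47 / 2) ∧
      LDP.TableColumn 3 12 1 24) :=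
  ⟨⟨LDP.Prog.table_one.1, LDP.mem_hollowLDP_one_iff, LDP.Prog.table_one.2⟩,
    LDP.Prog.table_two, LDP.Prog.table_three⟩
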